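/- **Conventions.** A function $f:\mathbb N\to\mathbb R_{\ge 0}$ is *negligible* if $n^k f(n)\to 0$ for every $k\in\mathbb N$. A *polynomial-time quantum algorithm* is a map that sends a classical input (a tuple of bit strings) to a quantum circuit, such that a deterministic Turing machine computes the description of the circuit from the input in polynomial time; the circuit, over the gates $H$, $T$, $X$, CNOT, Toffoli, is run on $|0\cdots0\rangle$ and designated wires are measured at the end. An algorithm with quantum access to $\mathcal O:\{0,1\}^d\to\{0,1\}^m$ may in addition use query gates $|y,u\rangle\mapsto|y,u\oplus\mathcal O(y)\rangle$. **Witness search.** Let $\mathsf{Samp}$ be an instance sampler: on input $1^n$ it outputs a random triple $(pk,w,P)$ of a string $pk$, a witness $w$ and a predicate $P$ with $P(pk,w)=1$, where $pk$ and $w$ have lengths that depend only on $n$ and are polynomially bounded. Put $W_{pk}=\{w': P(pk,w')=1\}$. The witness-search game $\mathsf{WS}(\mathsf{Samp})$ is *hard* if for every polynomial-time quantum algorithm $\mathcal A$ (without oracle) the probability that $\mathcal A(1^n,pk)$ outputs some $\hat w\in W_{pk}$, where $(pk,w,P)\gets\mathsf{Samp}(1^n)$, is negligible in $n$. **Experiments.**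 Let $\ell_x,\ell_z:\mathbb N\to\mathbb N$, let $\ell_w(n)$ be the length of witnesses, and let $(\mathcal A_1,\mathcal A_2)$ be polynomial-time quantum algorithms with quantum access to an oracle $\{0,1\}^{\ell_x(n)+\ell_w(n)}\to\{0,1\}^{\ell_z(n)}$. Experiment $E$: 1. Generate $(pk,w,P)\gets\mathsf{Samp}(1^n)$. 2. Draw $\mathcal O:\{0,1\}^{\ell_x(n)+\ell_w(n)}\to\{0,1\}^{\ell_z(n)}$ uniformly at random from all such functions. 3. $\mathcal A_1$, on input $(1^n,pk)$ and with quantum access to $\mathcal O$, outputs a classical string $x\in\{0,1\}^{\ell_x(n)}$. 4. Set $z:=\mathcal O(x\|w)$. 5. $\mathcal A_2$, given $(1^n,pk,x,w,z)$, the final quantum state of $\mathcal A_1$ and quantum access to $\mathcal O$, outputs a bit $b$. Experiment $E'$: the same, except that in step 4 a uniformly random $z\in\{0,1\}^{\ell_z(n)}$ is drawn, independently of everything else, and $\mathcal O'$ is defined by $\mathcal O'(x\|w)=z$ and $\mathcal O'(y)=\mathcal O(y)$ for $y\ne x\|w$; in step 5, $\mathcal A_2$ has quantum access to $\mathcal O'$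 instead of $\mathcal O$. **Lemma (Hardness of Witness-Search to Programming QRO).** If $\mathsf{WS}(\mathsf{Samp})$ is hard, then for all such $(\mathcal A_1,\mathcal A_2)$ $$\mathrm{ADV}(n):=\Bigl|\Pr_{E}[b=1]-\Pr_{E'}[b=1]\Bigr|$$ is negligible in $n$. -/

import Mathlib

open scoped BigOperators

noncomputable section

namespace QRO

/-- Bit strings of length `k`. -/
abbrev BitString (k : ℕ) : Type := Fin k → Bool

/-- Negligible functions of the security parameter. -/
def Negligible (f : ℕ → ℝ) : Prop :=
  Asymptotics.SuperpolynomialDecay Filter.atTop (fun n : ℕ => (n : ℝ)) f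

/-! ### Quantum oracle circuits

Wires are numbered by `ℕ`; a circuit touches finitely many of them, and all wires start in `|0⟩`.
A computational basis state is given by the finite set of the wires that carry the value `1`. -/

/-- Elementary gates (a universal set) and oracle queries. In `cnot i j` and `toffoli i j k` the
last wire is the target. `query ins outs` is `|x, y⟩ ↦ |x, y ⊕ O(x)⟩`, with `x` on the wires `ins`
and `y` on the wires `outs`. -/
inductive Gate : Type
  | hadamard (i : ℕ)
  | phaseT (i : ℕ)
  | pauliX (i : ℕ)
  | cnot (i j : ℕ)
  | toffoli (i j k : ℕ)
  | query (ins outs : List ℕ)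

/-- A circuit: a sequence of gates, and the wires that are measured at the end as the output. -/
structure Circuit : Type where
  gates : List Gate
  out : List ℕ

/-- The wires of a gate are distinct, and queries fit an oracle from `d` bits to `m` bits. -/
def Gate.WellFormed (d m : ℕ) : Gate → Prop
  | .hadamard _ => True
  | .phaseT _ => True
  | .pauliX _ => True
  | .cnot i j => i ≠ j
  | .toffoli i j k => [i, j, k].Nodup
  | .query ins outs => ins.length = d ∧ outs.length = m ∧ (ins ++ outs).Nodup

/-- The gate is not an oracle query. -/
def Gate.IsElementary : Gate → Prop
  | .query _ _ => False
  | _ => True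

/-- All gates are well-formed. -/
def Circuit.WellFormed (d m : ℕ) (C : Circuit) : Prop :=
  ∀ g ∈ C.gates, g.WellFormed d m

/-- The circuit makes no oracle query. -/
def Circuit.QueryFree (C : Circuit) : Prop :=
  ∀ g ∈ C.gates, g.IsElementary

/-- (Unnormalized) state vectors. -/
abbrev State : Type := Finset ℕ →₀ ℂ

/-- The all-zero state `|0…0⟩`. -/
def ketZero : State := Finsupp.single ∅ 1

/-- The squared norm of a state vector. -/
def normSq (ψ : State) : ℝ := ψ.sum fun _ c => ‖c‖ ^ 2

/-- The values of the listed wires in a basis state. -/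
def readWires (ws : List ℕ) (s : Finset ℕ) : List Bool := ws.map fun i => decide (i ∈ s)

/-- The (unnormalized) state after the listed wires have been measured with outcome `v`; its
squared norm is the probability of that outcome. -/
def project (ws : List ℕ) (v : List Bool) (ψ : State) : State :=
  ψ.filter fun s => readWires ws s = v

/-- The query input that the wires `ins` (of which there are `d` in a well-formed query) carry. -/
def queryInput (d : ℕ) (ins : List ℕ) (s : Finset ℕ) : BitString d :=
  fun i => decide (ins.getD i 0 ∈ s)

/-- Those wires among `outs` (of which there are `m` in a well-formed query) at whose positions
the answer `y` has a `1`. -/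
def onesOf {m : ℕ} (outs : List ℕ) (y : BitString m) : Finset ℕ :=
  (Finset.univ.filter fun i : Fin m => y i = true).image fun i : Fin m => outs.getD (i : ℕ) 0

/-- The action of a gate on a basis state. -/
def Gate.onBasis {d m : ℕ} (O : BitString d → BitString m) : Gate → Finset ℕ → State
  | .hadamard i, s =>
      ((1 / Real.sqrt 2 : ℝ) : ℂ) •
        (Finsupp.single (s.erase i) 1 + Finsupp.single (insert i s) (if i ∈ s then -1 else 1))
  | .phaseT i, s =>
      Finsupp.single s (if i ∈ s then Complex.exp (Real.pi / 4 * Complex.I) else 1)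
  | .pauliX i, s => Finsupp.single (symmDiff s {i}) 1
  | .cnot i j, s => Finsupp.single (if i ∈ s then symmDiff s {j} else s) 1
  | .toffoli i j k, s => Finsupp.single (if i ∈ s ∧ j ∈ s then symmDiff s {k} else s) 1
  | .query ins outs, s => Finsupp.single (symmDiff s (onesOf outs (O (queryInput d ins s)))) 1

/-- The action of a gate on state vectors, by linear extension. -/
def Gate.apply {d m : ℕ} (O : BitString d → BitString m) (g : Gate) : State →ₗ[ℂ] State :=
  Finsupp.linearCombination ℂ (g.onBasis O)

/-- Runs a sequence of gates, the first one first. -/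
def run {d m : ℕ} (O : BitString d → BitString m) (gs : List Gate) (ψ : State) : State :=
  gs.foldl (fun φ g => g.apply O φ) ψ

/-! ### Polynomial-time quantum algorithms

A quantum algorithm with classical input is a map that sends the input to a circuit; it runs in
polynomial time if a deterministic Turing machine computes the description of the circuit from the
input in polynomial time. -/

/-- The alphabet in which circuits are described. -/
inductive Symbol : Type
  | hadamard | phaseT | pauliX | cnot | toffoli | query | output
  | tick | endWire | endList

/-- The wire number `i` in unary. -/
def encodeWire (i : ℕ) : List Symbol := List.replicate i Symbol.tick ++ [Symbol.endWire]

def encodeWires (ws : List ℕ) : List Symbol := ws.flatMap encodeWire ++ [Symbol.endList]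

def Gate.encode : Gate → List Symbol
  | .hadamard i => Symbol.hadamard :: encodeWire i
  | .phaseT i => Symbol.phaseT :: encodeWire i
  | .pauliX i => Symbol.pauliX :: encodeWire i
  | .cnot i j => Symbol.cnot :: (encodeWire i ++ encodeWire j)
  | .toffoli i j k => Symbol.toffoli :: (encodeWire i ++ encodeWire j ++ encodeWire k)
  | .query ins outs => Symbol.query :: (encodeWires ins ++ encodeWires outs)

/-- The description of a circuit. -/
def Circuit.encode (C : Circuit) : List Symbol :=
  C.gates.flatMap Gate.encode ++ Symbol.output :: encodeWires C.out

/-- A tuple of bit strings, each followed by the separator `none`. -/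
def encodeInput (l : List (List Bool)) : List (Option Bool) :=
  l.flatMap fun s => s.map some ++ [none]

/-- A quantum algorithm whose classical input is a tuple of bit strings. -/
abbrev QAlgorithm : Type := List (List Bool) → Circuit

def QAlgorithm.PolyTime (A : QAlgorithm) : Prop :=
  Nonempty (Turing.TM2ComputableInPolyTime encodeInput Circuit.encode A)

/-- The security parameter in unary, `1ⁿ`. -/
def unary (n : ℕ) : List Bool := List.replicate n true

/-! ### Witness search -/

/-- An instance-sampling algorithm: on `1ⁿ` it outputs public information `pk`, a witness `w` and a
predicate `P` with `P(pk, w) = 1`. The lengths of `pk` and `w` are polynomially bounded. -/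
structure Sampler where
  pkLen : ℕ → ℕ
  wLen : ℕ → ℕ
  pkLen_le : ∃ p : Polynomial ℕ, ∀ n, pkLen n ≤ p.eval n
  wLen_le : ∃ p : Polynomial ℕ, ∀ n, wLen n ≤ p.eval n
  dist : (n : ℕ) → PMF (BitString (pkLen n) × BitString (wLen n) ×
    (BitString (pkLen n) → BitString (wLen n) → Bool))
  valid : ∀ n, ∀ t ∈ (dist n).support, t.2.2 t.1 t.2.1 = true

/-- The expected value of `f (pk, w, P)` over `(pk, w, P) ← Samp(1ⁿ)`. -/
def Sampler.expect (S : Sampler) (n : ℕ)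
    (f : BitString (S.pkLen n) → BitString (S.wLen n) →
      (BitString (S.pkLen n) → BitString (S.wLen n) → Bool) → ℝ) : ℝ :=
  ∑ t, (S.dist n t).toReal * f t.1 t.2.1 t.2.2

/-- The probability that the circuit `C`, run with the oracle `O` on `|0…0⟩`, outputs `v`. -/
def outputProb {d m : ℕ} (O : BitString d → BitString m) (C : Circuit) (v : List Bool) : ℝ :=
  normSq (project C.out v (run O C.gates ketZero))

/-- The probability that `A`, on input `(1ⁿ, pk)`, wins the witness-search game, that is, outputs
some `ŵ` with `P(pk, ŵ) = 1`. The oracle on zero bits is a dummy, since `A` makes no queries. -/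
def Sampler.winProb (S : Sampler) (A : QAlgorithm) (n : ℕ) : ℝ :=
  S.expect n fun pk _ P =>
    ∑ v ∈ Finset.univ.filter (fun v => P pk v = true),
      outputProb (fun y : BitString 0 => y) (A [unary n, List.ofFn pk]) (List.ofFn v)

/-- Witness search is hard: every polynomial-time quantum algorithm wins with negligible
probability. -/
def Sampler.WSHard (S : Sampler) : Prop :=
  ∀ A : QAlgorithm, A.PolyTime →
    (∀ (n : ℕ) (pk : BitString (S.pkLen n)),
      (A [unary n, List.ofFn pk]).WellFormed 0 0 ∧ (A [unary n, List.ofFn pk]).QueryFree) →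
    Negligible (S.winProb A)

/-! ### The two experiments -/

/-- An efficient two-stage adversary in the quantum random-oracle model: `A₁` gets `(1ⁿ, pk)` and
outputs a string `x` of length `xLen n`; `A₂` gets `(1ⁿ, pk, x, w, z)` and continues on the wires of
`A₁`, in their final state. Both may query an oracle from `xLen n + wLen n` bits to `zLen n` bits. -/
structure Adversary (S : Sampler) (xLen zLen : ℕ → ℕ) where
  A₁ : QAlgorithm
  A₂ : QAlgorithm
  polyTime₁ : A₁.PolyTime
  polyTime₂ : A₂.PolyTime
  wellFormed₁ : ∀ (n : ℕ) (pk : BitString (S.pkLen n)),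
    (A₁ [unary n, List.ofFn pk]).WellFormed (xLen n + S.wLen n) (zLen n)
  out₁ : ∀ (n : ℕ) (pk : BitString (S.pkLen n)),
    (A₁ [unary n, List.ofFn pk]).out.length = xLen n
  wellFormed₂ : ∀ (n : ℕ) (pk : BitString (S.pkLen n)) (x : BitString (xLen n))
    (w : BitString (S.wLen n)) (z : BitString (zLen n)),
    (A₂ [unary n, List.ofFn pk, List.ofFn x, List.ofFn w, List.ofFn z]).WellFormed
      (xLen n + S.wLen n) (zLen n)
  out₂ : ∀ (n : ℕ) (pk : BitString (S.pkLen n)) (x : BitString (xLen n))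
    (w : BitString (S.wLen n)) (z : BitString (zLen n)),
    (A₂ [unary n, List.ofFn pk, List.ofFn x, List.ofFn w, List.ofFn z]).out.length = 1

variable {S : Sampler} {xLen zLen : ℕ → ℕ}

/-- The probability that `A₁` with oracle `O₁` outputs `x`, and that then `A₂`, given `w` and `z`,
with oracle `O₂` outputs the bit `1`. -/
def Adversary.prob (A : Adversary S xLen zLen) (n : ℕ) (pk : BitString (S.pkLen n))
    (w : BitString (S.wLen n)) (O₁ O₂ : BitString (xLen n + S.wLen n) → BitString (zLen n))
    (x : BitString (xLen n)) (z : BitString (zLen n)) : ℝ :=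
  let C₁ := A.A₁ [unary n, List.ofFn pk]
  let C₂ := A.A₂ [unary n, List.ofFn pk, List.ofFn x, List.ofFn w, List.ofFn z]
  normSq (project C₂.out [true]
    (run O₂ C₂.gates (project C₁.out (List.ofFn x) (run O₁ C₁.gates ketZero))))

/-- `Pr[b = 1]` in the experiment where `z = O(x‖w)` and both stages have the oracle `O`. -/
def Adversary.probReal (A : Adversary S xLen zLen) (n : ℕ) : ℝ :=
  S.expect n fun pk w _ =>
    𝔼 O : BitString (xLen n + S.wLen n) → BitString (zLen n),
      ∑ x : BitString (xLen n), A.prob n pk w O O x (O (Fin.append x w))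

/-- `Pr[b = 1]` in the experiment where, after `A₁` has output `x`, a uniformly random `z` is drawn
and `A₂` has the oracle that is reprogrammed to `z` at `x‖w`. -/
def Adversary.probProg (A : Adversary S xLen zLen) (n : ℕ) : ℝ :=
  S.expect n fun pk w _ =>
    𝔼 O : BitString (xLen n + S.wLen n) → BitString (zLen n), 𝔼 z : BitString (zLen n),
      ∑ x : BitString (xLen n),
        A.prob n pk w O (Function.update O (Fin.append x w) z) x z

end QRO

end

open scoped BigOperators

noncomputable section

namespace QRO

open Function (update update_self update_of_ne)

section

/-! ### Stack programs and their compilation to Turing machines -/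

/-! Fix an instance with witness `w` and puncture the oracle: it answers zero on every input that
ends with `w`. If the first stage runs with the punctured oracle, the two experiments coincide. The
value at `x‖w` is then uniform and independent of everything the first stage has seen, so reading it
from the oracle and redrawing it have the same effect (`puncture_update`, `expect_update`).
Puncturing moves the final state of the first stage by at most twice the sum, over its queries, of
the norm of the part of the state that queries an input ending with `w` (`norm_run_sub_le`). What
follows is a measurement and contractions, so the acceptance probabilities move by at most a
constant times that distance (`abs_sum_sub_le`). By Cauchy–Schwarz, the squared difference for this
instance is at most a polynomial times the total probability that a measured query of the first
stage ends with `w`.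

A reduction harvests that probability: it runs the first stage, measures the input of a random query
and outputs its last part. Since `w` satisfies the predicate, each such hit wins the witness-search
game. The reduction must be a circuit without oracle and without intermediate measurements, and a
Turing machine must compute it in polynomial time. Three devices achieve this.

The random function becomes a hash function with bounded independence. An amplitude after `q` gates
is a linear combination of functions of at most `q` oracle values, so an outcome probability
involves at most `2 * q` values at a time, and `2 * q`-wise independence gives exactly the same
expectation (`IsIndep.expect_normSq_run`). The key is a polynomial over `𝔽₂`; the input selects a
monic modulus, and the answer consists of some coefficients of the remainder. Independence is a
Chinese-remainder argument (`exists_hash_eq_single`), and in-place long division makes the function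
reversible (`run_hashGates`).

Randomness comes from Hadamard gates. Key and coins show unchanged at the end of each branch, so
branches with different values stay orthogonal and their probabilities add up
(`outputProb_simCircuit`). A query is copied to output wires if all its coins are one; with
probability of order `1 / s` a given query is the only one (`le_card_fires`). Altogether this yields
`sum_expect_hitState_le`.

Finally, the passage from a circuit to its simulation is a rewriting of descriptions. It is written
in a small language of string expressions, each of which runs in polynomial time as a stack program
(`Expr.runs`). Such a program can be appended to the machine that computes the first stage
(`nonempty_polyTime_thenProg`). -/

instance : DecidableEq Symbol := Classical.decEq _

instance : Fintype Symbol where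
  elems := {.hadamard, .phaseT, .pauliX, .cnot, .toffoli, .query, .output, .tick, .endWire,
    .endList}
  complete a := by cases a <;> simp

/-- Structured programs on stacks of symbols, with one register. `loop k P` pops a symbol from `k`
into the register and runs `P`, until `k` is empty. -/
inductive Prog (K : Type) : Type
  | skip
  | push (k : K) (f : Option Symbol → Symbol)
  | pop (k : K)
  | ite (p : Option Symbol → Bool) (P Q : Prog K)
  | seq (P Q : Prog K)
  | loop (k : K) (P : Prog K)

variable {K : Type} [DecidableEq K]

open Function (update)

/-- `Exec P r S t r' S'`: from register `r` and stacks `S`, the program `P` terminates after `t`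
jumps with register `r'` and stacks `S'`. -/
inductive Exec : Prog K → Option Symbol → (K → List Symbol) → ℕ → Option Symbol →
    (K → List Symbol) → Prop
  | skip (r S) : Exec .skip r S 0 r S
  | push (k f r S) : Exec (.push k f) r S 0 r (update S k (f r :: S k))
  | pop (k r S) : Exec (.pop k) r S 0 (S k).head? (update S k (S k).tail)
  | iteTrue {p P Q r S t r' S'} (h : p r = true) (hP : Exec P r S t r' S') :
      Exec (.ite p P Q) r S t r' S'
  | iteFalse {p P Q r S t r' S'} (h : p r = false) (hQ : Exec Q r S t r' S') :
      Exec (.ite p P Q) r S t r' S'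
  | seq {P Q r S t₁ r₁ S₁ t₂ r₂ S₂} (hP : Exec P r S t₁ r₁ S₁) (hQ : Exec Q r₁ S₁ t₂ r₂ S₂) :
      Exec (.seq P Q) r S (t₁ + t₂) r₂ S₂
  | loopNil {k P S} (r) (h : S k = []) : Exec (.loop k P) r S 1 none S
  | loopCons {k P r S a l t₁ r₁ S₁ t₂ r₂ S₂} (h : S k = a :: l)
      (hP : Exec P (some a) (update S k l) t₁ r₁ S₁) (hL : Exec (.loop k P) r₁ S₁ t₂ r₂ S₂) :
      Exec (.loop k P) r S (1 + t₁ + t₂) r₂ S₂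

/-- The labels that the compiled program needs: one for each loop. -/
def Prog.Lab : Prog K → Type
  | .skip => Empty
  | .push _ _ => Empty
  | .pop _ => Empty
  | .ite _ P Q => P.Lab ⊕ Q.Lab
  | .seq P Q => P.Lab ⊕ Q.Lab
  | .loop _ P => Option P.Lab

@[reducible]
def Prog.labFintype : (P : Prog K) → Fintype P.Lab
  | .skip => inferInstanceAs (Fintype Empty)
  | .push _ _ => inferInstanceAs (Fintype Empty)
  | .pop _ => inferInstanceAs (Fintype Empty)
  | .ite _ P Q =>
    letI := P.labFintype
    letI := Q.labFintype
    inferInstanceAs (Fintype (P.Lab ⊕ Q.Lab))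
  | .seq P Q =>
    letI := P.labFintype
    letI := Q.labFintype
    inferInstanceAs (Fintype (P.Lab ⊕ Q.Lab))
  | .loop _ P =>
    letI := P.labFintype
    inferInstanceAs (Fintype (Option P.Lab))

instance (P : Prog K) : Fintype P.Lab := P.labFintype

section Compile

variable {K₁ : Type} [DecidableEq K₁] (Γ₁ : K₁ → Type)

/-- Alphabets of a machine extended by the stacks of a program. -/
abbrev extΓ (K : Type) : K₁ ⊕ K → Type
  | .inl k => Γ₁ k
  | .inr _ => Symbol

variable {Γ₁} {Λ σ : Type}

open Turing.TM2 (stepAux step Cfg)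

abbrev extStk (S₁ : ∀ k, List (Γ₁ k)) (S : K → List Symbol) : ∀ k, List (extΓ Γ₁ K k)
  | .inl k => S₁ k
  | .inr k => S k

theorem update_extStk_inr (S₁ : ∀ k, List (Γ₁ k)) (S : K → List Symbol) (k : K)
    (l : List Symbol) :
    update (extStk S₁ S) (.inr k) l = extStk S₁ (update S k l) := by
  funext j
  rcases j with j | j
  · rw [Function.update_of_ne (by simp)]
  · by_cases h : j = k
    · subst h; simp [extStk]
    · rw [Function.update_of_ne (by simpa using h)]
      simp [extStk, Function.update_of_ne h]

theorem update_extStk_inl (S₁ : ∀ k, List (Γ₁ k)) (S : K → List Symbol) (k : K₁)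
    (l : List (Γ₁ k)) :
    update (extStk S₁ S) (.inl k) l = extStk (update S₁ k l) S := by
  funext j
  rcases j with j | j
  · by_cases h : j = k
    · subst h; simp [extStk]
    · rw [Function.update_of_ne (by simpa using h)]
      simp [extStk, Function.update_of_ne h]
  · rw [Function.update_of_ne (by simp)]

abbrev ExtStmt (Γ₁ : K₁ → Type) (K Λ σ : Type) : Type :=
  Turing.TM2.Stmt (extΓ Γ₁ K) Λ (σ × Option Symbol)

/-- The statement that runs `P` up to its first loop, and continues with `cont`. -/
def Prog.comp : (P : Prog K) → (P.Lab → Λ) → ExtStmt Γ₁ K Λ σ → ExtStmt Γ₁ K Λ σ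
  | .skip, _, cont => cont
  | .push k f, _, cont => .push (.inr k) (fun v => f v.2) cont
  | .pop k, _, cont => .pop (.inr k) (fun v o => (v.1, o)) cont
  | .ite p P Q, emb, cont =>
      .branch (fun v => p v.2) (P.comp (fun l => emb (.inl l)) cont)
        (Q.comp (fun l => emb (.inr l)) cont)
  | .seq P Q, emb, cont =>
      P.comp (fun l => emb (.inl l)) (Q.comp (fun l => emb (.inr l)) cont)
  -- The continuation does not occur here: it is entered from the statement at the label of the
  -- loop, once the stack is empty.
  | .loop _ _, emb, _ => .goto fun _ => emb none

/-- The statements at the labels of `P`, if `P` is continued with `cont`. -/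
def Prog.code : (P : Prog K) → (P.Lab → Λ) → ExtStmt Γ₁ K Λ σ → P.Lab → ExtStmt Γ₁ K Λ σ
  | .skip, _, _ => fun l => nomatch l
  | .push _ _, _, _ => fun l => nomatch l
  | .pop _, _, _ => fun l => nomatch l
  | .ite _ P Q, emb, cont =>
      Sum.elim (P.code (fun l => emb (.inl l)) cont) (Q.code (fun l => emb (.inr l)) cont)
  | .seq P Q, emb, cont =>
      Sum.elim (P.code (fun l => emb (.inl l)) (Q.comp (fun l => emb (.inr l)) cont))
        (Q.code (fun l => emb (.inr l)) cont)
  | .loop k P, emb, cont => fun l =>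
      Option.elim l
        (.pop (.inr k) (fun v o => (v.1, o))
          (.branch (fun v => v.2.isNone) cont
            (P.comp (fun l => emb (some l)) (.goto fun _ => emb none))))
        (P.code (fun l => emb (some l)) (.goto fun _ => emb none))

/-- `n` steps of a machine. -/
abbrev stepN {α : Type} (f : α → Option α) (n : ℕ) (c : Option α) : Option α :=
  (flip bind f)^[n] c

theorem stepN_add {α : Type} {f : α → Option α} {m n : ℕ} {a b c : Option α}
    (h₁ : stepN f m a = b) (h₂ : stepN f n b = c) : stepN f (m + n) a = c := by
  rw [stepN, Nat.add_comm, Function.iterate_add_apply]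
  rw [stepN] at h₁ h₂
  rw [h₁, h₂]

theorem stepN_one {α : Type} (f : α → Option α) (a : α) : stepN f 1 (some a) = f a := rfl

/-- Induction on the run, with the continuation generalized: the first part of a sequence continues
with the compiled second part, the body of a loop with a jump back to its label. One step of a `TM2`
machine executes a statement up to the next jump, which is why only loops cost time in `Exec`. -/
theorem Exec.comp {P : Prog K} {r S t r' S'} (h : Exec P r S t r' S')
    (M : Λ → ExtStmt Γ₁ K Λ σ) (emb : P.Lab → Λ) (cont : ExtStmt Γ₁ K Λ σ)
    (hM : ∀ l, M (emb l) = P.code emb cont l) (v : σ) (S₁ : ∀ k, List (Γ₁ k)) :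
    stepN (step M) t (some (stepAux (P.comp emb cont) (v, r) (extStk S₁ S))) =
      some (stepAux cont (v, r') (extStk S₁ S')) := by
  induction h generalizing cont with
  | skip r S => rfl
  | push k f r S =>
    simp only [Prog.comp, stepAux]
    rw [update_extStk_inr]; rfl
  | pop k r S =>
    simp only [Prog.comp, stepAux]
    rw [update_extStk_inr]; rfl
  | iteTrue h hP ih =>
    simp only [Prog.comp, stepAux, h, cond_true]
    exact ih _ _ fun l => hM (.inl l)
  | iteFalse h hQ ih =>
    simp only [Prog.comp, stepAux, h, cond_false]
    exact ih _ _ fun l => hM (.inr l)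
  | seq hP hQ ih₁ ih₂ =>
    simp only [Prog.comp]
    exact stepN_add (ih₁ _ _ fun l => hM (.inl l)) (ih₂ _ _ fun l => hM (.inr l))
  | @loopNil k P S r h =>
    have h0 : M (emb none) = .pop (.inr k) (fun v o => (v.1, o))
        (.branch (fun v => v.2.isNone) cont
          (P.comp (fun l => emb (some l)) (.goto fun _ => emb none))) := hM none
    rw [stepN_one]
    simp only [Prog.comp, stepAux, step]
    rw [h0]
    simp only [stepAux, update_extStk_inr]
    have h1 : update S k (S k).tail = S := by rw [h, List.tail_nil, ← h, Function.update_eq_self]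
    rw [h1]
    simp [h]
  | @loopCons k P r S a l t₁ r₁ S₁' t₂ r₂ S₂ h hP hL ih₁ ih₂ =>
    have h0 : M (emb none) = .pop (.inr k) (fun v o => (v.1, o))
        (.branch (fun v => v.2.isNone) cont
          (P.comp (fun l => emb (some l)) (.goto fun _ => emb none))) := hM none
    have h1 : stepN (step M) 1 (some (stepAux ((Prog.loop k P).comp emb cont) (v, r)
        (extStk S₁ S))) = some (stepAux (P.comp (fun l => emb (some l)) (.goto fun _ => emb none))
          (v, some a) (extStk S₁ (update S k l))) := by
      rw [stepN_one]
      simp only [Prog.comp, stepAux, step]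
      rw [h0]
      simp only [stepAux, update_extStk_inr]
      simp [h]
    refine stepN_add (stepN_add h1 (ih₁ _ _ fun l => hM (some l))) ?_
    exact ih₂ _ _ hM

end Compile

end

/-! ### Appending a stack program to a polynomial-time machine -/

section Sequence

variable {K : Type} [DecidableEq K] {K₁ : Type} [DecidableEq K₁] {Γ₁ : K₁ → Type}
  {Λ₁ Λ σ : Type}

open Turing Turing.TM2

/-- A statement of a machine as a statement of an extended machine, which jumps to `tgt` instead of
halting. -/
def liftStmt (K : Type) (emb : Λ₁ → Λ) (tgt : Λ) : Stmt Γ₁ Λ₁ σ → ExtStmt Γ₁ K Λ σ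
  | .push k f q => .push (.inl k) (fun v => f v.1) (liftStmt K emb tgt q)
  | .peek k f q => .peek (.inl k) (fun v o => (f v.1 o, v.2)) (liftStmt K emb tgt q)
  | .pop k f q => .pop (.inl k) (fun v o => (f v.1 o, v.2)) (liftStmt K emb tgt q)
  | .load f q => .load (fun v => (f v.1, v.2)) (liftStmt K emb tgt q)
  | .branch f q₁ q₂ => .branch (fun v => f v.1) (liftStmt K emb tgt q₁) (liftStmt K emb tgt q₂)
  | .goto f => .goto fun v => emb (f v.1)
  | .halt => .goto fun _ => tgt

def liftCfg (emb : Λ₁ → Λ) (tgt : Λ) (r : Option Symbol) (S : K → List Symbol)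
    (c : Cfg Γ₁ Λ₁ σ) : Cfg (extΓ Γ₁ K) Λ (σ × Option Symbol) :=
  ⟨some (c.l.elim tgt emb), (c.var, r), extStk c.stk S⟩

theorem stepAux_liftStmt (emb : Λ₁ → Λ) (tgt : Λ) (r : Option Symbol) (S : K → List Symbol)
    (q : Stmt Γ₁ Λ₁ σ) (v : σ) (S₁ : ∀ k, List (Γ₁ k)) :
    stepAux (liftStmt K emb tgt q) (v, r) (extStk S₁ S) =
      liftCfg emb tgt r S (stepAux q v S₁) := by
  induction q generalizing v S₁ with
  | push k f q ih => simp only [liftStmt, stepAux]; rw [update_extStk_inl, ih]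
  | peek k f q ih => simp only [liftStmt, stepAux]; rw [ih]
  | pop k f q ih => simp only [liftStmt, stepAux]; rw [update_extStk_inl, ih]
  | load f q ih => simp only [liftStmt, stepAux]; rw [ih]
  | branch f q₁ q₂ ih₁ ih₂ =>
    simp only [liftStmt, stepAux]
    cases f v
    · simp only [cond_false, ih₂]
    · simp only [cond_true, ih₁]
  | goto f => rfl
  | halt => rfl

theorem stepN_succ_some {α : Type} {f : α → Option α} {n : ℕ} {a : Option α} {c : α}
    (h : stepN f (n + 1) a = some c) : ∃ b, stepN f n a = some b ∧ f b = some c := by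
  rw [stepN, Function.iterate_succ_apply'] at h
  change (stepN f n a).bind f = some c at h
  exact Option.bind_eq_some_iff.1 h

/-- The extended machine mirrors the original one step by step. The last configuration may be
halted, and then becomes one at `tgt`; no earlier one is, since a halted configuration has no
successor. -/
theorem stepN_lift (m : Λ₁ → Stmt Γ₁ Λ₁ σ) (M : Λ → ExtStmt Γ₁ K Λ σ) (emb : Λ₁ → Λ) (tgt : Λ)
    (hM : ∀ l, M (emb l) = liftStmt K emb tgt (m l)) (r : Option Symbol) (S : K → List Symbol)
    (n : ℕ) (c c' : Cfg Γ₁ Λ₁ σ) (h : stepN (step m) n (some c) = some c') :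
    stepN (step M) n (some (liftCfg emb tgt r S c)) = some (liftCfg emb tgt r S c') := by
  induction n generalizing c' with
  | zero => cases h; rfl
  | succ n ih =>
    obtain ⟨b, hb, hbc⟩ := stepN_succ_some h
    refine stepN_add (ih b hb) ?_
    rw [stepN_one]
    obtain ⟨l, v, S₁⟩ := b
    cases l with
    | none => simp [step] at hbc
    | some l =>
      simp only [step, Option.some.injEq] at hbc
      subst hbc
      simp only [liftCfg, Option.elim, step]
      rw [hM, stepAux_liftStmt]
      rfl

/-- The number of `push` operations in a statement. -/
def pushes : Stmt Γ₁ Λ₁ σ → ℕ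
  | .push _ _ q => pushes q + 1
  | .peek _ _ q => pushes q
  | .pop _ _ q => pushes q
  | .load _ q => pushes q
  | .branch _ q₁ q₂ => pushes q₁ + pushes q₂
  | .goto _ => 0
  | .halt => 0

theorem length_stepAux_le (q : Stmt Γ₁ Λ₁ σ) (v : σ) (S : ∀ k, List (Γ₁ k)) (k : K₁) :
    ((stepAux q v S).stk k).length ≤ (S k).length + pushes q := by
  induction q generalizing v S with
  | push k' f q ih =>
    simp only [stepAux, pushes]
    refine (ih _ _).trans ?_
    by_cases h : k = k'
    · subst h; simp; omega
    · rw [update_of_ne h]; omega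
  | peek k f q ih => exact ih _ _
  | pop k' f q ih =>
    simp only [stepAux, pushes]
    refine (ih _ _).trans ?_
    by_cases h : k = k'
    · subst h; simp
    · rw [update_of_ne h]
  | load f q ih => exact ih _ _
  | branch f q₁ q₂ ih₁ ih₂ =>
    simp only [stepAux, pushes]
    cases f v
    · exact (ih₂ _ _).trans (by omega)
    · exact (ih₁ _ _).trans (by omega)
  | goto f => simp [stepAux, pushes]
  | halt => simp [stepAux, pushes]

/-- A step executes the statement at one label, so the number of `push` operations at all labels
together bounds the growth of a stack in each step. -/
theorem length_stepN_le [Fintype Λ₁] (m : Λ₁ → Stmt Γ₁ Λ₁ σ) (n : ℕ) (c c' : Cfg Γ₁ Λ₁ σ)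
    (h : stepN (step m) n (some c) = some c') (k : K₁) :
    (c'.stk k).length ≤ (c.stk k).length + n * ∑ l, pushes (m l) := by
  induction n generalizing c' with
  | zero => cases h; simp
  | succ n ih =>
    obtain ⟨b, hb, hbc⟩ := stepN_succ_some h
    have h1 := ih b hb
    obtain ⟨l, v, S₁⟩ := b
    cases l with
    | none => simp [step] at hbc
    | some l =>
      simp only [step, Option.some.injEq] at hbc
      subst hbc
      have h2 := length_stepAux_le (m l) v S₁ k
      have h3 : pushes (m l) ≤ ∑ l, pushes (m l) :=
        Finset.single_le_sum (f := fun l => pushes (m l)) (fun _ _ => Nat.zero_le _)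
          (Finset.mem_univ l)
      simp only at h1
      rw [Nat.succ_mul]
      omega

theorem initList_stk (tm : FinTM2) (s : List (tm.Γ tm.k₀)) :
    (initList tm s).stk = update (fun _ => []) tm.k₀ s := by
  funext k
  by_cases h : k = tm.k₀
  · subst h; simp [initList]
  · simp [initList, h]

theorem haltList_stk (tm : FinTM2) (s : List (tm.Γ tm.k₁)) :
    (haltList tm s).stk = update (fun _ => []) tm.k₁ s := by
  funext k
  by_cases h : k = tm.k₁
  · subst h; simp [haltList]
  · simp [haltList, h]

/-- The statement that moves the output of a machine to the stack `kin`, one symbol at a time, and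
then continues with `cont`. -/
def transferStmt (k₁ : K₁) (dec : Γ₁ k₁ → Symbol) (kin : K) (tgt : Λ) (cont : ExtStmt Γ₁ K Λ σ) :
    ExtStmt Γ₁ K Λ σ :=
  .pop (.inl k₁) (fun v o => (v.1, o.map dec))
    (.branch (fun v => v.2.isNone) cont
      -- The default is never pushed, since this branch is taken only when the register holds a
      -- symbol.
      (.push (.inr kin) (fun v => v.2.getD .tick) (.goto fun _ => tgt)))

/-- Moving symbols one at a time reverses their order, so the program that follows receives its
input reversed. The additional step is the `pop` that finds the stack empty. -/
theorem stepN_transfer (M : Λ → ExtStmt Γ₁ K Λ σ) (k₁ : K₁) (dec : Γ₁ k₁ → Symbol) (kin : K)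
    (tgt : Λ) (cont : ExtStmt Γ₁ K Λ σ) (hM : M tgt = transferStmt k₁ dec kin tgt cont) (v : σ)
    (l : List (Γ₁ k₁)) (r : Option Symbol) (acc : List Symbol) :
    stepN (step M) (l.length + 1) (some ⟨some tgt, (v, r),
        extStk (update (fun _ => []) k₁ l) (update (fun _ => []) kin acc)⟩) =
      some (stepAux cont (v, none) (extStk (fun _ => [])
        (update (fun _ => []) kin ((l.map dec).reverse ++ acc)))) := by
  induction l generalizing acc r with
  | nil =>
    rw [List.length_nil, Nat.zero_add, stepN_one]
    simp only [step]
    rw [hM]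
    simp only [transferStmt, stepAux, extStk]
    rw [update_extStk_inl]
    simp
  | cons a l ih =>
    rw [List.length_cons, Nat.add_comm]
    refine stepN_add (b := _) ?_ (ih (some (dec a)) (dec a :: acc)) |>.trans ?_
    · rw [stepN_one]
      simp only [step]
      rw [hM]
      simp only [transferStmt, stepAux, extStk]
      rw [update_extStk_inl]
      simp only [update_self, List.head?_cons, Option.map_some, Option.isNone_some, cond_false,
        Option.getD_some, List.tail_cons, Function.update_idem]
      rw [update_extStk_inr]
      simp
    · simp

/-- The machine that runs `tm`, moves its output to the stack `kin`, and then runs `P`. -/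
def FinTM2.thenProg (tm : FinTM2) [Fintype K] (dec : tm.Γ tm.k₁ → Symbol) (P : Prog K)
    (kin kout : K) : FinTM2 :=
  letI := tm.kFin
  letI := tm.ΛFin
  letI := tm.σFin
  letI := tm.Γk₀Fin
  { K := tm.K ⊕ K
    k₀ := .inl tm.k₀
    k₁ := .inr kout
    Γ := extΓ tm.Γ K
    Λ := tm.Λ ⊕ Option P.Lab
    main := .inl tm.main
    σ := tm.σ × Option Symbol
    initialState := (tm.initialState, none)
    m := Sum.elim (fun l => liftStmt K .inl (.inr none) (tm.m l)) fun l =>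
      l.elim (transferStmt tm.k₁ dec kin (.inr none) (P.comp (fun l => .inr (some l)) .halt))
        (P.code (fun l => .inr (some l)) .halt) }

theorem eval_mono (p : Polynomial ℕ) {m n : ℕ} (h : m ≤ n) : p.eval m ≤ p.eval n := by
  simp only [Polynomial.eval_eq_sum_range]
  gcongr

/-- The output of a polynomial-time function has polynomial length. -/
theorem length_le_of_polyTime {α β αΓ βΓ : Type} {ea : α → List αΓ} {eb : β → List βΓ} {f : α → β}
    (h : TM2ComputableInPolyTime ea eb f) :
    ∃ q : Polynomial ℕ, ∀ a, (eb (f a)).length ≤ q.eval (ea a).length := by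
  let _ := h.tm.ΛFin
  set c := ∑ l, pushes (h.tm.m l) with hc
  -- At the start the output stack is no longer than the input, and each of the at most `h.time`
  -- steps adds at most `c` symbols.
  let q : Polynomial ℕ := Polynomial.X + h.time * Polynomial.C c
  refine ⟨q, fun a => ?_⟩
  have h1 := (h.outputsFun a).evals_in_steps
  have h2 := length_stepN_le h.tm.m _ _ _ h1 h.tm.k₁
  rw [haltList_stk, initList_stk] at h2
  simp only [update_self, List.length_map] at h2
  refine h2.trans ?_
  have h3 : ((update (fun _ => []) h.tm.k₀
      ((ea a).map h.inputAlphabet.invFun) : ∀ k, List (h.tm.Γ k)) h.tm.k₁).length ≤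
      (ea a).length := by
    by_cases hk : h.tm.k₁ = h.tm.k₀
    · rw [hk]; simp
    · rw [update_of_ne hk]; simp
  simp only [q, Polynomial.eval_add, Polynomial.eval_mul, Polynomial.eval_X, Polynomial.eval_C]
  exact Nat.add_le_add h3 (Nat.mul_le_mul_right _ (h.outputsFun a).steps_le_m)

/-- A function that is computed in polynomial time, followed by a stack program that runs in
polynomial time. -/
theorem nonempty_polyTime_thenProg {α β γ αΓ : Type} {ea : α → List αΓ} {eb : β → List Symbol}
    {ec : γ → List Symbol} {f : α → β} {g : α → γ} (h : TM2ComputableInPolyTime ea eb f)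
    [Fintype K] (P : Prog K) (kin kout : K) (p : Polynomial ℕ) (G : List Symbol → List Symbol)
    -- The input is reversed by the transfer. A correct final configuration has the initial internal
    -- state and only the output stack filled, hence the register `none` and the empty stacks at the
    -- end.
    (hP : ∀ l, ∃ t ≤ p.eval l.length, Exec P none (update (fun _ => []) kin l.reverse) t none
      (update (fun _ => []) kout (G l)))
    (hg : ∀ a, ec (g a) = G (eb (f a))) :
    Nonempty (TM2ComputableInPolyTime ea ec g) := by
  obtain ⟨q, hlen⟩ := length_le_of_polyTime h
  refine ⟨{ tm := FinTM2.thenProg h.tm h.outputAlphabet P kin kout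
            inputAlphabet := h.inputAlphabet
            outputAlphabet := Equiv.refl _
            -- The three phases: the given machine, the transfer of an output of length at most `q`,
            -- and the program on that output.
            time := h.time + (q + 1) + p.comp q
            outputsFun := fun a => ?_ }⟩
  have hex := hP (eb (f a))
  have key := (h.outputsFun a).evals_in_steps
  refine Classical.choice ?_
  obtain ⟨t, ht, hex⟩ := hex
  let M := (FinTM2.thenProg h.tm h.outputAlphabet P kin kout).m
  have e1 := stepN_lift h.tm.m M Sum.inl (Sum.inr none) (fun l => rfl) none (fun _ : K => []) _ _ _
    key
  have e2 := stepN_transfer (K := K) M h.tm.k₁ h.outputAlphabet kin (Sum.inr none)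
    (P.comp (fun l => .inr (some l)) .halt) rfl h.tm.initialState
    ((eb (f a)).map h.outputAlphabet.invFun) none []
  have e3 := hex.comp M (fun l => .inr (some l)) .halt (fun l => rfl) h.tm.initialState
    (fun _ => [])
  have h0 : update (fun _ : K => ([] : List Symbol)) kin [] = fun _ => [] :=
    Function.update_eq_self kin _
  have hdec : ((eb (f a)).map h.outputAlphabet.invFun).map h.outputAlphabet = eb (f a) := by
    simp
  rw [h0, hdec, List.append_nil] at e2
  have hhalt : (liftCfg Sum.inl (Sum.inr none) none (fun _ : K => [])
      (haltList h.tm ((eb (f a)).map h.outputAlphabet.invFun)) :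
        Cfg (extΓ h.tm.Γ K) (h.tm.Λ ⊕ Option P.Lab) (h.tm.σ × Option Symbol)) =
      ⟨some (Sum.inr none), (h.tm.initialState, none),
        extStk (update (fun _ => []) h.tm.k₁ ((eb (f a)).map h.outputAlphabet.invFun))
          fun _ => []⟩ := by
    refine congrArg (fun S => Cfg.mk (some (Sum.inr none)) (h.tm.initialState, none)
      (extStk S fun _ : K => [])) (haltList_stk h.tm _)
  have e123 := stepN_add (stepN_add (e1.trans (congrArg some hhalt)) e2) e3
  refine ⟨⟨⟨(h.outputsFun a).steps + (((eb (f a)).map h.outputAlphabet.invFun).length + 1) + t,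
    Eq.trans ?_ (e123.trans ?_)⟩, ?_⟩⟩
  · refine congrArg (stepN (step M) _) ?_
    refine congrArg some ?_
    have : (initList (FinTM2.thenProg h.tm h.outputAlphabet P kin kout)
        ((ea a).map h.inputAlphabet.invFun)).stk =
        extStk (initList h.tm ((ea a).map h.inputAlphabet.invFun)).stk (fun _ : K => []) := by
      rw [initList_stk, initList_stk]
      refine Eq.trans ?_ (update_extStk_inl (fun _ => []) (fun _ : K => []) h.tm.k₀ _)
      funext k
      rcases k with k | k <;> rfl
    exact congrArg (Cfg.mk _ _) this
  · have : (haltList (FinTM2.thenProg h.tm h.outputAlphabet P kin kout) (ec (g a))).stk =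
        extStk (fun _ : h.tm.K => []) (update (fun _ : K => []) kout (G (eb (f a)))) := by
      rw [hg]
      refine (haltList_stk (FinTM2.thenProg h.tm h.outputAlphabet P kin kout) _).trans ?_
      refine Eq.trans ?_ (update_extStk_inr (fun _ => []) (fun _ : K => []) kout _)
      funext k
      rcases k with k | k <;> rfl
    refine congrArg some ?_
    refine Eq.trans (congrArg (Cfg.mk _ _) this.symm) ?_
    exact congrArg (haltList (FinTM2.thenProg h.tm h.outputAlphabet P kin kout))
      (List.map_id (ec (g a))).symm
  · simp only [List.length_map, Polynomial.eval_add, Polynomial.eval_one, Polynomial.eval_comp]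
    have h1 := (h.outputsFun a).steps_le_m
    have h2 := hlen a
    have h3 := ht.trans (eval_mono p h2)
    omega

end Sequence

section

/-! ### Running times of stack programs -/

section Runs

variable {K : Type} [DecidableEq K]

/-- `P` terminates with stacks `S'` within `T` jumps. -/
def Runs (P : Prog K) (r : Option Symbol) (S S' : K → List Symbol) (T : ℕ) : Prop :=
  ∃ t ≤ T, ∃ r', Exec P r S t r' S'

theorem Runs.mono {P : Prog K} {r S S' T T'} (h : Runs P r S S' T) (hT : T ≤ T') :
    Runs P r S S' T' := by
  obtain ⟨t, ht, h⟩ := h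
  exact ⟨t, ht.trans hT, h⟩

theorem Runs.to {P : Prog K} {r S S' S'' T T'} (h : Runs P r S S' T) (hS : S' = S'')
    (hT : T ≤ T') : Runs P r S S'' T' := hS ▸ h.mono hT

/-- The second program has to work from every register, so that the register between two programs
need not be tracked. -/
theorem Runs.seq {P Q : Prog K} {r S S₁ S₂ T₁ T₂} (hP : Runs P r S S₁ T₁)
    (hQ : ∀ r, Runs Q r S₁ S₂ T₂) : Runs (.seq P Q) r S S₂ (T₁ + T₂) := by
  obtain ⟨t₁, h₁, r₁, e₁⟩ := hP
  obtain ⟨t₂, h₂, r₂, e₂⟩ := hQ r₁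
  exact ⟨_, Nat.add_le_add h₁ h₂, _, e₁.seq e₂⟩

theorem Runs.skip (r) (S : K → List Symbol) : Runs .skip r S S 0 := ⟨0, le_rfl, _, .skip r S⟩

theorem Runs.push (k : K) (f r S) : Runs (.push k f) r S (update S k (f r :: S k)) 0 :=
  ⟨0, le_rfl, _, .push k f r S⟩

theorem Runs.pop (k : K) (r S) : Runs (.pop k) r S (update S k (S k).tail) 0 :=
  ⟨0, le_rfl, _, .pop k r S⟩

theorem Runs.loopNil {k : K} {P r S} (h : S k = []) : Runs (.loop k P) r S S 1 :=
  ⟨1, le_rfl, _, .loopNil r h⟩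

theorem Runs.loopCons {k : K} {P r S a l S₁ S₂ T₁ T₂} (h : S k = a :: l)
    (hP : Runs P (some a) (update S k l) S₁ T₁) (hL : ∀ r, Runs (.loop k P) r S₁ S₂ T₂) :
    Runs (.loop k P) r S S₂ (1 + T₁ + T₂) := by
  obtain ⟨t₁, h₁, r₁, e₁⟩ := hP
  obtain ⟨t₂, h₂, r₂, e₂⟩ := hL r₁
  exact ⟨_, by omega, _, .loopCons h e₁ e₂⟩

/-- The rule of loop invariants: `St u w` describes the stacks when the symbols of `u`, latest
first, have been processed and `w` is still on `k`. Each round costs one jump besides its body, and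
so does the exit. -/
theorem Runs.loop {k : K} {P : Prog K} (St : List Symbol → List Symbol → K → List Symbol) (c : ℕ)
    (hk : ∀ u w, St u w k = w) (l : List Symbol)
    (hP : ∀ u a w, l = u.reverse ++ a :: w →
      Runs P (some a) (update (St u (a :: w)) k w) (St (a :: u) w) c) (r) :
    Runs (.loop k P) r (St [] l) (St l.reverse []) (l.length * (c + 1) + 1) := by
  suffices H : ∀ w u r, l = u.reverse ++ w →
      Runs (.loop k P) r (St u w) (St l.reverse []) (w.length * (c + 1) + 1) from
    H l [] r (by simp)
  intro w
  induction w with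
  | nil =>
    intro u r hl
    have : l.reverse = u := by simp [hl]
    rw [this]
    exact (Runs.loopNil (hk u [])).mono (by simp)
  | cons a w ih =>
    intro u r hl
    refine (Runs.loopCons (hk u (a :: w)) (hP u a w hl)
      fun r => ih (a :: u) r (by simp [hl])).mono ?_
    simp only [List.length_cons]
    ring_nf
    omega

/-- Pushes the register. -/
abbrev Prog.pushReg (k : K) : Prog K := .push k fun r => r.getD .tick

theorem Runs.move {k k' : K} (h : k ≠ k') (r S) :
    Runs (.loop k (.pushReg k')) r S (update (update S k []) k' ((S k).reverse ++ S k'))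
      ((S k).length + 1) := by
  have := Runs.loop (k := k) (P := .pushReg k')
    (fun u w => update (update S k w) k' (u ++ S k')) 0 (fun u w => by simp [update_of_ne h])
    (S k) (fun u a w _ => ?_) r
  · simpa using this
  · refine (Runs.push k' _ _ _).to ?_ le_rfl
    simp only [Option.getD_some]
    funext j
    by_cases h1 : j = k'
    · subst h1; simp [update_of_ne h.symm]
    · by_cases h2 : j = k
      · subst h2; simp [update_of_ne h1]
      · simp [h1, h2]

theorem Runs.clear (k : K) (r S) :
    Runs (.loop k .skip) r S (update S k []) ((S k).length + 1) := by
  have := Runs.loop (k := k) (P := .skip) (fun _ w => update S k w) 0 (fun u w => by simp)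
    (S k) (fun u a w _ => by simpa using Runs.skip _ _) r
  simpa using this

/-- Pops one symbol and pushes it to two stacks, until the first one is empty. -/
theorem Runs.moveTwo {k k' k'' : K} (h : k ≠ k') (h' : k ≠ k'') (h'' : k' ≠ k'') (r S) :
    Runs (.loop k (.seq (.pushReg k') (.pushReg k''))) r S
      (update (update (update S k []) k' ((S k).reverse ++ S k')) k'' ((S k).reverse ++ S k''))
      ((S k).length + 1) := by
  have := Runs.loop (k := k) (P := .seq (.pushReg k') (.pushReg k''))
    (fun u w => update (update (update S k w) k' (u ++ S k')) k'' (u ++ S k'')) 0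
    (fun u w => by simp [update_of_ne h, update_of_ne h']) (S k) (fun u a w _ => ?_) r
  · simpa using this
  · have e1 := Exec.push (K := K) k' (fun r => r.getD .tick) (some a)
      (update (update (update (update S k (a :: w)) k' (u ++ S k')) k'' (u ++ S k'')) k w)
    have e2 := e1.seq (Exec.push (K := K) k'' (fun r => r.getD .tick) (some a) _)
    refine Runs.to ⟨_, le_rfl, _, e2⟩ ?_ le_rfl
    simp only [Option.getD_some]
    funext j
    by_cases h1 : j = k''
    · subst h1; simp [update_of_ne h'.symm, update_of_ne h''.symm]
    · by_cases h2 : j = k'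
      · subst h2; simp [update_of_ne h1, update_of_ne h.symm]
      · by_cases h3 : j = k
        · subst h3; simp [update_of_ne h1, update_of_ne h2]
        · simp [h1, h2, h3]

/-- Selects a program by the symbol in the register. -/
def Prog.dispatch (Q : Symbol → Prog K) : Prog K :=
  (Finset.univ : Finset Symbol).toList.foldr (fun a P => .ite (fun r => r = some a) (Q a) P) .skip

theorem Runs.dispatch {Q : Symbol → Prog K} {a S S' T} (h : Runs (Q a) (some a) S S' T) :
    Runs (.dispatch Q) (some a) S S' T := by
  have ha : a ∈ (Finset.univ : Finset Symbol).toList := by simp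
  unfold Prog.dispatch
  generalize (Finset.univ : Finset Symbol).toList = l at ha
  obtain ⟨t, ht, r', e⟩ := h
  refine ⟨t, ht, r', ?_⟩
  induction l with
  | nil => simp at ha
  | cons b l ih =>
    rw [List.foldr_cons]
    by_cases hb : a = b
    · subst hb
      exact .iteTrue (by simp) e
    · exact .iteFalse (by simpa using hb) (ih (by simpa [hb] using ha))

end Runs

/-! ### Expressions for functions on strings -/

/-- Concatenation of `f u a w` over all splittings `u.reverse ++ a :: w` of a list, where `u` starts
with the first argument. -/
def splitMap {α β : Type} (f : List α → α → List α → List β) : List α → List α → List β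
  | _, [] => []
  | u, a :: w => f u a w ++ splitMap f (a :: u) w

/-- Expressions for string-valued functions of string variables. `bind x e₁ e₂` evaluates `e₂` with
`x` set to `e₁`; `each v s p e` concatenates the values of `e a`, where `a` runs through the symbols
of `v`, with `s` set to the symbols after `a`, and `p` to those before `a`, in reverse order;
`size v x y` is the bit length of the length of `v` in unary; `drop v u x y` removes as many
symbols from `v` as `u` has. The variables `x` and `y` are auxiliary. -/
inductive Expr (V : Type) : Type
  | nil
  | sym (a : Symbol)
  | var (v : V)
  | app (e₁ e₂ : Expr V)
  | bind (x : V) (e₁ e₂ : Expr V)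
  | ifNil (v : V) (e₁ e₂ : Expr V)
  | each (v s p : V) (e : Symbol → Expr V)
  | size (v x y : V)
  | drop (v u x y : V)

variable {V : Type} [DecidableEq V]

def Expr.denote : Expr V → (V → List Symbol) → List Symbol
  | .nil, _ => []
  | .sym a, _ => [a]
  | .var v, ρ => ρ v
  | .app e₁ e₂, ρ => e₁.denote ρ ++ e₂.denote ρ
  | .bind x e₁ e₂, ρ => e₂.denote (update ρ x (e₁.denote ρ))
  | .ifNil v e₁ e₂, ρ => if ρ v = [] then e₁.denote ρ else e₂.denote ρ
  | .each v s p e, ρ => splitMap (fun u a w => (e a).denote (update (update ρ s w) p u)) [] (ρ v)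
  | .size v _ _, ρ => List.replicate (Nat.size (ρ v).length) .tick
  | .drop v u _ _, ρ => (ρ v).drop (ρ u).length

/-- Bound and auxiliary variables are fresh; `U` is the set of variables in use. -/
def Expr.Scoped : Finset V → Expr V → Prop
  | _, .nil => True
  | _, .sym _ => True
  | U, .var v => v ∈ U
  | U, .app e₁ e₂ => e₁.Scoped U ∧ e₂.Scoped U
  -- `x` is in use already during `e₁`, because the value of `e₁` is assembled on the stack `acc x`.
  | U, .bind x e₁ e₂ => x ∉ U ∧ e₁.Scoped (insert x U) ∧ e₂.Scoped (insert x U)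
  | U, .ifNil v e₁ e₂ => v ∈ U ∧ e₁.Scoped U ∧ e₂.Scoped U
  | U, .each v s p e => v ∈ U ∧ s ∉ U ∧ p ∉ U ∧ s ≠ p ∧ ∀ a, (e a).Scoped (insert s (insert p U))
  | U, .size v x y => v ∈ U ∧ x ∉ U ∧ y ∉ U ∧ x ≠ y
  | U, .drop v u x y => v ∈ U ∧ u ∈ U ∧ x ∉ U ∧ y ∉ U ∧ x ≠ y

/-- The stacks of the program for an expression: a temporary one, and two for each variable, one for
its value and one on which the value is assembled. -/
abbrev Stk (V : Type) : Type := Option (Bool × V)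

abbrev Stk.val (x : V) : Stk V := some (false, x)

abbrev Stk.acc (x : V) : Stk V := some (true, x)

open Prog in
/-- Copies the value of `v` to `k`. -/
def Prog.copyTo (v : V) (k : Stk V) : Prog (Stk V) :=
  .seq (.loop (.val v) (pushReg none)) (.loop none (.seq (pushReg (.val v)) (pushReg k)))

open Prog in
/-- The program that appends the value of the expression to the stack `acc τ`. -/
def Expr.comp : Expr V → V → Prog (Stk V)
  | .nil, _ => .skip
  | .sym a, τ => .push (.acc τ) fun _ => a
  | .var v, τ =>
      .seq (.loop (.val v) (.seq (pushReg (.acc τ)) (pushReg none))) (.loop none (pushReg (.val v)))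
  | .app e₁ e₂, τ => .seq (e₁.comp τ) (e₂.comp τ)
  | .bind x e₁ e₂, τ =>
      .seq (e₁.comp x) (.seq (.loop (.acc x) (pushReg (.val x)))
        (.seq (e₂.comp τ) (.loop (.val x) .skip)))
  | .ifNil v e₁ e₂, τ =>
      .seq (.pop (.val v)) (.ite Option.isNone (e₁.comp τ)
        (.seq (pushReg (.val v)) (e₂.comp τ)))
  -- Popping from the copy of `v` on `val s` leaves there exactly the symbols after the current one,
  -- and pushing the processed symbols onto `val p` collects those before it in reverse order.
  | .each v s p e, τ =>
      .seq (copyTo v (.val s)) (.seq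
        (.loop (.val s) (dispatch fun a => .seq ((e a).comp τ) (.push (.val p) fun _ => a)))
        (.loop (.val p) .skip))
  -- A round of the outer loop replaces the length `n` by `n / 2`: the outer pop removes one symbol,
  -- and the inner loop keeps half of the other `n - 1`, rounded up. The number of rounds down to
  -- zero is the bit length.
  | .size v x y, τ =>
      .seq (copyTo v (.val x)) (.loop (.val x) (.seq (.push (.acc τ) fun _ => .tick)
        (.seq (.loop (.val x) (.seq (.pop (.val x)) (.push (.val y) fun _ => .tick)))
          (.loop (.val y) (pushReg (.val x))))))
  | .drop v u x y, τ =>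
      .seq (copyTo v (.val x)) (.seq (copyTo u (.val y)) (.seq (.loop (.val y) (.pop (.val x)))
        (.loop (.val x) (pushReg (.acc τ)))))

theorem Runs.copyTo {v : V} {k : Stk V} (hk : k ≠ .val v) (hk' : k ≠ none) (r)
    {S : Stk V → List Symbol} (h0 : S none = []) (hS : S k = []) :
    Runs (.copyTo v k) r S (update S k (S (.val v))) (2 * (S (.val v)).length + 2) := by
  have h1 := Runs.move (K := Stk V) (k := .val v) (k' := none) (by simp) r S
  refine (h1.seq fun r => Runs.moveTwo (by simp) hk'.symm hk.symm r _).to ?_ ?_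
  · funext j
    by_cases h1 : j = k
    · subst h1; simp [h0, hk, hk', hS]
    · by_cases h2 : j = .val v
      · subst h2; simp [h1, h0]
      · by_cases h3 : j = none
        · subst h3; simp [h1, h0]
        · simp [h1, h2, h3]
  · simp [h0]; omega

theorem length_splitMap_le {α β : Type} (f : List α → α → List α → List β) (c : ℕ)
    (u l : List α) (h : ∀ u' a w, u.reverse ++ l = u'.reverse ++ a :: w → (f u' a w).length ≤ c) :
    (splitMap f u l).length ≤ l.length * c := by
  induction l generalizing u with
  | nil => simp [splitMap]
  | cons a l ih =>
    simp only [splitMap, List.length_append, List.length_cons]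
    have h1 := h u a l rfl
    have h2 := ih (a :: u) (fun u' b w hw => h u' b w (by simpa using hw))
    rw [Nat.succ_mul]
    omega

/-- The part of `splitMap` that comes from the symbols `u`, if `w` are those that follow. -/
def splitMapBefore {α β : Type} (f : List α → α → List α → List β) : List α → List α → List β
  | [], _ => []
  | a :: u, w => splitMapBefore f u (a :: w) ++ f u a w

theorem splitMapBefore_append {α β : Type} (f : List α → α → List α → List β) (u w : List α) :
    splitMapBefore f u w ++ splitMap f u w = splitMap f [] (u.reverse ++ w) := by
  induction u generalizing w with
  | nil => rfl
  | cons a u ih =>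
    have := ih (a :: w)
    simpa [splitMapBefore, splitMap] using this

theorem splitMapBefore_reverse {α β : Type} (f : List α → α → List α → List β) (l : List α) :
    splitMapBefore f l.reverse [] = splitMap f [] l := by
  simpa [splitMap] using splitMapBefore_append f l.reverse []

end

section

variable {V : Type} [DecidableEq V]

/-- A loop is left by a `pop` from an empty stack. Ending a program with a loop thus resets the
register, as a final configuration requires. -/
theorem Exec.loop_reg {K : Type} [DecidableEq K] {k : K} {Q r S t r' S'}
    (h : Exec (.loop k Q) r S t r' S') : r' = none := by
  generalize hP : Prog.loop k Q = P at h
  induction h with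
  | loopNil => rfl
  | loopCons _ _ _ _ ih => exact ih hP
  | _ => cases hP

/-- The half is rounded up: when a single symbol is left, the inner `pop` meets an empty stack, and
a tick is still pushed. -/
theorem Runs.halve {x y : V} (hxy : x ≠ y) (r) (S : Stk V → List Symbol) :
    Runs (.loop (Stk.val x) (.seq (.pop (Stk.val x)) (.push (Stk.val y) fun _ => .tick))) r S
      (update (update S (Stk.val x) []) (Stk.val y)
        (List.replicate (((S (Stk.val x)).length + 1) / 2) .tick ++ S (Stk.val y)))
      (((S (Stk.val x)).length + 1) / 2 + 1) := by
  induction hn : (S (Stk.val x)).length using Nat.strong_induction_on generalizing S r with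
  | _ n ih =>
    match hl : S (Stk.val x), n, hn with
    | [], n, hn =>
      have : n = 0 := by rw [← hn]; rfl
      subst this
      refine (Runs.loopNil hl).to ?_ (by simp)
      funext j
      by_cases h1 : j = Stk.val y
      · subst h1; simp
      · by_cases h2 : j = Stk.val x
        · subst h2; simp [h1, hl]
        · simp [h1, h2]
    | a :: l, n, hn =>
      have hn' : n = l.length + 1 := by rw [← hn]; rfl
      have e1 : Runs (.seq (.pop (Stk.val x)) (.push (Stk.val y) fun _ => .tick)) (some a)
          (update S (Stk.val x) l)
          (update (update S (Stk.val x) l.tail) (Stk.val y) (.tick :: S (Stk.val y))) 0 := by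
        refine ((Runs.pop (Stk.val x) _ _).seq fun r => Runs.push (Stk.val y) _ r _).to ?_ le_rfl
        funext j
        by_cases h1 : j = Stk.val y
        · subst h1; simp [hxy.symm]
        · by_cases h2 : j = Stk.val x
          · subst h2; simp [h1]
          · simp [h1, h2]
      refine (Runs.loopCons hl e1 fun r => ih l.tail.length ?_ r _ ?_).to ?_ ?_
      · simp; omega
      · simp [hxy]
      · funext j
        have h3 : (n + 1) / 2 = (l.tail.length + 1) / 2 + 1 := by
          rw [hn']
          cases l with
          | nil => simp
          | cons b l => simp; omega
        by_cases h1 : j = Stk.val y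
        · subst h1
          simp only [update_self]
          rw [h3, List.replicate_succ']
          simp
        · by_cases h2 : j = Stk.val x
          · subst h2; simp [h1]
          · simp [h1, h2]
      · rw [hn']
        cases l with
        | nil => simp
        | cons b l => simp; omega

theorem Nat.size_half {n : ℕ} (h : n ≠ 0) : n.size = (n / 2).size + 1 := by
  conv_lhs => rw [← Nat.bit_bodd_div2 n]
  rw [Nat.size_bit, Nat.div2_val]
  rwa [Nat.bit_bodd_div2]

/-- Linear time, since the lengths decrease geometrically; the recursion amounts to `11 * (n / 2) +
4 ≤ 9 * n + 1` for positive `n`. -/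
theorem Runs.size {x y τ : V} (hxy : x ≠ y) (r) (S : Stk V → List Symbol)
    (hy : S (Stk.val y) = []) :
    Runs (.loop (Stk.val x) (.seq (.push (Stk.acc τ) fun _ => .tick)
        (.seq (.loop (Stk.val x) (.seq (.pop (Stk.val x)) (.push (Stk.val y) fun _ => .tick)))
          (.loop (Stk.val y) (.pushReg (Stk.val x)))))) r S
      (update (update S (Stk.val x) []) (Stk.acc τ)
        (List.replicate (Nat.size (S (Stk.val x)).length) .tick ++ S (Stk.acc τ)))
      (9 * (S (Stk.val x)).length + 1) := by
  induction hn : (S (Stk.val x)).length using Nat.strong_induction_on generalizing S r with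
  | _ n ih =>
    match hl : S (Stk.val x), n, hn with
    | [], n, hn =>
      have : n = 0 := by rw [← hn]; rfl
      subst this
      refine (Runs.loopNil hl).to ?_ (by simp)
      funext j
      by_cases h1 : j = Stk.acc τ
      · subst h1; simp
      · by_cases h2 : j = Stk.val x
        · subst h2; simp [hl]
        · simp [h1, h2]
    | a :: l, n, hn =>
      have hn' : n = l.length + 1 := by rw [← hn]; rfl
      have e1 := (Runs.push (K := Stk V) (Stk.acc τ) (fun _ => .tick) (some a)
        (update S (Stk.val x) l)).seq fun r => (Runs.halve hxy r _).seq fun r =>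
          Runs.move (k := Stk.val y) (k' := Stk.val x) (by simp [hxy.symm]) r _
      refine (Runs.loopCons hl e1 fun r => ih (n / 2) ?_ r _ ?_ ?_).to ?_ ?_
      · omega
      · simp [hxy, hxy.symm]
      · simp [hxy, hxy.symm, hy, hn']
      · rw [Nat.size_half (n := n) (by omega)]
        funext j
        by_cases h1 : j = Stk.acc τ
        · subst h1
          rw [List.replicate_succ']
          simp
        · by_cases h2 : j = Stk.val x
          · subst h2; simp
          · by_cases h3 : j = Stk.val y
            · subst h3; simp [hy, hxy.symm]
            · simp [h1, h2, h3]
      · simp [hxy.symm, hy]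
        omega

/-- The value of an expression is computed in polynomial time. -/
theorem Expr.runs (e : Expr V) : ∃ p : Polynomial ℕ, ∀ (U : Finset V) (S : Stk V → List Symbol)
    (τ : V) (n : ℕ) (r : Option Symbol), e.Scoped U → τ ∈ U → S none = [] →
    (∀ x ∉ U, S (Stk.val x) = [] ∧ S (Stk.acc x) = []) → (∀ x, (S (Stk.val x)).length ≤ n) →
    Runs (e.comp τ) r S
      (update S (Stk.acc τ) ((e.denote fun x => S (Stk.val x)).reverse ++ S (Stk.acc τ))) (p.eval n) ∧
    (e.denote fun x => S (Stk.val x)).length ≤ p.eval n := by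
  induction e with
  | nil =>
    refine ⟨0, fun U S τ n r _ _ _ _ _ => ⟨?_, by simp [denote]⟩⟩
    exact (Runs.skip r S).to (by simp [denote]) (by simp)
  | sym a =>
    refine ⟨1, fun U S τ n r _ _ _ _ _ => ⟨?_, by simp [denote]⟩⟩
    exact (Runs.push (Stk.acc τ) _ r S).to (by simp [denote]) (by simp)
  | var v =>
    refine ⟨2 * Polynomial.X + 2, fun U S τ n r hU hτ h0 hf hn => ⟨?_, ?_⟩⟩
    · have hv := hn v
      refine ((Runs.moveTwo (k := Stk.val v) (k' := Stk.acc τ) (k'' := none) (by simp) (by simp)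
        (by simp) r S).seq fun r => Runs.move (by simp) r _).to ?_ ?_
      · funext j
        rcases j with _ | ⟨_ | _, j⟩
        · simp [h0]
        · by_cases h : j = v
          · subst h; simp [h0]
          · simp [h]
        · by_cases h : j = τ
          · subst h; simp [denote]
          · simp [h]
      · simp [h0]; omega
    · have := hn v
      simp only [denote, Polynomial.eval_add, Polynomial.eval_mul, Polynomial.eval_ofNat,
        Polynomial.eval_X]
      omega
  | app e₁ e₂ ih₁ ih₂ =>
    obtain ⟨p₁, ih₁⟩ := ih₁
    obtain ⟨p₂, ih₂⟩ := ih₂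
    refine ⟨p₁ + p₂, fun U S τ n r hU hτ h0 hf hn => ⟨?_, ?_⟩⟩
    · obtain ⟨h1, _⟩ := ih₁ U S τ n r hU.1 hτ h0 hf hn
      refine (h1.seq fun r => (ih₂ U _ τ n r hU.2 hτ (by simp [h0]) (fun x hx => ?_) ?_).1).to ?_ ?_
      · have : x ≠ τ := fun h => hx (h ▸ hτ)
        simp [hf x hx, this]
      · simpa using hn
      · simp [denote]
      · simp
    · have h1 := (ih₁ U S τ n r hU.1 hτ h0 hf hn).2
      have h2 := (ih₂ U S τ n r hU.2 hτ h0 hf hn).2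
      simp only [denote, Polynomial.eval_add, List.length_append]
      omega
  | bind x e₁ e₂ ih₁ ih₂ =>
    obtain ⟨p₁, ih₁⟩ := ih₁
    obtain ⟨p₂, ih₂⟩ := ih₂
    -- `p₁` bounds the time for `e₁` and also the length of its value, so `e₂` sees values of length
    -- at most `n + p₁`. The other terms pay for moving this value to `val x` and for clearing it.
    refine ⟨3 * p₁ + 2 + p₂.comp (Polynomial.X + p₁), fun U S τ n r hU hτ h0 hf hn => ?_⟩
    obtain ⟨hx, hU1, hU2⟩ := hU
    have hxτ : x ≠ τ := fun h => hx (h ▸ hτ)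
    have hfx : ∀ z ∉ insert x U, S (Stk.val z) = [] ∧ S (Stk.acc z) = [] := fun z hz =>
      hf z fun h => hz (Finset.mem_insert_of_mem h)
    obtain ⟨a1, b1⟩ := ih₁ (insert x U) S x n r hU1 (Finset.mem_insert_self _ _) h0 hfx hn
    set d := e₁.denote fun x => S (Stk.val x) with hd
    let S' : Stk V → List Symbol := update S (Stk.val x) d
    have hS' : (fun z => S' (Stk.val z)) = update (fun z => S (Stk.val z)) x d := by
      funext z
      by_cases h : z = x
      · subst h; simp [S']
      · simp [S', h]
    have h2 : ∀ r, _ := fun r => ih₂ (insert x U) S' τ (n + p₁.eval n) r hU2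
      (Finset.mem_insert_of_mem hτ) (by simp [S', h0]) (fun z hz => by
        have : z ≠ x := fun h => hz (h ▸ Finset.mem_insert_self _ _)
        simpa [S', this] using hfx z hz) (fun z => by
        by_cases h : z = x
        · subst h; simp [S']; omega
        · simp [S', h]; have := hn z; omega)
    rw [hS'] at h2
    obtain ⟨-, b2⟩ := h2 r
    refine ⟨?_, ?_⟩
    · have m1 : ∀ r, Runs (.loop (Stk.acc x) (.pushReg (Stk.val x))) r
          (update S (Stk.acc x) (d.reverse ++ S (Stk.acc x))) S' (d.length + 1) := fun r => by
        refine (Runs.move (by simp) r _).to ?_ ?_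
        · funext j
          rcases j with _ | ⟨_ | _, j⟩
          · simp [S']
          · by_cases h : j = x
            · subst h; simp [S', (hf j hx).1, (hf j hx).2]
            · simp [h, S']
          · by_cases h : j = x
            · subst h; simp [S', (hf j hx).2]
            · simp [h, S']
        · simp [(hf x hx).2]
      refine (a1.seq fun r => (m1 r).seq fun r => (h2 r).1.seq fun r =>
        Runs.clear (Stk.val x) r _).to ?_ ?_
      · funext j
        rcases j with _ | ⟨_ | _, j⟩
        · simp [S']
        · by_cases h : j = x
          · subst h; simp [S', (hf j hx).1]
          · simp [h, S']
        · by_cases h : j = τ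
          · subst h; simp [S', denote, hd]
          · simp [h, S']
      · have hc : (update S' (Stk.acc τ) ((e₂.denote (update (fun z => S (Stk.val z)) x d)).reverse ++
            S' (Stk.acc τ)) (Stk.val x)).length = d.length := by simp [S']
        rw [hc]
        simp only [Polynomial.eval_add, Polynomial.eval_mul, Polynomial.eval_ofNat,
          Polynomial.eval_comp, Polynomial.eval_X]
        omega
    · simp only [denote, Polynomial.eval_add, Polynomial.eval_mul, Polynomial.eval_ofNat,
        Polynomial.eval_comp, Polynomial.eval_X, ← hd]
      omega
  | ifNil v e₁ e₂ ih₁ ih₂ =>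
    obtain ⟨p₁, ih₁⟩ := ih₁
    obtain ⟨p₂, ih₂⟩ := ih₂
    refine ⟨p₁ + p₂, fun U S τ n r hU hτ h0 hf hn => ?_⟩
    obtain ⟨hv, hU1, hU2⟩ := hU
    obtain ⟨-, b1⟩ := ih₁ U S τ n r hU1 hτ h0 hf hn
    obtain ⟨-, b2⟩ := ih₂ U S τ n r hU2 hτ h0 hf hn
    simp only [denote, Polynomial.eval_add]
    obtain hl | ⟨a, l, hl⟩ : S (Stk.val v) = [] ∨ ∃ a l, S (Stk.val v) = a :: l := by
      cases S (Stk.val v) <;> simp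
    · obtain ⟨t, ht, r', e⟩ := (ih₁ U S τ n none hU1 hτ h0 hf hn).1
      rw [if_pos hl]
      refine ⟨⟨0 + t, by omega, r', ?_⟩, by omega⟩
      have e0 := Exec.pop (Stk.val v) r S
      rw [hl, List.tail_nil, ← hl, Function.update_eq_self, hl] at e0
      exact e0.seq (.iteTrue rfl e)
    · have e0 := Exec.pop (Stk.val v) r S
      rw [hl] at e0
      have e1 := Exec.push (Stk.val v) (fun r => r.getD .tick) (some a) (update S (Stk.val v) l)
      have h1 : update (update S (Stk.val v) l) (Stk.val v)
          ((some a).getD .tick :: update S (Stk.val v) l (Stk.val v)) = S := by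
        simp [← hl]
      rw [h1] at e1
      obtain ⟨t, ht, r', e⟩ := (ih₂ U S τ n (some a) hU2 hτ h0 hf hn).1
      rw [if_neg (by simp [hl])]
      refine ⟨⟨0 + (0 + t), by omega, r', ?_⟩, by omega⟩
      exact e0.seq (.iteFalse rfl (e1.seq e))
  | each v s p e ih =>
    choose q ih using ih
    -- The terms are for copying `v`, for the rounds, and for clearing `val p`. The sum over all
    -- symbols bounds the body whichever symbol is dispatched.
    refine ⟨2 * Polynomial.X + 2 + Polynomial.X * (∑ a, q a + 1) + 1 + Polynomial.X + 1,
      fun U S τ n r hU hτ h0 hf hn => ?_⟩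
    obtain ⟨hv, hs, hp, hsp, hU⟩ := hU
    have hsv : s ≠ v := fun h => hs (h ▸ hv)
    have hpv : p ≠ v := fun h => hp (h ▸ hv)
    have hsτ : s ≠ τ := fun h => hs (h ▸ hτ)
    have hpτ : p ≠ τ := fun h => hp (h ▸ hτ)
    set f : List Symbol → Symbol → List Symbol → List Symbol := fun u a w =>
      (e a).denote (update (update (fun x => S (Stk.val x)) s w) p u) with hf'
    set C := ∑ a, (q a).eval n with hC
    have hqC : ∀ a, (q a).eval n ≤ C := fun a =>
      Finset.single_le_sum (f := fun a => (q a).eval n) (fun _ _ => Nat.zero_le _)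
        (Finset.mem_univ a)
    -- The loop invariant: `w` is left on `val s`, the processed symbols `u` are on `val p`, and
    -- their contributions are on the accumulator, in reverse.
    let St : List Symbol → List Symbol → Stk V → List Symbol := fun u w =>
      update (update (update S (Stk.val s) w) (Stk.val p) u) (Stk.acc τ)
        ((splitMapBefore f u w).reverse ++ S (Stk.acc τ))
    have main : ∀ u a w, S (Stk.val v) = u.reverse ++ a :: w → ∀ r,
        Runs ((e a).comp τ) r (update (St u (a :: w)) (Stk.val s) w)
          (update (update (St u (a :: w)) (Stk.val s) w) (Stk.acc τ)
            ((f u a w).reverse ++ St u (a :: w) (Stk.acc τ))) (q a |>.eval n) ∧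
          (f u a w).length ≤ (q a).eval n := by
      intro u a w huw r
      have hlen := hn v
      rw [huw] at hlen
      simp only [List.length_append, List.length_reverse, List.length_cons] at hlen
      have := ih a (insert s (insert p U)) (update (St u (a :: w)) (Stk.val s) w) τ n r (hU a)
        (by simp [hτ]) (by simp [St, h0]) (fun z hz => by
          simp only [Finset.mem_insert, not_or] at hz
          have hzτ : z ≠ τ := fun h => hz.2.2 (h ▸ hτ)
          simp [St, hz.1, hz.2.1, hzτ, hf z hz.2.2]) (fun z => by
          by_cases h1 : z = s
          · subst h1; simp; omega
          · by_cases h2 : z = p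
            · subst h2; simp [St, h1]; omega
            · simp [St, h1, h2]; exact hn z)
      have h3 : (fun z => update (St u (a :: w)) (Stk.val s) w (Stk.val z)) =
          update (update (fun x => S (Stk.val x)) s w) p u := by
        funext z
        by_cases h1 : z = s
        · subst h1; simp [hsp]
        · by_cases h2 : z = p
          · subst h2; simp [St, h1]
          · simp [St, h1, h2]
      rw [h3] at this
      simpa using this
    have hlen : (splitMap f [] (S (Stk.val v))).length ≤ n * C := by
      refine (length_splitMap_le f C [] (S (Stk.val v)) fun u a w h => ?_).trans
        (Nat.mul_le_mul_right _ (hn v))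
      exact (main u a w (by simpa using h) none).2.trans (hqC a)
    refine ⟨?_, ?_⟩
    · have l1 := fun r => Runs.loop (k := Stk.val s)
        (P := .dispatch fun a => .seq ((e a).comp τ) (.push (Stk.val p) fun _ => a)) St C
        (fun u w => by simp [St, hsp]) (S (Stk.val v)) (fun u a w h => by
          refine Runs.dispatch (((main u a w h (some a)).1.seq
            fun r => Runs.push (Stk.val p) _ r _).to ?_ (by simpa using hqC a))
          funext j
          rcases j with _ | ⟨_ | _, j⟩
          · simp [St]
          · by_cases h1 : j = s
            · subst h1; simp [St, hsp]
            · by_cases h2 : j = p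
              · subst h2; simp [St, h1]
              · simp [St, h1, h2]
          · by_cases h1 : j = τ
            · subst h1; simp [St, splitMapBefore]
            · simp [St, h1]) r
      have hSt : St [] (S (Stk.val v)) = update S (Stk.val s) (S (Stk.val v)) := by
        funext j
        rcases j with _ | ⟨_ | _, j⟩
        · simp [St]
        · by_cases h1 : j = p
          · subst h1; simp [St, hsp.symm, (hf j hp).1]
          · simp [St, h1]
        · by_cases h1 : j = τ
          · subst h1; simp [St, splitMapBefore]
          · simp [St, h1]
      rw [hSt] at l1
      refine ((Runs.copyTo (by simpa using hsv) (by simp) r h0 (hf s hs).1).seq fun r =>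
        (l1 r).seq fun r => Runs.clear _ r _).to ?_ ?_
      · funext j
        rcases j with _ | ⟨_ | _, j⟩
        · simp [St]
        · by_cases h1 : j = p
          · subst h1; simp [(hf j hp).1]
          · by_cases h2 : j = s
            · subst h2; simp [St, h1, (hf j hs).1]
            · simp [St, h1, h2]
        · by_cases h1 : j = τ
          · subst h1; simp [St, denote, hf', splitMapBefore_reverse]
          · simp [St, h1]
      · have h1 := hn v
        have h2 := Nat.mul_le_mul_right (C + 1) h1
        simp [St, Polynomial.eval_finsetSum, ← hC]
        omega
    · simp only [denote, Polynomial.eval_add, Polynomial.eval_mul, Polynomial.eval_ofNat,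
        Polynomial.eval_X, Polynomial.eval_finsetSum, Polynomial.eval_one, ← hC, mul_add]
      refine hlen.trans ?_
      omega
  | size v x y =>
    refine ⟨11 * Polynomial.X + 3, fun U S τ n r hU hτ h0 hf hn => ?_⟩
    obtain ⟨hv, hx, hy, hxy⟩ := hU
    have hxv : x ≠ v := fun h => hx (h ▸ hv)
    have hyx : y ≠ x := hxy.symm
    have h1 := hn v
    refine ⟨?_, ?_⟩
    · refine ((Runs.copyTo (by simpa using hxv) (by simp) r h0 (hf x hx).1).seq fun r =>
        Runs.size hxy r _ (by simp [hyx, (hf y hy).1])).to ?_ ?_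
      · funext j
        rcases j with _ | ⟨_ | _, j⟩
        · simp
        · by_cases h1 : j = x
          · subst h1; simp [(hf j hx).1]
          · simp [h1]
        · by_cases h1 : j = τ
          · subst h1; simp [denote]
          · simp [h1]
      · simp; omega
    · have h2 : (S (Stk.val v)).length.size ≤ (S (Stk.val v)).length := Nat.size_le.2 Nat.lt_two_pow_self
      simp [denote]; omega
  | drop v u x y =>
    refine ⟨6 * Polynomial.X + 6, fun U S τ n r hU hτ h0 hf hn => ?_⟩
    obtain ⟨hv, hu, hx, hy, hxy⟩ := hU
    have hxv : x ≠ v := fun h => hx (h ▸ hv)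
    have hxu : x ≠ u := fun h => hx (h ▸ hu)
    have hyu : y ≠ u := fun h => hy (h ▸ hu)
    have hyx : y ≠ x := hxy.symm
    have h1 := hn v
    have h2 := hn u
    refine ⟨?_, by simp [denote]; omega⟩
    have l1 := fun r => Runs.loop (k := Stk.val y) (P := .pop (Stk.val x))
      (fun z w => update (update S (Stk.val x) ((S (Stk.val v)).drop z.length)) (Stk.val y) w) 0
      (fun u w => by simp) (S (Stk.val u)) (fun z a w _ => by
        refine (Runs.pop _ _ _).to ?_ le_rfl
        funext j
        by_cases h1 : j = Stk.val x
        · subst h1; simp [hxy]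
        · by_cases h2 : j = Stk.val y
          · subst h2; simp [hyx]
          · simp [h1, h2]) r
    simp only [List.length_nil, List.drop_zero, List.length_reverse] at l1
    have c2 : ∀ r, Runs (.copyTo u (Stk.val y)) r (update S (Stk.val x) (S (Stk.val v)))
        (update (update S (Stk.val x) (S (Stk.val v))) (Stk.val y) (S (Stk.val u)))
        (2 * (S (Stk.val u)).length + 2) := fun r => by
      refine (Runs.copyTo (by simpa using hyu) (by simp) r (by simp [h0])
        (by simp [hyx, (hf y hy).1])).to ?_ ?_ <;> simp [hxu.symm]
    refine ((Runs.copyTo (by simpa using hxv) (by simp) r h0 (hf x hx).1).seq fun r =>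
      (c2 r).seq fun r => (l1 r).seq fun r => Runs.move (by simp) r _).to ?_ ?_
    · funext j
      rcases j with _ | ⟨_ | _, j⟩
      · simp
      · by_cases h1 : j = x
        · subst h1; simp [(hf j hx).1]
        · by_cases h2 : j = y
          · subst h2; simp [(hf j hy).1, h1]
          · simp [h1, h2]
      · by_cases h1 : j = τ
        · subst h1; simp [denote, hxy]
        · simp [h1]
    · simp [hxy]; omega

/-- A function that is computed in polynomial time, followed by an expression. -/
theorem nonempty_polyTime_expr {α β γ αΓ : Type} {ea : α → List αΓ} {eb : β → List Symbol}
    {ec : γ → List Symbol} {f : α → β} {g : α → γ}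
    (h : Turing.TM2ComputableInPolyTime ea eb f) [Fintype V] (e : Expr V) (i o : V) (hio : i ≠ o)
    (he : e.Scoped {i, o})
    (hg : ∀ a, ec (g a) = e.denote (update (fun _ => []) i (eb (f a)))) :
    Nonempty (Turing.TM2ComputableInPolyTime ea ec g) := by
  obtain ⟨p, hp⟩ := e.runs
  refine nonempty_polyTime_thenProg h
    -- The first loop undoes the reversal of the input and the last one that of the assembled value;
    -- the input is cleared in between, because only the output may remain.
    (.seq (.loop (Stk.acc i) (.pushReg (Stk.val i))) (.seq (e.comp o)
      (.seq (.loop (Stk.val i) .skip) (.loop (Stk.acc o) (.pushReg (Stk.val o))))))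
    (Stk.acc i) (Stk.val o) (2 * Polynomial.X + 2 * p + 3)
    (fun l => e.denote (update (fun _ => []) i l)) (fun l => ?_) hg
  let S₁ : Stk V → List Symbol := update (fun _ => []) (Stk.val i) l
  have hS₁ : (fun x => S₁ (Stk.val x)) = update (fun _ => []) i l := by
    funext x
    by_cases hx : x = i
    · subst hx; simp [S₁]
    · simp [S₁, hx]
  have r1 : Runs (.loop (Stk.acc i) (.pushReg (Stk.val i))) none
      (update (fun _ => []) (Stk.acc i) l.reverse) S₁ (l.length + 1) := by
    refine (Runs.move (by simp) _ _).to ?_ (by simp)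
    funext j
    rcases j with _ | ⟨_ | _, j⟩
    · simp [S₁]
    · by_cases hx : j = i
      · subst hx; simp [S₁]
      · simp [S₁, hx]
    · by_cases hx : j = i
      · subst hx; simp [S₁]
      · simp [S₁, hx]
  have r2 := fun r => hp {i, o} S₁ o l.length r he (by simp) (by simp [S₁]) (fun x hx => by
    simp only [Finset.mem_insert, Finset.mem_singleton, not_or] at hx
    simp [S₁, hx.1]) (fun x => by
    by_cases hx : x = i
    · subst hx; simp [S₁]
    · simp [S₁, hx])
  rw [hS₁] at r2
  have hlen := (r2 none).2
  obtain ⟨t, ht, r', hex⟩ := r1.seq fun r => (r2 r).1.seq fun r =>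
    (Runs.clear (Stk.val i) r _).seq fun r =>
      Runs.move (k := Stk.acc o) (k' := Stk.val o) (by simp) r _
  have hr' : r' = none := by
    cases hex with
    | seq _ h2 => cases h2 with
      | seq _ h3 => cases h3 with
        | seq _ h4 => exact h4.loop_reg
  subst hr'
  refine ⟨t, ht.trans ?_, ?_⟩
  · simp [S₁]
    omega
  · convert hex using 1
    funext j
    rcases j with _ | ⟨_ | _, j⟩
    · simp [S₁]
    · by_cases hx : j = o
      · subst hx; simp [S₁, hio.symm]
      · by_cases hx' : j = i
        · subst hx'; simp [S₁, hx]
        · simp [S₁, hx, hx']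
    · by_cases hx : j = o
      · subst hx; simp [S₁]
      · simp [S₁, hx]

end

section

/-! ### The reduction as a transformation of circuits

Let `s` be the length of the description of a circuit `C`. The wires of `C` are below `s`; the
wires `s + i` receive the measured query input; a random polynomial over `𝔽₂`, which is the key of
the hash function that replaces the oracle, is on the key wires from `2 s` on. They are followed by
random coins, which decide which query is measured, and by ancilla wires. -/

/-- The degree of the moduli of the hash function. -/
def hashDeg (s : ℕ) : ℕ := s * (s * 3)

/-- The position of the coefficients that are the hash value. -/
def hashPos (s : ℕ) : ℕ := s * (s * 2)

/-- The number of reduction steps of the hash function. -/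
def hashSteps (s : ℕ) : ℕ := s * (hashDeg s + hashDeg s)

/-- The number of key wires and coin wires. -/
def randLen (s : ℕ) : ℕ := hashSteps s + hashDeg s + s * hashDeg s

/-- The number of coins for each query. -/
def coinNum (s : ℕ) : ℕ := Nat.size (s + s)

def outWire (s i : ℕ) : ℕ := s + i

def keyWire (s p : ℕ) : ℕ := s + (s + p)

/-- Each position `j` owns a block of `hashDeg s` wires, more than the coins need. The sums are
nested to the right, like the concatenations of unary numbers that describe these wires. -/
def coinWire (s j l : ℕ) : ℕ := s + (s + (hashSteps s + (hashDeg s + (j * hashDeg s + l))))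

def ancWire (s j l : ℕ) : ℕ := s + (s + (randLen s + (j * hashDeg s + l)))

/-- Computes the conjunction of the coins for the query at position `j`. -/
def flagGates (s j : ℕ) : List Gate :=
  .pauliX (ancWire s j 0) :: (List.range (coinNum s)).map fun l =>
    .toffoli (ancWire s j l) (coinWire s j l) (ancWire s j (l + 1))

/-- Copies the query input if the coins say so. -/
def copyGates (s j : ℕ) (ins : List ℕ) : List Gate :=
  ins.mapIdx fun i w => .toffoli (ancWire s j (coinNum s)) w (outWire s i)

/-- One step of the reduction of the key modulo the polynomial that the wires `ins` determine. -/
def reduceStep (s : ℕ) (ins : List ℕ) (p : ℕ) : List Gate :=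
  ins.mapIdx fun i w => .toffoli w (keyWire s (p + hashDeg s)) (keyWire s (p + i))

def reduceGates (s : ℕ) (ins : List ℕ) : List Gate :=
  (List.range (hashSteps s)).reverse.flatMap (reduceStep s ins)

def unreduceGates (s : ℕ) (ins : List ℕ) : List Gate :=
  (List.range (hashSteps s)).flatMap (reduceStep s ins)

def answerGates (s : ℕ) (outs : List ℕ) : List Gate :=
  outs.mapIdx fun i w => .cnot (keyWire s (hashPos s + i)) w

/-- The replacement of a query gate whose description starts at position `j`. -/
def queryGates (s j : ℕ) (ins outs : List ℕ) : List Gate :=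
  flagGates s j ++ (copyGates s j ins ++
    (reduceGates s ins ++ (answerGates s outs ++ unreduceGates s ins)))

def simGate (s j : ℕ) : Gate → List Gate
  | .query ins outs => queryGates s j ins outs
  | g => [g]

def simGates (s : ℕ) : ℕ → List Gate → List Gate
  | _, [] => []
  | j, g :: gs => simGate s j g ++ simGates s (j + g.encode.length) gs

/-- The input wires of the first query. -/
def firstIns : List Gate → List ℕ
  | [] => []
  | .query ins _ :: _ => ins
  | _ :: gs => firstIns gs

/-- The circuit that runs `C` with a hash function in place of the oracle and outputs the last part
of the input of a random query. -/
def simCircuit (C : Circuit) : Circuit where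
  gates := (List.range (randLen C.encode.length)).map
      (fun p => .hadamard (keyWire C.encode.length p)) ++ simGates C.encode.length 0 C.gates
  out := (List.range ((firstIns C.gates).length - C.out.length)).map
    fun k => outWire C.encode.length (C.out.length + k)

/-! ### The transformation is an expression -/

section Macros

variable {V : Type} [DecidableEq V]

/-- The number `n` in unary. -/
abbrev ticks (n : ℕ) : List Symbol := List.replicate n .tick

theorem ticks_add (m n : ℕ) : ticks m ++ ticks n = ticks (m + n) := by simp [ticks]

theorem encodeWire_eq (n : ℕ) : encodeWire n = ticks n ++ [.endWire] := rfl

theorem splitMap_eq_nil {α β : Type} (f : List α → α → List α → List β) (u l rest : List α)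
    (h : ∀ a ∈ l, ∀ u w, f u a w = []) :
    splitMap f u (l ++ rest) = splitMap f (l.reverse ++ u) rest := by
  induction l generalizing u with
  | nil => rfl
  | cons a l ih =>
    simp only [List.cons_append, splitMap, h a (by simp), List.nil_append, List.reverse_cons,
      List.append_assoc]
    exact ih _ fun b hb => h b (by simp [hb])

theorem splitMap_const {α β : Type} (f : α → List β) (u l : List α) :
    splitMap (fun _ a _ => f a) u l = l.flatMap f := by
  induction l generalizing u with
  | nil => rfl
  | cons a l ih => simp [splitMap, ih]

theorem splitMap_congr {α β : Type} {f g : List α → α → List α → List β}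
    (h : ∀ u a w, f u a w = g u a w) (u l : List α) : splitMap f u l = splitMap g u l := by
  have : f = g := by funext u a w; exact h u a w
  rw [this]

/-- On a unary number `each` is a counting loop: the symbols before the current one are the counter
in unary. The symbols after it are a decreasing counter, as in `splitMap_ticks_after`. -/
theorem splitMap_ticks_before {β : Type} {f : List Symbol → Symbol → List Symbol → List β}
    {g : ℕ → List β} (h : ∀ i w, f (ticks i) .tick w = g i) (n : ℕ) :
    splitMap f [] (ticks n) = (List.range n).flatMap g := by
  suffices H : ∀ n m, splitMap f (ticks m) (ticks n) =
      (List.range n).flatMap fun i => g (m + i) by simpa using H n 0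
  intro n
  induction n with
  | zero => intro m; rfl
  | succ n ih =>
    intro m
    have h1 := ih (m + 1)
    have h2 := h m
    simp only [ticks, List.replicate_succ] at h1 h2 ⊢
    rw [splitMap, h1, h2, List.range_succ_eq_map]
    simp [List.flatMap_map, Nat.add_assoc, Nat.add_comm 1]

theorem splitMap_ticks_after {β : Type} {f : List Symbol → Symbol → List Symbol → List β}
    {g : ℕ → List β} (h : ∀ i u, f u .tick (ticks i) = g i) (n : ℕ) :
    splitMap f [] (ticks n) = (List.range n).reverse.flatMap g := by
  generalize ([] : List Symbol) = u
  induction n generalizing u with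
  | zero => rfl
  | succ n ih =>
    simp only [ticks, List.replicate_succ] at h ih ⊢
    rw [splitMap, ih, h, List.range_succ]
    simp

/-- As many ticks as there are symbols `a` with `P a` in `v`. -/
def Expr.count (P : Symbol → Bool) (v s p : V) : Expr V :=
  .each v s p fun a => if P a then .sym .tick else .nil

theorem Expr.denote_count (P : Symbol → Bool) (v s p : V) (ρ) :
    (Expr.count P v s p).denote ρ = ticks ((ρ v).countP P) := by
  have : (Expr.count P v s p).denote ρ = (ρ v).flatMap fun a => if P a then [.tick] else [] := by
    rw [← splitMap_const _ []]
    refine splitMap_congr (fun u a w => ?_) _ _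
    simp only
    split_ifs <;> rfl
  rw [this]
  generalize ρ v = l
  induction l with
  | nil => rfl
  | cons a l ih =>
    rw [List.flatMap_cons, ih, List.countP_cons]
    split_ifs <;> simp [ticks, List.replicate_succ]

theorem countP_eq_zero_iff_all {l : List Symbol} {P : Symbol → Bool} :
    ticks (l.countP fun b => !P b) = [] ↔ ∀ b ∈ l, P b = true := by
  simp [ticks, List.countP_eq_zero]

/-- The longest initial segment of `v` all of whose symbols satisfy `P`. -/
def Expr.takeWhile (P : Symbol → Bool) (v s p c s' p' : V) : Expr V :=
  -- `c` counts the earlier symbols that violate `P`; `a` can be kept only if there are none.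
  .each v s p fun a => .bind c (.count (fun b => !P b) p s' p')
    (.ifNil c (if P a then .sym a else .nil) .nil)

theorem Expr.denote_takeWhile (P : Symbol → Bool) (v s p c s' p' : V) (ρ) :
    (Expr.takeWhile P v s p c s' p').denote ρ = (ρ v).takeWhile P := by
  have h : ∀ u l : List Symbol, splitMap (fun u a (_ : List Symbol) =>
      if ticks (u.countP fun b => !P b) = [] then (if P a then [a] else []) else []) u l =
      if ∀ b ∈ u, P b = true then l.takeWhile P else [] := by
    intro u l
    induction l generalizing u with
    | nil => simp [splitMap]
    | cons a l ih =>
      rw [splitMap, ih]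
      simp only [countP_eq_zero_iff_all, List.mem_cons, forall_eq_or_imp, List.takeWhile_cons]
      by_cases hu : ∀ b ∈ u, P b = true
      · by_cases ha : P a = true
        · simp only [ha, true_and, if_true, if_pos hu, List.singleton_append]
        · simp [ha]
      · simp [hu]
  have := h [] (ρ v)
  simp only [List.not_mem_nil, false_imp_iff, implies_true, if_true] at this
  rw [← this]
  refine splitMap_congr (fun u a w => ?_) _ _
  simp only [denote, update_self, denote_count]
  split_ifs <;> rfl

/-- What follows the first symbol of `v` that does not satisfy `P`. -/
def Expr.dropWhileTail (P : Symbol → Bool) (v s p c s' p' : V) : Expr V :=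
  .each v s p fun a => .bind c (.count (fun b => !P b) p s' p') (.ifNil c .nil (.sym a))

theorem Expr.denote_dropWhileTail (P : Symbol → Bool) (v s p c s' p' : V) (ρ) :
    (Expr.dropWhileTail P v s p c s' p').denote ρ = ((ρ v).dropWhile P).tail := by
  have h : ∀ u l : List Symbol, splitMap (fun u a (_ : List Symbol) =>
      if ticks (u.countP fun b => !P b) = [] then [] else [a]) u l =
      if ∀ b ∈ u, P b = true then (l.dropWhile P).tail else l := by
    intro u l
    induction l generalizing u with
    | nil => simp [splitMap]
    | cons a l ih =>
      rw [splitMap, ih]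
      simp only [countP_eq_zero_iff_all, List.mem_cons, forall_eq_or_imp, List.dropWhile_cons]
      by_cases hu : ∀ b ∈ u, P b = true
      · by_cases ha : P a = true
        · simp only [ha, true_and, if_true, if_pos hu, List.nil_append]
        · simp only [ha, false_and, if_false, if_pos hu, Bool.false_eq_true, List.nil_append,
            List.tail_cons]
      · simp [hu]
  have := h [] (ρ v)
  simp only [List.not_mem_nil, false_imp_iff, implies_true, if_true] at this
  rw [← this]
  refine splitMap_congr (fun u a w => ?_) _ _
  simp only [denote, update_self, denote_count]

theorem countP_flatMap_encodeWire (ws : List ℕ) :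
    ((ws.flatMap encodeWire).countP fun b => b = .endWire) = ws.length := by
  rw [List.countP_flatMap]
  have : (List.countP (fun b => decide (b = Symbol.endWire))) ∘ encodeWire = fun _ => 1 := by
    funext n; simp [encodeWire, List.countP_replicate]
  rw [this]; simp

/-- Concatenates the values of `e`, where `x` runs through the wire numbers in the list `v` and `i`
through their indices. -/
def Expr.eachWire (v s p x i c s' p' s'' p'' : V) (e : Expr V) : Expr V :=
  .each v s p fun a => if a = .endWire then
    .bind x (.takeWhile (fun b => b = .tick) p s' p' c s'' p'')
      (.bind i (.count (fun b => b = .endWire) p s' p') e) else .nil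

/-- A wire is read backwards from its end marker: the reversed prefix begins with the ticks of this
wire, up to the previous marker, and the number of markers in it is the index. -/
theorem Expr.denote_eachWire (v s p x i c s' p' s'' p'' : V) (hxp : x ≠ p) (e : Expr V) (ρ)
    (ws : List ℕ) (hv : ρ v = ws.flatMap encodeWire) (g : ℕ → ℕ → List Symbol)
    (he : ∀ k w l l', e.denote (update (update (update (update ρ s l) p l') x (ticks w)) i
      (ticks k)) = g k w) :
    (Expr.eachWire v s p x i c s' p' s'' p'' e).denote ρ = (ws.mapIdx g).flatten := by
  have h : ∀ (ws us : List ℕ), splitMap (fun u a (_ : List Symbol) =>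
      if a = .endWire then g (u.countP fun b => b = .endWire)
        (u.takeWhile fun b => b = .tick).length else [])
      (us.flatMap encodeWire).reverse (ws.flatMap encodeWire) =
        (ws.mapIdx fun i => g (us.length + i)).flatten := by
    intro ws
    induction ws with
    | nil => intro us; rfl
    | cons w ws ih =>
      intro us
      have h1 := ih (us ++ [w])
      have h2 := countP_flatMap_encodeWire us
      have h3 : ∀ l : List ℕ, ((ticks w ++ (l.flatMap encodeWire).reverse).takeWhile
          fun b => b = .tick) = ticks w := by
        intro l
        rw [List.takeWhile_append_of_pos (by simp [ticks])]
        rcases List.eq_nil_or_concat l with rfl | ⟨l, w, rfl⟩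
        · simp
        · simp [encodeWire]
      rw [List.flatMap_cons, encodeWire_eq w, List.append_assoc,
        splitMap_eq_nil _ _ _ _ (fun a ha u w => by
          have : a = .tick := (List.mem_replicate.1 ha).2
          simp [this])]
      simp only [List.cons_append, List.nil_append, splitMap, if_true]
      have h4 : (Symbol.endWire :: ((ticks w).reverse ++ (us.flatMap encodeWire).reverse)) =
          ((us ++ [w]).flatMap encodeWire).reverse := by simp [encodeWire]
      rw [h4, h1]
      simp only [ticks, List.reverse_replicate] at h3 ⊢
      rw [h3, List.countP_append, List.countP_reverse, h2]
      simp [List.countP_replicate, List.mapIdx_cons, Nat.add_assoc, Nat.add_comm 1]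
  have := h ws []
  simp only [List.flatMap_nil, List.reverse_nil, List.length_nil, Nat.zero_add] at this
  rw [← this, Expr.eachWire, Expr.denote, hv]
  refine splitMap_congr (fun u a w => ?_) _ _
  split_ifs with ha
  · have ht : ∀ l : List Symbol, l.takeWhile (fun b => b = .tick) =
        ticks (l.takeWhile fun b => b = .tick).length := by
      intro l
      refine List.eq_replicate_of_mem fun b hb => ?_
      simpa using List.mem_takeWhile_imp hb
    simp only [denote, denote_takeWhile, update_self, denote_count, update_of_ne hxp.symm]
    rw [ht u, he, ← ht]
  · rfl

/-- A wire whose number is the sum of the given variables. -/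
def Expr.wire (l : List V) : Expr V := l.foldr (fun v e => .app (.var v) e) (.sym .endWire)

theorem Expr.denote_wire (l : List V) (ρ) :
    (Expr.wire l).denote ρ = (l.map ρ).flatten ++ [.endWire] := by
  induction l with
  | nil => rfl
  | cons v l ih =>
    simp only [wire, List.foldr_cons, denote, List.map_cons, List.flatten_cons,
      List.append_assoc]
    rw [← ih]
    rfl

theorem Expr.scoped_count {P : Symbol → Bool} {v s p : V} {U : Finset V} (hv : v ∈ U)
    (hs : s ∉ U) (hp : p ∉ U) (hsp : s ≠ p) : (Expr.count P v s p).Scoped U :=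
  ⟨hv, hs, hp, hsp, fun a => by dsimp only; split_ifs <;> exact trivial⟩

theorem Expr.scoped_takeWhile {P : Symbol → Bool} {v s p c s' p' : V} {U : Finset V} (hv : v ∈ U)
    (hU : ∀ x ∈ [s, p, c, s', p'], x ∉ U) (hn : [s, p, c, s', p'].Nodup) :
    (Expr.takeWhile P v s p c s' p').Scoped U := by
  simp only [List.mem_cons, List.not_mem_nil, or_false, forall_eq_or_imp, forall_eq] at hU
  simp only [List.nodup_cons, List.mem_cons, List.not_mem_nil, or_false, not_or] at hn
  refine ⟨hv, hU.1, hU.2.1, hn.1.1, fun a => ⟨?_, ?_, ?_, ?_, ?_⟩⟩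
  · simp only [Finset.mem_insert]; tauto
  · refine scoped_count ?_ ?_ ?_ ?_ <;> (try simp only [Finset.mem_insert]) <;> tauto
  · simp
  · split_ifs <;> exact trivial
  · exact trivial

theorem Expr.scoped_dropWhileTail {P : Symbol → Bool} {v s p c s' p' : V} {U : Finset V}
    (hv : v ∈ U) (hU : ∀ x ∈ [s, p, c, s', p'], x ∉ U) (hn : [s, p, c, s', p'].Nodup) :
    (Expr.dropWhileTail P v s p c s' p').Scoped U := by
  simp only [List.mem_cons, List.not_mem_nil, or_false, forall_eq_or_imp, forall_eq] at hU
  simp only [List.nodup_cons, List.mem_cons, List.not_mem_nil, or_false, not_or] at hn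
  refine ⟨hv, hU.1, hU.2.1, hn.1.1, fun a => ⟨?_, ?_, ?_, trivial, trivial⟩⟩
  · simp only [Finset.mem_insert]; tauto
  · refine scoped_count ?_ ?_ ?_ ?_ <;> (try simp only [Finset.mem_insert]) <;> tauto
  · simp

theorem Expr.scoped_wire {l : List V} {U : Finset V} (h : ∀ v ∈ l, v ∈ U) :
    (Expr.wire l).Scoped U := by
  induction l with
  | nil => exact trivial
  | cons v l ih => exact ⟨h v (by simp), ih fun w hw => h w (by simp [hw])⟩

theorem Expr.scoped_eachWire {v s p x i c s' p' s'' p'' : V} {e : Expr V} {U : Finset V}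
    (hv : v ∈ U) (hU : ∀ y ∈ [s, p, x, i, c, s', p', s'', p''], y ∉ U)
    (hn : [s, p, x, i, c, s', p', s'', p''].Nodup)
    (he : e.Scoped (insert i (insert x (insert s (insert p U))))) :
    (Expr.eachWire v s p x i c s' p' s'' p'' e).Scoped U := by
  simp only [List.mem_cons, List.not_mem_nil, or_false, forall_eq_or_imp, forall_eq] at hU
  simp only [List.nodup_cons, List.mem_cons, List.not_mem_nil, or_false, not_or,
    List.nodup_nil, and_true, not_false_eq_true] at hn
  refine ⟨hv, hU.1, hU.2.1, hn.1.1, fun a => ?_⟩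
  dsimp only
  split_ifs
  · refine ⟨?_, ?_, ?_, ?_, he⟩
    · grind
    · refine scoped_takeWhile (by simp) ?_ ?_
      · grind
      · grind
    · grind
    · refine scoped_count ?_ ?_ ?_ ?_ <;> grind
  · exact trivial

end Macros

end

/-! ### The expression that describes the simulating circuit -/

section Sim

open QRO.Expr (wire count takeWhile dropWhileTail eachWire)

/-- Loops over a list of wires; the wire is in variable 22, and its index in variable 23. -/
abbrev wiresExpr (v : Fin 32) (e : Expr (Fin 32)) : Expr (Fin 32) :=
  eachWire v 20 21 22 23 24 25 26 27 28 e

/-- Expression for `flagGates`. -/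
def flagExpr : Expr (Fin 32) :=
  .app (.sym .pauliX) (.app (wire [2, 2, 6, 14]) (.each 7 20 21 fun _ =>
    .app (.sym .toffoli) (.app (wire [2, 2, 6, 14, 21]) (.app (wire [2, 2, 5, 3, 14, 21])
      (wire [2, 2, 6, 14, 21, 15])))))

def copyExpr : Expr (Fin 32) :=
  wiresExpr 11 (.app (.sym .toffoli) (.app (wire [2, 2, 6, 14, 7]) (.app (wire [22])
    (wire [2, 23]))))

/-- `q` selects the direction of the loop over the reduction steps: variable 16, the symbols to
come, counts down as in `reduceGates`, and variable 17, the symbols before, counts up as in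
`unreduceGates`. -/
def reduceExpr (q : Fin 32) : Expr (Fin 32) :=
  .each 5 16 17 fun _ => wiresExpr 11 (.app (.sym .toffoli) (.app (wire [22])
    (.app (wire [2, 2, q, 3]) (wire [2, 2, q, 23]))))

def answerExpr : Expr (Fin 32) :=
  wiresExpr 12 (.app (.sym .cnot) (.app (wire [2, 2, 4, 23]) (wire [22])))

/-- Evaluated at a symbol `query`, with the rest of the description in variable 9 and the part
before it in variable 10. Both wire lists are cut out at their end markers. The length of variable
10 is the position `j`, so looping over it makes variable 14 equal to `j * hashDeg s`. -/
def queryExpr : Expr (Fin 32) :=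
  .bind 11 (takeWhile (fun b => b ≠ .endList) 9 20 21 22 23 24)
    (.bind 13 (dropWhileTail (fun b => b ≠ .endList) 9 20 21 22 23 24)
      (.bind 12 (takeWhile (fun b => b ≠ .endList) 13 20 21 22 23 24)
        (.bind 14 (.each 10 20 21 fun _ => .var 3)
          (.app flagExpr (.app copyExpr (.app (reduceExpr 16) (.app answerExpr
            (reduceExpr 17))))))))

/-- `drop` performs the truncated subtraction of the number of output wires (variable 18) from the
arity of the queries (variable 8). -/
def outputExpr : Expr (Fin 32) :=
  .app (.sym .output) (.bind 18 (count (fun b => b = .endWire) 9 20 21)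
    (.bind 19 (.drop 8 18 20 21) (.app (.each 19 20 21 fun _ => wire [2, 18, 21])
      (.sym .endList))))

/-- All output is produced at the head symbol of a gate or of the output list; the symbols of wires
contribute nothing. An elementary gate is copied together with the wire symbols that follow it. -/
def gateExpr : Symbol → Expr (Fin 32)
  | .query => queryExpr
  | .output => outputExpr
  | .tick => .nil
  | .endWire => .nil
  | .endList => .nil
  | a => .app (.sym a) (takeWhile (fun b => b = .tick ∨ b = .endWire) 9 20 21 22 23 24)

/-- The input wires of the first query. -/
def firstQueryExpr : Expr (Fin 32) :=
  .each 0 20 21 fun a => if a = .query then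
    .bind 22 (count (fun b => b = .query) 21 23 24)
      (.ifNil 22 (takeWhile (fun b => b ≠ .endList) 20 23 24 25 26 27) .nil) else .nil

def hadamardExpr : Expr (Fin 32) :=
  .each 6 20 21 fun _ => .app (.sym .hadamard) (wire [2, 2, 21])

/-- The description of `simCircuit C` as a function of the description of `C`. -/
def simExpr : Expr (Fin 32) :=
  .bind 2 (count (fun _ => true) 0 20 21)
  -- Variable 0 holds the description, of length `s`, so nested loops over it multiply by `s` in
  -- unary.
  (.bind 3 (.each 0 20 21 fun _ => .each 0 22 23 fun _ =>
    .app (.sym .tick) (.app (.sym .tick) (.sym .tick)))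
  (.bind 4 (.each 0 20 21 fun _ => .each 0 22 23 fun _ => .app (.sym .tick) (.sym .tick))
  (.bind 5 (.each 0 20 21 fun _ => .app (.var 3) (.var 3))
  (.bind 6 (.app (.var 5) (.app (.var 3) (.each 0 20 21 fun _ => .var 3)))
  (.bind 29 (.app (.var 2) (.var 2))
  (.bind 7 (.size 29 20 21)
  (.bind 15 (.sym .tick)
  (.bind 30 firstQueryExpr
  (.bind 8 (count (fun b => b = .endWire) 30 20 21)
  (.app hadamardExpr (.each 0 9 10 gateExpr)))))))))))

theorem gateExpr_scoped (a : Symbol) :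
    (gateExpr a).Scoped {9, 10, 8, 30, 15, 7, 29, 6, 5, 4, 3, 2, 0, 1} := by
  cases a
  all_goals
    try unfold gateExpr
    try unfold queryExpr flagExpr copyExpr reduceExpr answerExpr
    try unfold outputExpr
  all_goals
    repeat' first
      | exact trivial
      | decide
      | exact (show _ ∈ (_ : Finset (Fin 32)) by decide)
      | refine Expr.scoped_count ?_ ?_ ?_ ?_
      | refine Expr.scoped_takeWhile ?_ ?_ ?_
      | refine Expr.scoped_dropWhileTail ?_ ?_ ?_
      | refine Expr.scoped_eachWire ?_ ?_ ?_ ?_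
      | refine Expr.scoped_wire ?_
      | refine ⟨?_, ?_⟩
      | intro _

theorem simExpr_scoped : simExpr.Scoped {0, 1} := by
  unfold simExpr hadamardExpr firstQueryExpr
  repeat' first
    | exact gateExpr_scoped _
    | exact trivial
    | decide
    | exact (show _ ∈ (_ : Finset (Fin 32)) by decide)
    | refine Expr.scoped_count ?_ ?_ ?_ ?_
    | refine Expr.scoped_takeWhile ?_ ?_ ?_
    | refine Expr.scoped_wire ?_
    | refine ⟨?_, ?_⟩
    | (show Expr.Scoped _ (ite _ _ _); split_ifs)
    | intro _

/-- The variables that hold the parameters of `simCircuit`. -/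
structure IsSimEnv (s d : ℕ) (ρ : Fin 32 → List Symbol) : Prop where
  len : ρ 2 = ticks s
  deg : ρ 3 = ticks (hashDeg s)
  pos : ρ 4 = ticks (hashPos s)
  steps : ρ 5 = ticks (hashSteps s)
  rand : ρ 6 = ticks (randLen s)
  coins : ρ 7 = ticks (coinNum s)
  one : ρ 15 = ticks 1
  arity : ρ 8 = ticks d

theorem flatMap_encode_mapIdx (ws : List ℕ) (g : ℕ → ℕ → Gate) :
    (ws.mapIdx g).flatMap Gate.encode = (ws.mapIdx fun i w => (g i w).encode).flatten := by
  rw [List.flatMap_def]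
  simp [List.mapIdx_eq_zipIdx_map, Function.comp_def]

variable {s d j : ℕ} {ρ : Fin 32 → List Symbol} {ins outs : List ℕ}

theorem denote_flagExpr (h : IsSimEnv s d ρ) (hj : ρ 14 = ticks (j * hashDeg s)) :
    flagExpr.denote ρ = (flagGates s j).flatMap Gate.encode := by
  simp only [flagExpr, Expr.denote, Expr.denote_wire, h.coins]
  rw [splitMap_ticks_before (g := fun l =>
    (Gate.toffoli (ancWire s j l) (coinWire s j l) (ancWire s j (l + 1))).encode)]
  · simp only [flagGates, List.flatMap_cons, List.flatMap_map]
    simp [Gate.encode, h.len, h.rand, hj, encodeWire_eq, ticks, ancWire, List.replicate_add,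
      -List.replicate_append_replicate]
  · intro i w
    simp [Gate.encode, h.len, h.rand, hj, h.one, h.deg, h.steps, encodeWire_eq, ticks, ancWire,
      coinWire, List.replicate_add,
      -List.replicate_append_replicate]

theorem denote_copyExpr (h : IsSimEnv s d ρ) (hj : ρ 14 = ticks (j * hashDeg s))
    (hi : ρ 11 = ins.flatMap encodeWire) :
    copyExpr.denote ρ = (copyGates s j ins).flatMap Gate.encode := by
  rw [copyExpr, Expr.denote_eachWire (ws := ins) (hv := hi) (hxp := by decide) (g := fun i w =>
    (Gate.toffoli (ancWire s j (coinNum s)) w (outWire s i)).encode)]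
  · rw [copyGates, flatMap_encode_mapIdx]
  · intro k w l l'
    simp [Expr.denote, Expr.denote_wire, Gate.encode, h.len, h.rand, hj, h.coins, encodeWire_eq,
      ticks, ancWire, outWire, List.replicate_add,
      -List.replicate_append_replicate]

theorem denote_reduceExpr_after (h : IsSimEnv s d ρ) (hi : ρ 11 = ins.flatMap encodeWire) :
    (reduceExpr 16).denote ρ = (reduceGates s ins).flatMap Gate.encode := by
  simp only [reduceExpr, Expr.denote, h.steps]
  rw [splitMap_ticks_after (g := fun p => (reduceStep s ins p).flatMap Gate.encode)]
  · rw [reduceGates, List.flatMap_assoc]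
  · intro i u
    rw [Expr.denote_eachWire (ws := ins) (hv := by simpa using hi) (hxp := by decide)
      (g := fun k w => (Gate.toffoli w (keyWire s (i + hashDeg s)) (keyWire s (i + k))).encode)]
    · rw [reduceStep, flatMap_encode_mapIdx]
    · intro k w l l'
      simp [Expr.denote, Expr.denote_wire, Gate.encode, h.len, h.deg, encodeWire_eq,
        ticks, keyWire, List.replicate_add,
      -List.replicate_append_replicate]

theorem denote_reduceExpr_before (h : IsSimEnv s d ρ) (hi : ρ 11 = ins.flatMap encodeWire) :
    (reduceExpr 17).denote ρ = (unreduceGates s ins).flatMap Gate.encode := by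
  simp only [reduceExpr, Expr.denote, h.steps]
  rw [splitMap_ticks_before (g := fun p => (reduceStep s ins p).flatMap Gate.encode)]
  · rw [unreduceGates, List.flatMap_assoc]
  · intro i u
    rw [Expr.denote_eachWire (ws := ins) (hv := by simpa using hi) (hxp := by decide)
      (g := fun k w => (Gate.toffoli w (keyWire s (i + hashDeg s)) (keyWire s (i + k))).encode)]
    · rw [reduceStep, flatMap_encode_mapIdx]
    · intro k w l l'
      simp [Expr.denote, Expr.denote_wire, Gate.encode, h.len, h.deg, encodeWire_eq,
        ticks, keyWire, List.replicate_add,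
      -List.replicate_append_replicate]

theorem denote_answerExpr (h : IsSimEnv s d ρ) (ho : ρ 12 = outs.flatMap encodeWire) :
    answerExpr.denote ρ = (answerGates s outs).flatMap Gate.encode := by
  rw [answerExpr, Expr.denote_eachWire (ws := outs) (hv := ho) (hxp := by decide) (g := fun i w =>
    (Gate.cnot (keyWire s (hashPos s + i)) w).encode)]
  · rw [answerGates, flatMap_encode_mapIdx]
  · intro k w l l'
    simp [Expr.denote, Expr.denote_wire, Gate.encode, h.len, h.pos, encodeWire_eq,
      ticks, keyWire, List.replicate_add,
      -List.replicate_append_replicate]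

theorem mem_flatMap_encodeWire {ws : List ℕ} {a : Symbol} (h : a ∈ ws.flatMap encodeWire) :
    a = .tick ∨ a = .endWire := by
  simp only [List.mem_flatMap, encodeWire, List.mem_append, List.mem_replicate,
    List.mem_singleton] at h
  obtain ⟨_, _, h | h⟩ := h
  · exact .inl h.2
  · exact .inr h

theorem takeWhile_encodeWires (ws : List ℕ) (rest : List Symbol) :
    (encodeWires ws ++ rest).takeWhile (fun b => b ≠ .endList) = ws.flatMap encodeWire := by
  rw [encodeWires, List.append_assoc, List.takeWhile_append_of_pos]
  · simp
  · intro a ha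
    rcases mem_flatMap_encodeWire ha with rfl | rfl <;> simp

theorem dropWhile_encodeWires (ws : List ℕ) (rest : List Symbol) :
    ((encodeWires ws ++ rest).dropWhile (fun b => b ≠ .endList)).tail = rest := by
  rw [encodeWires, List.append_assoc, List.dropWhile_append_of_pos]
  · simp
  · intro a ha
    rcases mem_flatMap_encodeWire ha with rfl | rfl <;> simp

theorem flatMap_const_ticks (l : List Symbol) (n : ℕ) :
    (l.flatMap fun _ => ticks n) = ticks (l.length * n) := by
  induction l with
  | nil => simp
  | cons a l ih => rw [List.flatMap_cons, ih, ticks_add, List.length_cons]; congr 1; ring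

theorem IsSimEnv.update (h : IsSimEnv s d ρ) {x : Fin 32} (hx : x ∉ ({2, 3, 4, 5, 6, 7, 15, 8} :
    Finset (Fin 32))) (l : List Symbol) : IsSimEnv s d (update ρ x l) := by
  simp only [Finset.mem_insert, Finset.mem_singleton, not_or] at hx
  obtain ⟨h2, h3, h4, h5, h6, h7, h15, h8⟩ := hx
  constructor
  · rw [update_of_ne (Ne.symm h2), h.len]
  · rw [update_of_ne (Ne.symm h3), h.deg]
  · rw [update_of_ne (Ne.symm h4), h.pos]
  · rw [update_of_ne (Ne.symm h5), h.steps]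
  · rw [update_of_ne (Ne.symm h6), h.rand]
  · rw [update_of_ne (Ne.symm h7), h.coins]
  · rw [update_of_ne (Ne.symm h15), h.one]
  · rw [update_of_ne (Ne.symm h8), h.arity]

theorem denote_queryExpr (h : IsSimEnv s d ρ) {rest u : List Symbol}
    (h9 : ρ 9 = encodeWires ins ++ (encodeWires outs ++ rest)) (h10 : ρ 10 = u) :
    queryExpr.denote ρ = (queryGates s u.length ins outs).flatMap Gate.encode := by
  simp only [queryExpr, Expr.denote, Expr.denote_takeWhile, Expr.denote_dropWhileTail]
  have e14 : ∀ ρ' : Fin 32 → List Symbol, ρ' 10 = u → ρ' 3 = ticks (hashDeg s) →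
      splitMap (fun v _ w => Function.update (Function.update ρ' 20 w) 21 v 3) [] (ρ' 10) =
        ticks (u.length * hashDeg s) := by
    intro ρ' h1 h2
    rw [h1, ← flatMap_const_ticks, ← splitMap_const _ []]
    refine splitMap_congr (fun _ _ _ => ?_) _ _
    simp [h2]
  rw [e14 _ (by simp [h10]) (by simp [h.deg])]
  simp only [update_self, ne_eq, Fin.reduceEq, not_false_eq_true, update_of_ne, h9,
    takeWhile_encodeWires, dropWhile_encodeWires]
  have hE : IsSimEnv s d (Function.update (Function.update (Function.update (Function.update ρ 11
      (ins.flatMap encodeWire)) 13 (encodeWires outs ++ rest)) 12 (outs.flatMap encodeWire)) 14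
      (ticks (u.length * hashDeg s))) :=
    (((h.update (by decide) _).update (by decide) _).update (by decide) _).update (by decide) _
  rw [denote_flagExpr hE (j := u.length) (by simp), denote_copyExpr hE (j := u.length) (ins := ins)
    (by simp) (by simp), denote_reduceExpr_after hE (ins := ins) (by simp),
    denote_answerExpr hE (outs := outs) (by simp), denote_reduceExpr_before hE (ins := ins)
    (by simp)]
  simp [queryGates]

end Sim

/-! ### Correctness of the expression -/

section

open QRO.Expr (wire count takeWhile dropWhileTail eachWire)

variable {s d j : ℕ} {ρ : Fin 32 → List Symbol} {ins outs : List ℕ}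

/-- The symbol is not part of the description of a wire. -/
def IsHead (l : List Symbol) : Prop :=
  ∀ a ∈ l.head?, a ≠ .tick ∧ a ≠ .endWire

theorem isHead_encode (g : Gate) (rest : List Symbol) : IsHead (g.encode ++ rest) := by
  cases g <;> simp [IsHead, Gate.encode]

theorem isHead_flatMap_encode (gs : List Gate) {rest : List Symbol} (h : IsHead rest) :
    IsHead (gs.flatMap Gate.encode ++ rest) := by
  cases gs with
  | nil => exact h
  | cons g gs => rw [List.flatMap_cons, List.append_assoc]; exact isHead_encode _ _

theorem takeWhile_flatMap_encodeWire (ws : List ℕ) {rest : List Symbol} (h : IsHead rest) :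
    (ws.flatMap encodeWire ++ rest).takeWhile (fun b => b = .tick ∨ b = .endWire) =
      ws.flatMap encodeWire := by
  rw [List.takeWhile_append_of_pos]
  · cases rest with
    | nil => simp
    | cons a l =>
      obtain ⟨h1, h2⟩ := h a (by simp)
      simp [h1, h2]
  · intro a ha
    rcases mem_flatMap_encodeWire ha with rfl | rfl <;> simp

theorem gateExpr_eq_nil {ws : List ℕ} {a : Symbol} (ha : a ∈ encodeWires ws) :
    gateExpr a = .nil := by
  simp only [encodeWires, List.mem_append, List.mem_singleton] at ha
  rcases ha with ha | rfl
  · rcases mem_flatMap_encodeWire ha with rfl | rfl <;> rfl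
  · rfl

/-- A gate is consumed as one block: its head yields the replacement and its wire symbols yield
nothing. `IsHead rest` guarantees that the wires of an elementary gate end where the next item
begins. The position of the gate is the length of the prefix `u`. -/
theorem splitMap_gateExpr (h : IsSimEnv s d ρ) (g : Gate) (u : List Symbol) {rest : List Symbol}
    (hr : IsHead rest) :
    splitMap (fun u a w => (gateExpr a).denote (update (update ρ 9 w) 10 u)) u
        (g.encode ++ rest) =
      (simGate s u.length g).flatMap Gate.encode ++
        splitMap (fun u a w => (gateExpr a).denote (update (update ρ 9 w) 10 u))
          (g.encode.reverse ++ u) rest := by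
  have key : ∀ (a : Symbol) (ws : List ℕ),
      (∀ ρ', (gateExpr a).denote ρ' = a :: (ρ' 9).takeWhile
        (fun b => b = .tick ∨ b = .endWire)) →
      splitMap (fun u a w => (gateExpr a).denote (update (update ρ 9 w) 10 u)) u
        (a :: ws.flatMap encodeWire ++ rest) =
      a :: ws.flatMap encodeWire ++
        splitMap (fun u a w => (gateExpr a).denote (update (update ρ 9 w) 10 u))
          ((a :: ws.flatMap encodeWire).reverse ++ u) rest := by
    intro a ws ha
    rw [List.cons_append, splitMap, splitMap_eq_nil, ha]
    · rw [update_of_ne (by decide), update_self, takeWhile_flatMap_encodeWire _ hr]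
      simp
    · intro b hb u w
      rw [gateExpr_eq_nil (ws := ws) (by simp [encodeWires, hb])]
      rfl
  have hd : ∀ a ρ', (Expr.app (.sym a) (takeWhile (fun b => b = .tick ∨ b = .endWire) 9 20 21 22
      23 24 : Expr (Fin 32))).denote ρ' = a :: (ρ' 9).takeWhile
        (fun b => b = .tick ∨ b = .endWire) := by
    intro a ρ'
    simp only [Expr.denote, Expr.denote_takeWhile]
    rfl
  cases g with
  | hadamard i => simpa [simGate, Gate.encode] using key .hadamard [i] (hd _)
  | phaseT i => simpa [simGate, Gate.encode] using key .phaseT [i] (hd _)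
  | pauliX i => simpa [simGate, Gate.encode] using key .pauliX [i] (hd _)
  | cnot i j => simpa [simGate, Gate.encode] using key .cnot [i, j] (hd _)
  | toffoli i j k => simpa [simGate, Gate.encode] using key .toffoli [i, j, k] (hd _)
  | query ins outs =>
    have hE : ∀ l l', IsSimEnv s d (update (update ρ 9 l) 10 l') := fun l l' =>
      (h.update (by decide) _).update (by decide) _
    rw [Gate.encode, List.cons_append, splitMap, splitMap_eq_nil]
    · have := denote_queryExpr (hE (encodeWires ins ++ encodeWires outs ++ rest) u) (ins := ins)
        (outs := outs) (rest := rest) (u := u) (by simp) (by simp)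
      rw [simGate, ← this]
      simp [gateExpr]
    · intro b hb u w
      rcases List.mem_append.1 hb with hb | hb <;> rw [gateExpr_eq_nil hb] <;> rfl

theorem splitMap_gateExpr_flatMap (h : IsSimEnv s d ρ) (gs : List Gate) (u : List Symbol)
    {rest : List Symbol} (hr : IsHead rest) :
    splitMap (fun u a w => (gateExpr a).denote (update (update ρ 9 w) 10 u)) u
        (gs.flatMap Gate.encode ++ rest) =
      (simGates s u.length gs).flatMap Gate.encode ++
        splitMap (fun u a w => (gateExpr a).denote (update (update ρ 9 w) 10 u))
          ((gs.flatMap Gate.encode).reverse ++ u) rest := by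
  induction gs generalizing u with
  | nil => simp [simGates]
  | cons g gs ih =>
    rw [List.flatMap_cons, List.append_assoc, splitMap_gateExpr h g u
      (isHead_flatMap_encode gs hr), ih]
    simp [simGates, Nat.add_comm]

theorem denote_outputExpr (h : IsSimEnv s d ρ) {ws : List ℕ} (h9 : ρ 9 = encodeWires ws) :
    outputExpr.denote ρ = .output :: encodeWires ((List.range (d - ws.length)).map
      fun k => outWire s (ws.length + k)) := by
  simp only [outputExpr, Expr.denote, Expr.denote_count, h9, Expr.denote_wire]
  have hc : (encodeWires ws).countP (fun b => b = .endWire) = ws.length := by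
    rw [encodeWires, List.countP_append, countP_flatMap_encodeWire]; simp
  rw [hc]
  simp only [update_self, update_of_ne, ne_eq, Fin.reduceEq, not_false_eq_true, h.arity,
    List.length_replicate, ticks, List.drop_replicate]
  rw [splitMap_ticks_before (g := fun k => encodeWire (outWire s (ws.length + k)))]
  · simp [encodeWires, List.flatMap_map]
  · intro i w
    simp [h.len, encodeWire_eq, ticks, outWire, List.replicate_add,
      -List.replicate_append_replicate]

theorem splitMap_gateExpr_output (h : IsSimEnv s d ρ) (u : List Symbol) (ws : List ℕ) :
    splitMap (fun u a w => (gateExpr a).denote (update (update ρ 9 w) 10 u)) u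
        (.output :: encodeWires ws) =
      .output :: encodeWires ((List.range (d - ws.length)).map
        fun k => outWire s (ws.length + k)) := by
  rw [splitMap, ← List.append_nil (encodeWires ws), splitMap_eq_nil]
  · rw [List.append_nil, gateExpr, denote_outputExpr (ws := ws)
      ((h.update (by decide) _).update (by decide) _) (by simp)]
    simp [splitMap]
  · intro b hb u w
    rw [gateExpr_eq_nil hb]; rfl

theorem query_notMem_encodeWires (ws : List ℕ) : Symbol.query ∉ encodeWires ws := by
  simp [encodeWires, encodeWire]

/-- Only the first `query` symbol contributes, because each later one finds a `query` in its prefix;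
and this symbol never occurs inside a list of wires. -/
theorem denote_firstQueryExpr {C : Circuit} (h0 : ρ 0 = C.encode) :
    firstQueryExpr.denote ρ = (firstIns C.gates).flatMap encodeWire := by
  set f : List Symbol → Symbol → List Symbol → List Symbol := fun u a w =>
    if a = .query then if ticks (u.countP fun b => b = .query) = [] then
      w.takeWhile (fun b => b ≠ .endList) else [] else [] with hf
  have h1 : firstQueryExpr.denote ρ = splitMap f [] C.encode := by
    rw [firstQueryExpr, Expr.denote, h0]
    refine splitMap_congr (fun u a w => ?_) _ _
    simp only [hf]
    split_ifs with h1 h2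
    · simp [Expr.denote, Expr.denote_count, Expr.denote_takeWhile, h2]
    · simp only [Expr.denote, Expr.denote_count, Expr.denote_takeWhile, update_self]
      rw [if_neg h2]
    · rfl
  have hzero : ∀ l u : List Symbol, Symbol.query ∈ u → splitMap f u l = [] := by
    intro l
    induction l with
    | nil => intros; rfl
    | cons a l ih =>
      intro u hu
      have : ticks (u.countP fun b => b = .query) ≠ [] := by
        simp only [ticks, ne_eq, List.replicate_eq_nil_iff, List.countP_eq_zero]
        exact fun h => h _ hu (by simp)
      rw [splitMap, ih _ (by simp [hu])]
      simp only [hf, if_neg this, ite_self, List.append_nil]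
  have hskip : ∀ l u rest : List Symbol, Symbol.query ∉ l →
      splitMap f u (l ++ rest) = splitMap f (l.reverse ++ u) rest := by
    intro l u rest hl
    refine splitMap_eq_nil _ _ _ _ fun a ha u w => ?_
    have : a ≠ .query := fun h => hl (h ▸ ha)
    simp [hf, this]
  have hwire : ∀ i : ℕ, Symbol.query ∉ encodeWire i := by simp [encodeWire]
  have main : ∀ (gs : List Gate) (u : List Symbol), Symbol.query ∉ u →
      splitMap f u (gs.flatMap Gate.encode ++ .output :: encodeWires C.out) =
        (firstIns gs).flatMap encodeWire := by
    intro gs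
    induction gs with
    | nil =>
      intro u hu
      have := hskip (.output :: encodeWires C.out) u []
        (by simpa using query_notMem_encodeWires _)
      rw [List.append_nil] at this
      simpa [firstIns, splitMap] using this
    | cons g gs ih =>
      intro u hu
      have el : ∀ g : Gate, Symbol.query ∉ g.encode → splitMap f u
          ((g :: gs).flatMap Gate.encode ++ .output :: encodeWires C.out) =
          (firstIns gs).flatMap encodeWire := by
        intro g hg
        rw [List.flatMap_cons, List.append_assoc, hskip _ _ _ hg, ih]
        simp [hg, hu]
      cases g with
      | query ins outs =>
        rw [List.flatMap_cons, Gate.encode, List.append_assoc, List.cons_append, splitMap,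
          hzero _ _ (by simp)]
        have : u.countP (fun b => b = .query) = 0 := by
          rw [List.countP_eq_zero]; intro a ha; simp; rintro rfl; exact hu ha
        have h3 := takeWhile_encodeWires ins (encodeWires outs ++
          (gs.flatMap Gate.encode ++ .output :: encodeWires C.out))
        simp only [hf, if_true, this, List.append_nil, firstIns, ticks, List.replicate_zero,
          List.append_assoc, h3]
      | _ => exact el _ (by simp [Gate.encode, hwire])
  rw [h1]
  exact main _ _ (by simp)

theorem denote_simExpr (C : Circuit) :
    simExpr.denote (update (fun _ => []) 0 C.encode) = (simCircuit C).encode := by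
  set s := C.encode.length with hs
  have each : ∀ (ρ : Fin 32 → List Symbol) (x y : Fin 32) (e : Expr (Fin 32)) (n : ℕ),
      ρ 0 = C.encode → (∀ l l', e.denote (update (update ρ x l) y l') = ticks n) →
      (Expr.each 0 x y fun _ => e).denote ρ = ticks (s * n) := by
    intro ρ x y e n h0 he
    rw [Expr.denote, h0, hs, ← flatMap_const_ticks, ← splitMap_const _ []]
    exact splitMap_congr (fun _ _ _ => he _ _) _ _
  rw [simExpr, Expr.denote, Expr.denote_count]
  set ρ₂ := update (update (fun _ => []) 0 C.encode) (2 : Fin 32)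
    (ticks ((update (fun _ => []) (0 : Fin 32) C.encode 0).countP fun _ => true)) with h2
  have e2 : ρ₂ 2 = ticks s := by simp [h2, hs]
  have a2 : ρ₂ 0 = C.encode := by simp [h2]
  rw [Expr.denote, each ρ₂ 20 21 _ (s * 3) a2 (fun l l' => each _ _ _ _ 3 (by simp [a2])
    fun l l' => rfl)]
  set ρ₃ := update ρ₂ 3 (ticks (s * (s * 3))) with h3
  rw [Expr.denote, each ρ₃ 20 21 _ (s * 2) (by simp [h3, a2])
    (fun l l' => each _ _ _ _ 2 (by simp [h3, a2]) fun l l' => rfl)]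
  set ρ₄ := update ρ₃ 4 (ticks (s * (s * 2))) with h4
  rw [Expr.denote, each ρ₄ 20 21 _ (hashDeg s + hashDeg s) (by simp [h4, h3, a2])
    (fun l l' => by simp [Expr.denote, h4, h3, hashDeg])]
  set ρ₅ := update ρ₄ 5 (ticks (s * (hashDeg s + hashDeg s))) with h5
  have e6 : (Expr.app (.var 5) (.app (.var 3) (.each 0 20 21 fun _ => .var 3))).denote ρ₅ =
      ticks (randLen s) := by
    rw [Expr.denote, Expr.denote, Expr.denote, Expr.denote, each ρ₅ 20 21 _ (hashDeg s) (by simp [h5, h4, h3, a2])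
      (fun l l' => by simp [Expr.denote, h5, h4, h3, hashDeg])]
    simp [h5, h4, h3, hashDeg, randLen, hashSteps, Nat.add_assoc]
  rw [Expr.denote, e6]
  set ρ₆ := update ρ₅ 6 (ticks (randLen s)) with h6
  rw [Expr.denote]
  have e29 : (Expr.app (.var 2) (.var 2)).denote ρ₆ = ticks (s + s) := by
    simp [Expr.denote, h6, h5, h4, h3, e2]
  rw [e29, Expr.denote]
  set ρ₇ := update ρ₆ 29 (ticks (s + s)) with h7
  have e7 : (Expr.size 29 20 21).denote ρ₇ = ticks (coinNum s) := by
    simp [Expr.denote, h7, coinNum]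
  rw [e7, Expr.denote]
  set ρ₈ := update (update ρ₇ 7 (ticks (coinNum s))) 15 ((Expr.sym .tick).denote
    (update ρ₇ 7 (ticks (coinNum s)))) with h8
  rw [Expr.denote, denote_firstQueryExpr (C := C) (by simp [h8, h7, h6, h5, h4, h3, a2])]
  set ρ₉ := update ρ₈ 30 ((firstIns C.gates).flatMap encodeWire) with h9
  rw [Expr.denote, Expr.denote_count]
  have e8 : (ρ₉ 30).countP (fun b => b = .endWire) = (firstIns C.gates).length := by
    rw [h9, update_self, countP_flatMap_encodeWire]
  rw [e8]
  set ρ := update ρ₉ 8 (ticks (firstIns C.gates).length) with hρ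
  have hE : IsSimEnv s (firstIns C.gates).length ρ := by
    constructor
    · simp [hρ, h9, h8, h7, h6, h5, h4, h3, e2]
    · simp [hρ, h9, h8, h7, h6, h5, h4, h3, hashDeg]
    · simp [hρ, h9, h8, h7, h6, h5, h4, hashPos]
    · simp [hρ, h9, h8, h7, h6, h5, hashSteps]
    · simp [hρ, h9, h8, h7, h6]
    · simp [hρ, h9, h8]
    · simp [hρ, h9, h8, Expr.denote, ticks]
    · simp [hρ]
  have h0 : ρ 0 = C.encode := by simp [hρ, h9, h8, h7, h6, h5, h4, h3, a2]
  rw [Expr.denote, Expr.denote, h0, Circuit.encode, splitMap_gateExpr_flatMap hE _ _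
    (by simp [IsHead]), splitMap_gateExpr_output hE]
  have hH : hadamardExpr.denote ρ = ((List.range (randLen s)).map
      fun p => Gate.hadamard (keyWire s p)).flatMap Gate.encode := by
    rw [hadamardExpr, Expr.denote, hE.rand, splitMap_ticks_before
      (g := fun p => (Gate.hadamard (keyWire s p)).encode), List.flatMap_map]
    intro i w
    simp [Expr.denote, Expr.denote_wire, hE.len, Gate.encode, encodeWire_eq, ticks, keyWire,
      List.replicate_add, -List.replicate_append_replicate]
  rw [hH, Circuit.encode, simCircuit]
  simp [← hs]

/-- The transformation preserves polynomial time. -/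
theorem QAlgorithm.PolyTime.simCircuit {A : QAlgorithm} (h : A.PolyTime) :
    QAlgorithm.PolyTime fun l => simCircuit (A l) :=
  h.elim fun h => nonempty_polyTime_expr h simExpr 0 1 (by decide) simExpr_scoped
    fun l => (denote_simExpr (A l)).symm

end

section

/-! ### Norms of states -/

/-- States have finite support and no norm of their own. Embedding them in `ℓ²` provides the
triangle inequality and inner products, with `norm_toHilb_sq` as the dictionary. -/
abbrev Hilb : Type := lp (fun _ : Finset ℕ => ℂ) 2

/-- The orthonormal family of the computational basis states in a Hilbert space. -/
def ket (S : Finset ℕ) : Hilb :=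
  (HilbertBasis.ofRepr (LinearIsometryEquiv.refl ℂ Hilb) : HilbertBasis (Finset ℕ) ℂ Hilb) S

theorem orthonormal_ket : Orthonormal ℂ ket :=
  (HilbertBasis.ofRepr (LinearIsometryEquiv.refl ℂ Hilb)).orthonormal

def toHilb : State →ₗ[ℂ] Hilb := Finsupp.linearCombination ℂ ket

theorem toHilb_single (S : Finset ℕ) (c : ℂ) : toHilb (Finsupp.single S c) = c • ket S := by
  simp [toHilb]

/-- An arbitrary orthonormal family is allowed, so that this applies also to the images of the basis
states under a gate; there it says that the gate is an isometry. -/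
theorem inner_linearCombination {v : Finset ℕ → Hilb} (hv : Orthonormal ℂ v) (ψ : State) :
    ‖Finsupp.linearCombination ℂ v ψ‖ ^ 2 = normSq ψ := by
  have h := hv.inner_finsupp_eq_sum_left ψ ψ
  have h2 : ((‖Finsupp.linearCombination ℂ v ψ‖ ^ 2 : ℝ) : ℂ) = (normSq ψ : ℝ) := by
    rw [normSq, Finsupp.sum, Complex.ofReal_sum]
    have := inner_self_eq_norm_sq_to_K (𝕜 := ℂ) (Finsupp.linearCombination ℂ v ψ)
    rw [h] at this
    push_cast
    rw [show ((‖Finsupp.linearCombination ℂ v ψ‖ : ℝ) : ℂ) ^ 2 = _ from this.symm, Finsupp.sum]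
    refine Finset.sum_congr rfl fun S _ => ?_
    rw [Complex.conj_mul']
  exact_mod_cast h2

theorem norm_toHilb_sq (ψ : State) : ‖toHilb ψ‖ ^ 2 = normSq ψ :=
  inner_linearCombination orthonormal_ket ψ

theorem normSq_nonneg (ψ : State) : 0 ≤ normSq ψ := by
  rw [← norm_toHilb_sq]; positivity

theorem normSq_eq_sum {ψ : State} {U : Finset (Finset ℕ)} (h : ψ.support ⊆ U) :
    normSq ψ = ∑ S ∈ U, ‖ψ S‖ ^ 2 :=
  Finsupp.sum_of_support_subset _ h _ (by simp)

theorem normSq_zero : normSq 0 = 0 := by simp [normSq]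

theorem normSq_smul (c : ℂ) (ψ : State) : normSq (c • ψ) = ‖c‖ ^ 2 * normSq ψ := by
  rw [← norm_toHilb_sq, map_smul, norm_smul, mul_pow, norm_toHilb_sq]

theorem normSq_sum_of_disjoint {ι : Type*} (K : Finset ι) (f : ι → State)
    (h : ∀ i ∈ K, ∀ j ∈ K, i ≠ j → Disjoint (f i).support (f j).support) :
    normSq (∑ i ∈ K, f i) = ∑ i ∈ K, normSq (f i) := by
  classical
  induction K using Finset.induction_on with
  | empty => simp [normSq]
  | insert a K ha ih =>
    rw [Finset.sum_insert ha, Finset.sum_insert ha, ← ih fun i hi j hj =>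
      h i (by simp [hi]) j (by simp [hj])]
    refine Finsupp.sum_add_index_of_disjoint ?_ _
    refine Finset.disjoint_of_subset_right Finsupp.support_finsetSum ?_
    rw [Finset.disjoint_biUnion_right]
    intro i hi
    exact h a (by simp) i (by simp [hi]) fun e => ha (e ▸ hi)

theorem support_project_subset (ws : List ℕ) (v : List Bool) (ψ : State) :
    (project ws v ψ).support ⊆ ψ.support := by
  rw [project, Finsupp.support_filter]
  exact Finset.filter_subset _ _

theorem normSq_project_le (ws : List ℕ) (v : List Bool) (ψ : State) :
    normSq (project ws v ψ) ≤ normSq ψ := by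
  rw [normSq_eq_sum (support_project_subset ws v ψ),
    normSq_eq_sum subset_rfl]
  refine Finset.sum_le_sum fun S _ => ?_
  rw [project, Finsupp.filter_apply]
  split_ifs <;> simp

/-- The probabilities of the outcomes of a measurement sum up to the squared norm. -/
theorem sum_normSq_project {k : ℕ} {ws : List ℕ} (hk : ws.length = k) (ψ : State) :
    ∑ x : BitString k, normSq (project ws (List.ofFn x) ψ) = normSq ψ := by
  have : ∀ x : BitString k, normSq (project ws (List.ofFn x) ψ) =
      ∑ S ∈ ψ.support, if readWires ws S = List.ofFn x then ‖ψ S‖ ^ 2 else 0 := by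
    intro x
    rw [normSq_eq_sum (support_project_subset ws _ ψ)]
    refine Finset.sum_congr rfl fun S _ => ?_
    rw [project, Finsupp.filter_apply]
    split_ifs <;> simp
  simp_rw [this]
  rw [Finset.sum_comm, normSq_eq_sum subset_rfl]
  refine Finset.sum_congr rfl fun S _ => ?_
  subst hk
  have h : ∀ x : BitString ws.length, readWires ws S = List.ofFn x ↔
      x = fun i => decide (ws[i] ∈ S) := by
    intro x
    have : readWires ws S = List.ofFn fun i : Fin ws.length => decide (ws[i] ∈ S) := by
      rw [readWires]
      refine List.ext_getElem (by simp) fun i h1 h2 => by simp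
    rw [this, List.ofFn_inj, eq_comm]
  simp_rw [h]
  simp

theorem run_nil {d m : ℕ} (O : BitString d → BitString m) (ψ : State) : run O [] ψ = ψ := rfl

theorem run_cons {d m : ℕ} (O : BitString d → BitString m) (g : Gate) (gs : List Gate)
    (ψ : State) : run O (g :: gs) ψ = run O gs (g.apply O ψ) := rfl

theorem run_append {d m : ℕ} (O : BitString d → BitString m) (gs gs' : List Gate)
    (ψ : State) : run O (gs ++ gs') ψ = run O gs' (run O gs ψ) := by
  simp [run]

/-- Running a sequence of gates, as a linear map. -/
def runₗ {d m : ℕ} (O : BitString d → BitString m) : List Gate → State →ₗ[ℂ] State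
  | [] => LinearMap.id
  | g :: gs => runₗ O gs ∘ₗ g.apply O

theorem runₗ_apply {d m : ℕ} (O : BitString d → BitString m) (gs : List Gate) (ψ : State) :
    runₗ O gs ψ = run O gs ψ := by
  induction gs generalizing ψ with
  | nil => rfl
  | cons g gs ih => simp [runₗ, ih, run_cons]

theorem apply_single {d m : ℕ} (O : BitString d → BitString m) (g : Gate) (S : Finset ℕ) (c : ℂ) :
    g.apply O (Finsupp.single S c) = c • g.onBasis O S := by
  simp [Gate.apply]

/-- This covers every gate but the Hadamard gate: they permute the basis states up to phases. -/
theorem orthonormal_perm {b : Finset ℕ → State} {f : Finset ℕ → Finset ℕ} (hf : f.Injective)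
    {c : Finset ℕ → ℂ} (hc : ∀ S, ‖c S‖ = 1) (hb : ∀ S, b S = Finsupp.single (f S) (c S)) :
    Orthonormal ℂ fun S => toHilb (b S) := by
  simp only [hb, toHilb_single]
  refine ⟨fun S => ?_, fun S T h => ?_⟩
  · simp only
    rw [norm_smul, hc, orthonormal_ket.1, one_mul]
  · simp only
    rw [inner_smul_left, inner_smul_right, orthonormal_ket.2 (hf.ne h)]
    simp

theorem mem_queryInput {ins outs : List ℕ} {d : ℕ} (hd : ins.length = d)
    (hn : (ins ++ outs).Nodup) (S T : Finset ℕ) (hT : ∀ i ∈ T, i ∈ outs) :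
    queryInput d ins (symmDiff S T) = queryInput d ins S := by
  funext i
  have hi : ins.getD i 0 ∈ ins := by
    rw [List.getD_eq_getElem _ _ (by omega)]; exact List.getElem_mem _
  have : ins.getD i 0 ∉ T := fun h => (List.disjoint_of_nodup_append hn) hi (hT _ h)
  rw [queryInput, queryInput, decide_eq_decide, Finset.mem_symmDiff]
  tauto

theorem mem_of_mem_onesOf {m : ℕ} {outs : List ℕ} (hm : outs.length = m) {y : BitString m} {i : ℕ}
    (h : i ∈ onesOf outs y) : i ∈ outs := by
  simp only [onesOf, Finset.mem_image] at h
  obtain ⟨k, _, rfl⟩ := h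
  rw [List.getD_eq_getElem _ _ (by omega)]; exact List.getElem_mem _

/-- If the set of wires to be flipped is not affected by the flip, because no target is a control,
then it can be recovered from the result and the flip undone. -/
theorem symmDiff_inj_of {f : Finset ℕ → Finset ℕ} (h : ∀ S, f (symmDiff S (f S)) = f S) :
    Function.Injective fun S => symmDiff S (f S) := by
  intro S T hST
  dsimp only at hST
  have h1 : f S = f T := by rw [← h S, ← h T, hST]
  rw [h1] at hST
  exact symmDiff_left_injective _ hST

theorem orthonormal_onBasis {d m : ℕ} (O : BitString d → BitString m) {g : Gate}
    (hg : g.WellFormed d m) : Orthonormal ℂ fun S => toHilb (g.onBasis O S) := by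
  cases g with
  | hadamard i =>
    have key : ∀ S T : Finset ℕ, inner ℂ (toHilb ((Gate.hadamard i).onBasis O S))
        (toHilb ((Gate.hadamard i).onBasis O T)) = if S = T then 1 else 0 := by
      intro S T
      have h2 : ((Real.sqrt 2 : ℝ) : ℂ) * (Real.sqrt 2 : ℝ) = 2 := by
        rw [← Complex.ofReal_mul, Real.mul_self_sqrt (by norm_num)]; norm_num
      have h3 : ((Real.sqrt 2 : ℝ) : ℂ) ≠ 0 := by
        intro h; rw [h] at h2; norm_num at h2
      have hk := orthonormal_iff_ite.1 orthonormal_ket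
      simp only [Gate.onBasis, map_smul, map_add, toHilb_single, inner_smul_left,
        inner_smul_right, inner_add_left, inner_add_right, hk]
      have a1 : ∀ S T : Finset ℕ, S.erase i ≠ insert i T := fun S T h => by
        have := Finset.mem_insert_self i T
        rw [← h] at this; simp at this
      have a2 : ∀ S T : Finset ℕ, insert i T ≠ S.erase i := fun S T h => a1 S T h.symm
      have a3 : S.erase i = T.erase i ↔ insert i S = insert i T := by
        simp only [Finset.ext_iff, Finset.mem_erase, Finset.mem_insert]
        refine forall_congr' fun a => ?_
        by_cases h : a = i <;> simp [h]
      have a4 : S = T ↔ insert i S = insert i T ∧ (i ∈ S ↔ i ∈ T) := by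
        constructor
        · rintro rfl; simp
        · rintro ⟨h1, h2⟩
          simp only [Finset.ext_iff, Finset.mem_insert] at h1 ⊢
          intro a
          by_cases h : a = i
          · rw [h, h2]
          · simpa [h] using h1 a
      simp only [a1, a2, a3, if_false]
      -- If `S` and `T` agree away from wire `i`, both components of the images overlap; the two
      -- contributions cancel exactly when `S` and `T` differ at `i`.
      by_cases h : insert i S = insert i T
      · by_cases hS : i ∈ S <;> by_cases hT : i ∈ T <;> simp [h, hS, hT, a4] <;>
          field_simp <;> linear_combination -h2
      · simp [h, a4]
    exact orthonormal_iff_ite.2 key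
  | phaseT i =>
    refine orthonormal_perm Function.injective_id (fun S => ?_) fun S => rfl
    split_ifs
    · rw [Complex.norm_exp]; simp
    · simp
  | pauliX i =>
    exact orthonormal_perm (symmDiff_left_injective {i}) (c := fun _ => 1) (fun S => by simp)
      fun S => rfl
  | cnot i j =>
    have hij : i ≠ j := hg
    have : (fun S : Finset ℕ => if i ∈ S then symmDiff S {j} else S) =
        fun S => symmDiff S (if i ∈ S then {j} else ∅) := by
      funext S; split_ifs <;> simp [← Finset.bot_eq_empty]
    refine orthonormal_perm (f := fun S : Finset ℕ => if i ∈ S then symmDiff S {j} else S) ?_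
      (c := fun _ => 1) (fun S => by simp) fun S => rfl
    rw [this]
    refine symmDiff_inj_of fun S => ?_
    by_cases h : i ∈ S <;> simp [h, Finset.mem_symmDiff, hij]
  | toffoli i j k =>
    have hijk : [i, j, k].Nodup := hg
    simp only [List.nodup_cons, List.mem_cons, List.not_mem_nil, or_false, not_or] at hijk
    have : (fun S : Finset ℕ => if i ∈ S ∧ j ∈ S then symmDiff S {k} else S) =
        fun S => symmDiff S (if i ∈ S ∧ j ∈ S then {k} else ∅) := by
      funext S; split_ifs <;> simp [← Finset.bot_eq_empty]
    refine orthonormal_perm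
      (f := fun S : Finset ℕ => if i ∈ S ∧ j ∈ S then symmDiff S {k} else S) ?_
      (c := fun _ => 1) (fun S => by simp) fun S => rfl
    rw [this]
    refine symmDiff_inj_of fun S => ?_
    by_cases h : i ∈ S ∧ j ∈ S
    · simp [h, Finset.mem_symmDiff, hijk.1.2, hijk.2.1]
    · simp [h, ← Finset.bot_eq_empty]
  | query ins outs =>
    obtain ⟨hd, hm, hn⟩ := hg
    refine orthonormal_perm (f := fun S => symmDiff S (onesOf outs (O (queryInput d ins S)))) ?_
      (c := fun _ => 1) (fun S => by simp) fun S => rfl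
    refine symmDiff_inj_of fun S => ?_
    rw [mem_queryInput hd hn _ _ fun i => mem_of_mem_onesOf hm]

theorem normSq_apply {d m : ℕ} (O : BitString d → BitString m) {g : Gate}
    (hg : g.WellFormed d m) (ψ : State) : normSq (g.apply O ψ) = normSq ψ := by
  rw [← norm_toHilb_sq, ← inner_linearCombination (orthonormal_onBasis O hg)]
  congr 2
  rw [Gate.apply, Finsupp.linearCombination_apply, Finsupp.linearCombination_apply, map_finsuppSum]
  simp

theorem normSq_run {d m : ℕ} (O : BitString d → BitString m) {gs : List Gate}
    (hg : ∀ g ∈ gs, g.WellFormed d m) (ψ : State) : normSq (run O gs ψ) = normSq ψ := by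
  induction gs generalizing ψ with
  | nil => rfl
  | cons g gs ih =>
    rw [run_cons, ih (fun g' h => hg g' (by simp [h])), normSq_apply O (hg g (by simp))]

theorem norm_toHilb_eq {φ ψ : State} (h : normSq φ = normSq ψ) : ‖toHilb φ‖ = ‖toHilb ψ‖ := by
  rw [← sq_eq_sq₀ (norm_nonneg _) (norm_nonneg _), norm_toHilb_sq, norm_toHilb_sq, h]

theorem norm_toHilb_le {φ ψ : State} (h : normSq φ ≤ normSq ψ) : ‖toHilb φ‖ ≤ ‖toHilb ψ‖ := by
  rw [← sq_le_sq₀ (norm_nonneg _) (norm_nonneg _), norm_toHilb_sq, norm_toHilb_sq]; exact h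

end

/-! ### Bounded independence suffices against few queries -/

section Junta

variable {α β : Type*}

/-- The span of the functions of `O` that depend on at most `k` values of `O`. -/
def junta (α β : Type*) (k : ℕ) : Submodule ℂ ((α → β) → ℂ) :=
  Submodule.span ℂ {G | ∃ J : Finset α, J.card ≤ k ∧ DependsOn G (J : Set α)}

theorem junta_mono {k l : ℕ} (h : k ≤ l) : junta α β k ≤ junta α β l :=
  Submodule.span_mono fun _ ⟨J, hJ, hG⟩ => ⟨J, hJ.trans h, hG⟩

theorem const_mem_junta (k : ℕ) (c : ℂ) : (fun _ => c) ∈ junta α β k :=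
  Submodule.subset_span ⟨∅, by simp, fun _ _ _ => rfl⟩

theorem mul_mem_junta {k l : ℕ} {F G : (α → β) → ℂ} (hF : F ∈ junta α β k)
    (hG : G ∈ junta α β l) : (fun O => F O * G O) ∈ junta α β (k + l) := by
  classical
  have h : junta α β k * junta α β l ≤ junta α β (k + l) := by
    rw [junta, junta, Submodule.span_mul_span, junta]
    refine Submodule.span_mono ?_
    rintro _ ⟨F, ⟨J, hJ, hF⟩, G, ⟨J', hJ', hG⟩, rfl⟩
    refine ⟨J ∪ J', (Finset.card_union_le _ _).trans (by omega), fun O O' h => ?_⟩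
    show F O * G O = F O' * G O'
    rw [hF fun i hi => h i (by simp at hi ⊢; exact .inl hi),
      hG fun i hi => h i (by simp at hi ⊢; exact .inr hi)]
  exact h (Submodule.mul_mem_mul hF hG)

theorem conj_mem_junta {k : ℕ} {F : (α → β) → ℂ} (hF : F ∈ junta α β k) :
    (fun O => (starRingEnd ℂ) (F O)) ∈ junta α β k := by
  induction hF using Submodule.span_induction with
  | mem F h =>
    obtain ⟨J, hJ, h⟩ := h
    exact Submodule.subset_span ⟨J, hJ, fun O O' hO => by simp only [h hO]⟩
  | zero => simpa using const_mem_junta k 0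
  | add F G _ _ hF hG =>
    simp only [Pi.add_apply, map_add]
    exact add_mem hF hG
  | smul c F _ hF =>
    simp only [Pi.smul_apply, smul_eq_mul, map_mul]
    exact Submodule.smul_mem _ _ hF

variable [Fintype α] [DecidableEq α] [Fintype β] {K : Type*} [Fintype K]

/-- Under the random function `h` the values at any `n` points are uniform and independent. -/
def IsIndep (n : ℕ) (h : K → α → β) : Prop :=
  ∀ G ∈ junta α β n, 𝔼 κ, G (h κ) = 𝔼 O, G O

theorem expect_comp_of_card_fiber {A T : Type*} [Fintype A] [Nonempty A] [Fintype T]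
    [DecidableEq T] (f : A → T) (c : ℕ)
    (hf : ∀ t, (Finset.univ.filter fun a => f a = t).card = c) (F : T → ℂ) :
    𝔼 a, F (f a) = 𝔼 t, F t := by
  have h1 : Fintype.card A = Fintype.card T * c := by
    rw [← Finset.card_univ, Finset.card_eq_sum_card_fiberwise (f := f) (t := Finset.univ)
      (fun _ _ => Finset.mem_coe.2 (Finset.mem_univ _))]
    simp [hf]
  have h2 : ∑ a, F (f a) = c * ∑ t, F t := by
    rw [← Finset.sum_fiberwise_of_maps_to (s := Finset.univ) (t := Finset.univ) (g := f)
      (fun _ _ => Finset.mem_univ _), Finset.mul_sum]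
    refine Finset.sum_congr rfl fun t _ => ?_
    rw [Finset.sum_congr rfl (g := fun _ => F t) fun a ha => by
      rw [(Finset.mem_filter.1 ha).2], Finset.sum_const, hf, nsmul_eq_mul]
  have hA : Fintype.card A ≠ 0 := Fintype.card_ne_zero
  rw [Fintype.expect_eq_sum_div_card, Fintype.expect_eq_sum_div_card, h2, h1]
  rw [h1] at hA
  have hc : (c : ℂ) ≠ 0 := by exact_mod_cast right_ne_zero_of_mul hA
  push_cast
  rw [mul_comm (c : ℂ), mul_div_mul_right _ _ hc]

/-- By linearity it suffices to treat a function of the values on a set `J` of at most `n` points.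
Restricted to `J`, both `h κ` and a uniform function are uniform, since the fibers of the
restriction have equal size. -/
theorem isIndep_of_card_fiber [Nonempty K] [Nonempty β] [DecidableEq β] {n : ℕ} {h : K → α → β}
    (hh : ∀ J : Finset α, J.card ≤ n → ∃ c, ∀ t : J → β,
      (Finset.univ.filter fun κ => (fun y : J => h κ y) = t).card = c) : IsIndep n h := by
  intro G hG
  induction hG using Submodule.span_induction with
  | mem G hG =>
    obtain ⟨J, hJ, hG⟩ := hG
    obtain ⟨c, hc⟩ := hh J hJ
    obtain ⟨b⟩ := ‹Nonempty β›
    let ext : (J → β) → α → β := fun t y => if hy : y ∈ J then t ⟨y, hy⟩ else b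
    have hext : ∀ O, G O = G (ext fun y : J => O y) := fun O => hG fun y hy => by
      have : y ∈ J := hy
      simp [ext, this]
    have e1 := expect_comp_of_card_fiber (fun κ => fun y : J => h κ y) c hc fun t => G (ext t)
    have e2 := expect_comp_of_card_fiber (fun O : α → β => fun y : J => O y)
      (Fintype.card ({y // y ∉ J} → β)) (fun t => ?_) fun t => G (ext t)
    · simp only [← hext] at e1 e2
      rw [e1, e2]
    · rw [← Fintype.card_subtype]
      refine Fintype.card_congr ⟨fun O y => O.1 y, fun r => ⟨fun y => if hy : y ∈ J then t ⟨y, hy⟩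
        else r ⟨y, hy⟩, ?_⟩, fun O => ?_, fun r => ?_⟩
      · funext y; simp
      · ext y
        simp only
        split_ifs with hy
        · exact (congrFun O.2 ⟨y, hy⟩).symm
        · rfl
      · funext y; simp [y.2]
  | zero => simp
  | add F G _ _ hF hG =>
    simp only [Pi.add_apply, Finset.expect_add_distrib, hF, hG]
  | smul c F _ hF =>
    simp only [Pi.smul_apply, smul_eq_mul, ← Finset.mul_expect, hF]

end Junta

section Run

variable {d m : ℕ}

/-- A matrix entry of a query involves the oracle only at the input that the basis state carries. -/
theorem onBasis_mem_junta (g : Gate) (S T : Finset ℕ) :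
    (fun O : BitString d → BitString m => g.onBasis O S T) ∈
      junta (BitString d) (BitString m) 1 := by
  cases g with
  | query ins outs =>
    refine Submodule.subset_span ⟨{queryInput d ins S}, by simp, fun O O' h => ?_⟩
    simp only [Gate.onBasis]
    rw [h (queryInput d ins S) (by simp)]
  | _ => exact const_mem_junta _ _

theorem apply_coeff_mem_junta {k : ℕ} {Φ : (BitString d → BitString m) → State}
    (h : ∀ S, (fun O => Φ O S) ∈ junta (BitString d) (BitString m) k) (g : Gate) (T : Finset ℕ) :
    (fun O => g.apply O (Φ O) T) ∈ junta (BitString d) (BitString m) (k + 1) := by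
  classical
  -- There are finitely many oracles, so the supports of all `Φ O` have a finite union; this makes
  -- the index set independent of `O`.
  have : (fun O => g.apply O (Φ O) T) = ∑ S ∈ Finset.univ.biUnion fun O => (Φ O).support,
      fun O => Φ O S * g.onBasis O S T := by
    funext O
    rw [Gate.apply, Finsupp.linearCombination_apply, Finsupp.sum_of_support_subset
      (s := Finset.univ.biUnion fun O => (Φ O).support) _ _ _ (by simp), Finset.sum_apply,
      Finsupp.finsetSum_apply]
    · simp
    · exact Finset.subset_biUnion_of_mem (fun O => (Φ O).support) (Finset.mem_univ O)
  rw [this]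
  exact sum_mem fun S _ => mul_mem_junta (h S) (onBasis_mem_junta g S T)

theorem run_coeff_mem_junta {k : ℕ} {Φ : (BitString d → BitString m) → State}
    (h : ∀ S, (fun O => Φ O S) ∈ junta (BitString d) (BitString m) k) (gs : List Gate)
    (T : Finset ℕ) :
    (fun O => run O gs (Φ O) T) ∈ junta (BitString d) (BitString m) (k + gs.length) := by
  induction gs generalizing k Φ with
  | nil => exact h T
  | cons g gs ih =>
    have := ih (Φ := fun O => g.apply O (Φ O)) fun S => apply_coeff_mem_junta h g S
    rw [List.length_cons, ← Nat.add_assoc, Nat.add_right_comm]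
    exact this

/-- A squared modulus is the product of an amplitude and its conjugate, hence the doubling. This is
why `2 * q`-wise independence is needed for `q` queries. -/
theorem normSq_mem_junta {k : ℕ} {Φ : (BitString d → BitString m) → State}
    (h : ∀ S, (fun O => Φ O S) ∈ junta (BitString d) (BitString m) k) :
    (fun O => (normSq (Φ O) : ℂ)) ∈ junta (BitString d) (BitString m) (k + k) := by
  classical
  have : (fun O => (normSq (Φ O) : ℂ)) = ∑ S ∈ Finset.univ.biUnion fun O => (Φ O).support,
      fun O => (starRingEnd ℂ) (Φ O S) * Φ O S := by
    funext O
    rw [normSq_eq_sum (U := Finset.univ.biUnion fun O => (Φ O).support)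
      (Finset.subset_biUnion_of_mem (fun O => (Φ O).support) (Finset.mem_univ O)),
      Finset.sum_apply]
    push_cast
    exact Finset.sum_congr rfl fun S _ => (Complex.conj_mul' _).symm
  rw [this]
  exact sum_mem fun S _ => mul_mem_junta (conj_mem_junta (h S)) (h S)

/-- Few queries cannot distinguish a random function with enough independence from the uniform
one. -/
theorem IsIndep.expect_normSq_run {K : Type*} [Fintype K] {n : ℕ}
    {h : K → BitString d → BitString m} (hh : IsIndep n h) {gs : List Gate}
    (hgs : gs.length + gs.length ≤ n) (ws : List ℕ) (v : List Bool) (ψ : State) :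
    𝔼 κ, normSq (project ws v (run (h κ) gs ψ)) =
      𝔼 O : BitString d → BitString m, normSq (project ws v (run O gs ψ)) := by
  have h1 : ∀ S, (fun O : BitString d → BitString m => project ws v (run O gs ψ) S) ∈
      junta (BitString d) (BitString m) gs.length := by
    intro S
    by_cases hS : readWires ws S = v
    · have : (fun O : BitString d → BitString m => project ws v (run O gs ψ) S) =
          fun O => run O gs ψ S := by
        funext O; rw [project, Finsupp.filter_apply, if_pos hS]
      rw [this]
      have := run_coeff_mem_junta (k := 0) (Φ := fun _ : BitString d → BitString m => ψ)
        (fun S => const_mem_junta _ _) gs S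
      rwa [Nat.zero_add] at this
    · have : (fun O : BitString d → BitString m => project ws v (run O gs ψ) S) =
          fun O => 0 := by
        funext O; rw [project, Finsupp.filter_apply, if_neg hS]
      rw [this]
      exact const_mem_junta _ _
  have h2 := hh _ (junta_mono hgs (normSq_mem_junta h1))
  simp only [Fintype.expect_eq_sum_div_card] at h2 ⊢
  exact_mod_cast h2

end Run

/-! ### A hash function with bounded independence

The key is a polynomial over `𝔽₂`; the input `y` determines a monic polynomial of degree `N`, and
the hash value consists of coefficients of the key modulo that polynomial. -/

section Hash

open Polynomial

variable {d m : ℕ}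

def inPoly (y : BitString d) : (ZMod 2)[X] := ∑ i : Fin d, if y i then X ^ (i : ℕ) else 0

def modPoly (N : ℕ) (y : BitString d) : (ZMod 2)[X] := X ^ N + inPoly y

def hashFun (N B : ℕ) (f : (ZMod 2)[X]) (y : BitString d) : BitString m :=
  fun i => decide ((f %ₘ modPoly N y).coeff (B + i) ≠ 0)

def keyPoly {L : ℕ} (v : Fin L → ZMod 2) : (ZMod 2)[X] := ((degreeLTEquiv (ZMod 2) L).symm v).1

theorem inPoly_mem (y : BitString d) : inPoly y ∈ degreeLT (ZMod 2) d := by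
  refine sum_mem fun i _ => ?_
  split_ifs
  · rw [mem_degreeLT, degree_X_pow]; exact_mod_cast i.2
  · exact zero_mem _

theorem degree_inPoly_lt (y : BitString d) : (inPoly y).degree < d := mem_degreeLT.1 (inPoly_mem y)

theorem coeff_inPoly (y : BitString d) (i : Fin d) :
    (inPoly y).coeff i = if y i then 1 else 0 := by
  rw [inPoly, finsetSum_coeff, Finset.sum_eq_single i]
  · split_ifs <;> simp
  · intro j _ hj
    split_ifs
    · rw [coeff_X_pow, if_neg]
      exact fun h => hj (Fin.ext h.symm)
    · simp
  · simp

theorem inPoly_injective : Function.Injective (inPoly : BitString d → (ZMod 2)[X]) := by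
  intro y y' h
  funext i
  have := congrArg (fun p => p.coeff (i : ℕ)) h
  simp only [coeff_inPoly] at this
  cases h1 : y i <;> cases h2 : y' i <;> simp [h1, h2] at this ⊢

theorem monic_modPoly {N : ℕ} (hN : d ≤ N) (y : BitString d) : (modPoly N y).Monic :=
  monic_X_pow_add ((degree_inPoly_lt y).trans_le (by exact_mod_cast hN))

theorem degree_modPoly {N : ℕ} (hN : d ≤ N) (y : BitString d) : (modPoly N y).degree = N := by
  rw [modPoly, degree_add_eq_left_of_degree_lt, degree_X_pow]
  rw [degree_X_pow]
  exact (degree_inPoly_lt y).trans_le (by exact_mod_cast hN)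

/-- Prescribes the hash value at `y₀`, and zeros at the other points of `J`. -/
theorem exists_hash_eq_single {n N B : ℕ} (hN : d ≤ N) (hd : n * d ≤ B) (hB : B + m ≤ N)
    (J : Finset (BitString d)) (hJ : J.card ≤ n) {y₀ : BitString d} (hy₀ : y₀ ∈ J)
    (T : Fin m → ZMod 2) : ∃ f ∈ degreeLT (ZMod 2) (n * N),
      (∀ i : Fin m, (f %ₘ modPoly N y₀).coeff (B + i) = T i) ∧
      ∀ y ∈ J, y ≠ y₀ → f %ₘ modPoly N y = 0 := by
  classical
  rcases Nat.eq_zero_or_pos N with rfl | hN0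
  · have hm : m = 0 := by omega
    subst hm
    exact ⟨0, zero_mem _, fun i => i.elim0, fun y _ _ => by simp⟩
  -- Modulo `modPoly N y₀` each factor `modPoly N y` of `Q` equals `inPoly y - inPoly y₀`, as the
  -- leading powers cancel. So `Q`, which vanishes modulo the other moduli, is congruent to `D`,
  -- whose degree is at most `B`.
  set D : (ZMod 2)[X] := ∏ y ∈ J.erase y₀, (inPoly y - inPoly y₀) with hD
  set Q : (ZMod 2)[X] := ∏ y ∈ J.erase y₀, modPoly N y with hQ
  set t : (ZMod 2)[X] := ((degreeLTEquiv (ZMod 2) m).symm T).1 with ht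
  have ht_deg : t.degree < m := mem_degreeLT.1 ((degreeLTEquiv (ZMod 2) m).symm T).2
  have ht_coeff : ∀ i : Fin m, t.coeff i = T i := fun i =>
    congrFun ((degreeLTEquiv (ZMod 2) m).apply_symm_apply T) i
  have hD0 : D ≠ 0 := Finset.prod_ne_zero_iff.2 fun y hy =>
    sub_ne_zero.2 fun h => (Finset.mem_erase.1 hy).1 (inPoly_injective h)
  have hDdeg : D.natDegree ≤ B := by
    refine (natDegree_prod_le _ _).trans (le_trans ?_ hd)
    refine (Finset.sum_le_card_nsmul _ _ d fun y _ => ?_).trans ?_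
    · exact natDegree_le_of_degree_le ((degree_sub_le _ _).trans
        (max_le (degree_inPoly_lt y).le (degree_inPoly_lt y₀).le))
    · rw [smul_eq_mul]
      exact Nat.mul_le_mul_right _ ((Finset.card_le_card (Finset.erase_subset _ _)).trans hJ)
  set A : (ZMod 2)[X] := t * X ^ B with hA
  have hAdeg : A.degree < N := by
    rw [hA]
    by_cases h0 : t = 0
    · simp [h0]
    · rw [degree_mul, degree_X_pow, degree_eq_natDegree h0]
      have : t.natDegree < m := (natDegree_lt_iff_degree_lt h0).2 ht_deg
      exact_mod_cast (by omega : t.natDegree + B < N)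
  -- The remainder of `Q * E` at `y₀` is `D * E = A - A % D`. The error `A % D` has degree below
  -- `B`, so it leaves untouched the positions at which `A` carries the prescribed values.
  set E := A / D with hE
  have hdiv : D * E + A % D = A := EuclideanDomain.div_add_mod A D
  have hrem : (A % D).degree < D.degree := EuclideanDomain.mod_lt A hD0
  have hDE : D * E = A - A % D := by linear_combination hdiv
  have hrem' : (A % D).degree < (B : ℕ) := by
    refine hrem.trans_le ?_
    rw [degree_eq_natDegree hD0]; exact_mod_cast hDdeg
  have hDEdeg : (D * E).degree < N := by
    rw [hDE]
    refine (degree_sub_le _ _).trans_lt (max_lt hAdeg (hrem'.trans_le ?_))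
    exact_mod_cast (by omega : B ≤ N)
  refine ⟨Q * E, ?_, fun i => ?_, fun y hy hne => ?_⟩
  · rw [mem_degreeLT]
    by_cases hE0 : E = 0
    · rw [hE0, mul_zero, degree_zero]; exact WithBot.bot_lt_coe _
    have hEdeg : E.natDegree < N := by
      rw [natDegree_lt_iff_degree_lt hE0]
      refine lt_of_le_of_lt ?_ hDEdeg
      rw [degree_mul]
      exact le_add_of_nonneg_left (zero_le_degree_iff.2 hD0)
    have hQdeg : Q.natDegree ≤ (J.erase y₀).card * N := by
      refine (natDegree_prod_le _ _).trans
        ((Finset.sum_le_card_nsmul _ _ N fun y _ => ?_).trans (by rw [smul_eq_mul]))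
      exact natDegree_le_of_degree_le (degree_modPoly hN y).le
    refine degree_le_natDegree.trans_lt ?_
    have h1 : (Q * E).natDegree ≤ Q.natDegree + E.natDegree := natDegree_mul_le
    have h2 := Finset.card_erase_add_one hy₀
    have h3 : (J.erase y₀).card * N + N ≤ n * N := by
      rw [← Nat.succ_mul]; exact Nat.mul_le_mul_right _ (by omega)
    exact_mod_cast (by omega : (Q * E).natDegree < n * N)
  · have hdvd : modPoly N y₀ ∣ Q - D := by
      rw [hQ, hD]
      refine Finset.induction_on (J.erase y₀) (by simp) fun y K hy ih => ?_
      rw [Finset.prod_insert hy, Finset.prod_insert hy]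
      obtain ⟨c, hc⟩ := ih
      refine ⟨modPoly N y * c + ∏ y ∈ K, (inPoly y - inPoly y₀), ?_⟩
      have : ∏ y ∈ K, modPoly N y = modPoly N y₀ * c + ∏ y ∈ K, (inPoly y - inPoly y₀) := by
        rw [← hc]; ring
      rw [this, modPoly, modPoly]; ring
    obtain ⟨c, hc⟩ := hdvd
    have h1 : Q * E = D * E + modPoly N y₀ * (c * E) := by
      linear_combination E * hc
    have h2 := (div_modByMonic_unique (f := Q * E) (g := modPoly N y₀) (c * E) (D * E)
      (monic_modPoly hN y₀) ⟨h1.symm, by rwa [degree_modPoly hN]⟩).2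
    rw [h2, hDE, coeff_sub, hA, Nat.add_comm, coeff_mul_X_pow, ht_coeff,
      coeff_eq_zero_of_degree_lt (hrem'.trans_le (by exact_mod_cast (by omega : B ≤ i + B))),
      sub_zero]
  · rw [modByMonic_eq_zero_iff_dvd (monic_modPoly hN y)]
    exact (Finset.dvd_prod_of_mem _ (Finset.mem_erase.2 ⟨hne, hy⟩)).mul_right _

/-- The map from the key to the hash values on `J` is linear over `𝔽₂`, and summing the solutions of
`exists_hash_eq_single` over `J` shows that it is surjective. All its fibers are then cosets of the
kernel and have the same size. -/
theorem isIndep_hashFun {n N B L : ℕ} (hN : d ≤ N) (hd : n * d ≤ B) (hB : B + m ≤ N)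
    (hL : n * N ≤ L) :
    IsIndep n fun v : Fin L → ZMod 2 => (hashFun N B (keyPoly v) : BitString d → BitString m) := by
  classical
  refine isIndep_of_card_fiber fun J hJ => ?_
  let Φ : (Fin L → ZMod 2) →ₗ[ZMod 2] (J → Fin m → ZMod 2) :=
    LinearMap.pi fun y => LinearMap.pi fun i => lcoeff (ZMod 2) (B + i) ∘ₗ
      modByMonicHom (modPoly N y.1) ∘ₗ (degreeLT (ZMod 2) L).subtype ∘ₗ
        (degreeLTEquiv (ZMod 2) L).symm.toLinearMap
  have hΦ : ∀ v y i, Φ v y i = (keyPoly v %ₘ modPoly N y.1).coeff (B + i) := fun _ _ _ => rfl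
  have hsurj : Function.Surjective Φ := by
    intro T
    choose f hf hf1 hf2 using fun y : J => exists_hash_eq_single hN hd hB J hJ y.2 (T y)
    refine ⟨degreeLTEquiv (ZMod 2) L ⟨∑ y, f y, sum_mem fun y _ => degreeLT_mono hL (hf y)⟩, ?_⟩
    funext y i
    rw [hΦ, keyPoly, LinearEquiv.symm_apply_apply]
    have : (∑ y, f y) %ₘ modPoly N y.1 = ∑ y', f y' %ₘ modPoly N y.1 :=
      map_sum (modByMonicHom (modPoly N y.1)) _ _
    rw [this, Finset.sum_eq_single y, hf1]
    · intro y' _ hne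
      exact hf2 y' y.1 y.2 fun h => hne (Subtype.ext h.symm)
    · simp
  refine ⟨(Finset.univ.filter fun v => Φ v = 0).card, fun t => ?_⟩
  have h1 : ∀ v, (fun y : J => (hashFun N B (keyPoly v) y.1 : BitString m)) = t ↔
      Φ v = fun y i => if t y i then 1 else 0 := by
    have h2 : ∀ (z : ZMod 2) (b : Bool), decide (z ≠ 0) = b ↔ z = if b then 1 else 0 := by decide
    intro v
    simp only [funext_iff, hashFun, h2, hΦ]
  simp only [h1]
  exact AddMonoidHom.card_fiber_eq_of_mem_range Φ (hsurj _) (hsurj _)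

end Hash

/-! ### Computing the hash function with a circuit -/

section Reduce

open Polynomial

/-- One step of the division by `X ^ N + Y`, which leaves the quotient in the high coefficients. -/
def redStep (N : ℕ) (Y : (ZMod 2)[X]) (p : ℕ) (f : (ZMod 2)[X]) : (ZMod 2)[X] :=
  f + C (f.coeff (p + N)) * X ^ p * Y

def reduce (N : ℕ) (Y : (ZMod 2)[X]) : ℕ → (ZMod 2)[X] → (ZMod 2)[X]
  | 0, f => f
  | n + 1, f => reduce N Y n (redStep N Y n f)

def unreduce (N : ℕ) (Y : (ZMod 2)[X]) : ℕ → (ZMod 2)[X] → (ZMod 2)[X]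
  | 0, f => f
  | n + 1, f => redStep N Y n (unreduce N Y n f)

variable {N : ℕ} {Y : (ZMod 2)[X]}

/-- As `Y` has degree below `N`, the step does not alter the coefficient that controls it, and in
characteristic two repeating it cancels. The division is therefore undone by the same steps in the
opposite order. -/
theorem redStep_redStep (hY : Y.degree < N) (p : ℕ) (f : (ZMod 2)[X]) :
    redStep N Y p (redStep N Y p f) = f := by
  have h : (redStep N Y p f).coeff (p + N) = f.coeff (p + N) := by
    rw [redStep, coeff_add, mul_assoc, coeff_C_mul, Nat.add_comm p N, coeff_X_pow_mul,
      coeff_eq_zero_of_degree_lt hY, mul_zero, add_zero]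
  rw [redStep, h, redStep, add_assoc, CharTwo.add_self_eq_zero, add_zero]

theorem unreduce_reduce (hY : Y.degree < N) (n : ℕ) (f : (ZMod 2)[X]) :
    unreduce N Y n (reduce N Y n f) = f := by
  induction n generalizing f with
  | zero => rfl
  | succ n ih => rw [reduce, unreduce, ih, redStep_redStep hY]

/-- The invariant of long division in place: the register holds `Q * X ^ N + r`, with the part `Q`
of the quotient found so far, and `r + (X ^ N + Y) * Q` never changes. The leading coefficient of
`r`, which ordinary division would cancel, is left where it stands and counted as the next
coefficient of `Q`. -/
theorem exists_reduce_eq (hY : Y.degree < N) (n : ℕ) (Q r : (ZMod 2)[X]) (hQ : X ^ n ∣ Q)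
    (hr : r.degree < (n + N : ℕ)) :
    ∃ Q' r', reduce N Y n (Q * X ^ N + r) = Q' * X ^ N + r' ∧ r'.degree < (N : WithBot ℕ) ∧
      r' + (X ^ N + Y) * Q' = r + (X ^ N + Y) * Q := by
  induction n generalizing Q r with
  | zero => exact ⟨Q, r, rfl, by simpa using hr, rfl⟩
  | succ n ih =>
    set c := r.coeff (n + N) with hc
    have hcoeff : (Q * X ^ N + r).coeff (n + N) = c := by
      obtain ⟨q, rfl⟩ := hQ
      rw [coeff_add, coeff_mul_X_pow, pow_succ, mul_assoc, coeff_X_pow_mul', if_pos le_rfl]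
      simp [hc]
    have hmon : (X ^ N + Y).degree = (N : WithBot ℕ) := by
      rw [degree_add_eq_left_of_degree_lt, degree_X_pow]
      rwa [degree_X_pow]
    have hlead : (X ^ N + Y).coeff N = 1 := by
      rw [coeff_add, coeff_X_pow_self, coeff_eq_zero_of_degree_lt hY, add_zero]
    obtain ⟨Q', r', h1, h2, h3⟩ := ih (Q + C c * X ^ n) (r - C c * X ^ n * (X ^ N + Y))
      (dvd_add ((pow_dvd_pow _ n.le_succ).trans hQ) (dvd_mul_left _ _)) (by
        rw [degree_lt_iff_coeff_zero]
        intro k hk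
        obtain ⟨k, rfl⟩ := Nat.exists_eq_add_of_le hk
        rw [coeff_sub, mul_assoc, coeff_C_mul, show n + N + k = N + k + n by ring,
          coeff_X_pow_mul]
        rcases Nat.eq_zero_or_pos k with rfl | hk0
        · rw [Nat.add_zero, hlead, Nat.add_comm N n, ← hc]; ring
        · rw [coeff_eq_zero_of_degree_lt (p := r), coeff_eq_zero_of_degree_lt (p := X ^ N + Y)]
          · ring
          · rw [hmon]; exact_mod_cast (by omega : N < N + k)
          · exact hr.trans_le (by exact_mod_cast (by omega : n + 1 + N ≤ N + k + n)))
    refine ⟨Q', r', ?_, h2, h3.trans (by ring)⟩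
    rw [reduce, ← h1, redStep, hcoeff]
    congr 1
    linear_combination (C c * X ^ n * Y) * CharTwo.two_eq_zero (R := (ZMod 2)[X])

theorem coeff_reduce (hY : Y.degree < N) {n : ℕ} {f : (ZMod 2)[X]} (hf : f.degree < (n + N : ℕ))
    {i : ℕ} (hi : i < N) : (reduce N Y n f).coeff i = (f %ₘ (X ^ N + Y)).coeff i := by
  obtain ⟨Q, r, h1, h2, h3⟩ := exists_reduce_eq hY n 0 f (dvd_zero _) hf
  rw [zero_mul, zero_add] at h1
  rw [mul_zero, add_zero] at h3
  have hd : (X ^ N + Y).degree = (N : WithBot ℕ) := by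
    rw [degree_add_eq_left_of_degree_lt, degree_X_pow]
    rwa [degree_X_pow]
  rw [h1, (div_modByMonic_unique Q r (monic_X_pow_add hY) ⟨h3, by rwa [hd]⟩).2, coeff_add,
    coeff_mul_X_pow', if_neg (by omega), zero_add]

end Reduce

/-! ### Gate sequences that map basis states to basis states -/

section Maps

variable {d m : ℕ} {O : BitString d → BitString m}

/-- The gates map one basis state to another. -/
def Maps (O : BitString d → BitString m) (gs : List Gate) (S T : Finset ℕ) : Prop :=
  run O gs (Finsupp.single S 1) = Finsupp.single T 1

theorem Maps.nil (S : Finset ℕ) : Maps O [] S S := rfl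

theorem Maps.append {gs gs' : List Gate} {S T U : Finset ℕ} (h : Maps O gs S T)
    (h' : Maps O gs' T U) : Maps O (gs ++ gs') S U := by
  rw [Maps, run_append, h, h']

theorem Maps.cons {g : Gate} {gs' : List Gate} {S T U : Finset ℕ} (h : Maps O [g] S T)
    (h' : Maps O gs' T U) : Maps O (g :: gs') S U := h.append h'

theorem maps_pauliX (i : ℕ) (S : Finset ℕ) : Maps O [.pauliX i] S (symmDiff S {i}) := by
  simp [Maps, run, apply_single, Gate.onBasis]

theorem maps_cnot (i j : ℕ) (S : Finset ℕ) :
    Maps O [.cnot i j] S (symmDiff S (if i ∈ S then {j} else ∅)) := by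
  rw [Maps, run_cons, run_nil, apply_single, Gate.onBasis]
  split_ifs <;> simp [← Finset.bot_eq_empty]

theorem maps_toffoli (i j k : ℕ) (S : Finset ℕ) :
    Maps O [.toffoli i j k] S (symmDiff S (if i ∈ S ∧ j ∈ S then {k} else ∅)) := by
  rw [Maps, run_cons, run_nil, apply_single, Gate.onBasis]
  split_ifs <;> simp [← Finset.bot_eq_empty]

/-- A sequence of controlled negations in which no target is a control. -/
theorem maps_cnots (l : List (ℕ × ℕ)) (hl : (l.map Prod.snd).Nodup)
    (hd : ∀ q ∈ l, ∀ q' ∈ l, q.1 ≠ q'.2) (S : Finset ℕ) :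
    Maps O (l.map fun q => .cnot q.1 q.2) S
      (symmDiff S ((l.filter fun q => q.1 ∈ S).map Prod.snd).toFinset) := by
  induction l generalizing S with
  | nil => simpa [← Finset.bot_eq_empty] using Maps.nil S
  | cons q l ih =>
    rw [List.map_cons, List.nodup_cons] at hl
    rw [List.map_cons]
    refine Maps.cons (maps_cnot _ _ _) ?_
    have h1 := ih hl.2 (fun a ha b hb => hd a (by simp [ha]) b (by simp [hb]))
      (symmDiff S (if q.1 ∈ S then {q.2} else ∅))
    have h2 : (l.filter fun a => a.1 ∈ symmDiff S (if q.1 ∈ S then {q.2} else ∅)) =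
        l.filter fun a => a.1 ∈ S := by
      refine List.filter_congr fun a ha => ?_
      have := hd a (by simp [ha]) q (by simp)
      rw [decide_eq_decide, Finset.mem_symmDiff]
      split_ifs <;> simp [this]
    rw [h2] at h1
    convert h1 using 1
    rw [symmDiff_assoc, List.filter_cons]
    congr 1
    by_cases hq : q.1 ∈ S
    · have h3 : q.2 ∉ ((l.filter fun a => a.1 ∈ S).map Prod.snd).toFinset := by
        intro h
        rw [List.mem_toFinset] at h
        exact hl.1 (((List.filter_sublist).map _).subset h)
      simp only [hq, decide_true, if_true, List.map_cons, List.toFinset_cons]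
      ext a
      simp only [Finset.mem_insert, Finset.mem_symmDiff, Finset.mem_singleton]
      constructor
      · rintro (rfl | h)
        · exact .inl ⟨rfl, h3⟩
        · exact .inr ⟨h, fun e => h3 (e ▸ h)⟩
      · rintro (⟨h, _⟩ | ⟨h, _⟩)
        · exact .inl h
        · exact .inr h
    · simp [hq, ← Finset.bot_eq_empty]

open Polynomial in
/-- The key wires at which the polynomial has nonzero coefficients. -/
def keySet (s : ℕ) (f : (ZMod 2)[X]) : Finset ℕ := f.support.image (keyWire s)

theorem keyWire_injective (s : ℕ) : Function.Injective (keyWire s) := fun a b h => by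
  simp only [keyWire] at h; omega

open Polynomial in
theorem keyWire_mem_keySet {s p : ℕ} {f : (ZMod 2)[X]} :
    keyWire s p ∈ keySet s f ↔ f.coeff p ≠ 0 := by
  rw [keySet, (keyWire_injective s).mem_finset_image, mem_support_iff]

open Polynomial in
theorem notMem_keySet {s i : ℕ} {f : (ZMod 2)[X]} (h : i < s + s) : i ∉ keySet s f := by
  simp only [keySet, Finset.mem_image, not_exists, not_and, keyWire]
  intro p _; omega

open Polynomial in
theorem keySet_add_X_pow (s q : ℕ) (f : (ZMod 2)[X]) :
    keySet s (f + X ^ q) = symmDiff (keySet s f) {keyWire s q} := by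
  ext i
  by_cases hi : ∃ p, keyWire s p = i
  · obtain ⟨p, rfl⟩ := hi
    rw [Finset.mem_symmDiff, keyWire_mem_keySet, keyWire_mem_keySet, Finset.mem_singleton,
      (keyWire_injective s).eq_iff, coeff_add, coeff_X_pow]
    generalize f.coeff p = c
    by_cases h : p = q
    · simp only [h, if_true]; revert c; decide
    · simp [h]
  · have h : ∀ g : (ZMod 2)[X], i ∉ keySet s g := fun g hg => by
      obtain ⟨p, _, hp⟩ := Finset.mem_image.1 hg
      exact hi ⟨p, hp⟩
    have h' : i ≠ keyWire s q := fun e => hi ⟨q, e.symm⟩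
    simp [Finset.mem_symmDiff, h, h']

open Polynomial in
/-- The polynomial whose coefficients are the values of the listed wires. -/
def wirePoly (R : Finset ℕ) : List ℕ → (ZMod 2)[X]
  | [] => 0
  | w :: ws => (if w ∈ R then 1 else 0) + X * wirePoly R ws

theorem wirePoly_congr {R R' : Finset ℕ} {ws : List ℕ} (h : ∀ w ∈ ws, w ∈ R ↔ w ∈ R') :
    wirePoly R ws = wirePoly R' ws := by
  induction ws with
  | nil => rfl
  | cons w ws ih =>
    rw [wirePoly, wirePoly, ih fun w hw => h w (by simp [hw])]
    simp [h w]

theorem wirePoly_eq {R : Finset ℕ} {ws : List ℕ} (h : ws.length = d) :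
    wirePoly R ws = inPoly (queryInput d ws R) := by
  induction ws generalizing d with
  | nil => subst h; simp [wirePoly, inPoly]
  | cons w ws ih =>
    subst h
    rw [wirePoly, ih rfl, inPoly, inPoly, List.length_cons, Fin.sum_univ_succ, Finset.mul_sum]
    congr 1
    · simp [queryInput]
    · refine Finset.sum_congr rfl fun i _ => ?_
      simp only [queryInput, Fin.val_succ, List.getD_cons_succ, decide_eq_true_eq]
      split_ifs <;> ring

open Polynomial in
-- The targets are coefficients `p + i` with `i < hashDeg s`, so the controlling coefficient `p +
-- hashDeg s` is constant during the step. `R` is the remaining content of the wires; it need only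
-- avoid that control.
theorem maps_reduceStep {s p : ℕ} {R : Finset ℕ} (hR : keyWire s (p + hashDeg s) ∉ R)
    (ins : List ℕ) (hi : ∀ w ∈ ins, w < s) (hN : ins.length ≤ hashDeg s) (f : (ZMod 2)[X]) :
    Maps O (reduceStep s ins p) (symmDiff R (keySet s f))
      (symmDiff R (keySet s (redStep (hashDeg s) (wirePoly R ins) p f))) := by
  -- Generalized to a tail of the input wires that starts at index `k`, for induction on this tail.
  have main : ∀ (ws : List ℕ) (k : ℕ) (f : (ZMod 2)[X]), (∀ w ∈ ws, w < s) →
      k + ws.length ≤ hashDeg s →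
      Maps O (ws.mapIdx fun i w => .toffoli w (keyWire s (p + hashDeg s)) (keyWire s (p + (k + i))))
        (symmDiff R (keySet s f)) (symmDiff R (keySet s
          (f + C (f.coeff (p + hashDeg s)) * X ^ p * (X ^ k * wirePoly R ws)))) := by
    intro ws
    induction ws with
    | nil => intro k f _ _; simpa [wirePoly] using Maps.nil _
    | cons w ws ih =>
      intro k f hw hk
      rw [List.length_cons] at hk
      rw [List.mapIdx_cons]
      refine Maps.cons (maps_toffoli _ _ _ _) ?_
      have e1 : w ∈ symmDiff R (keySet s f) ↔ w ∈ R := by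
        have : w ∉ keySet s f := notMem_keySet (by have := hw w (by simp); omega)
        rw [Finset.mem_symmDiff]; tauto
      have e2 : keyWire s (p + hashDeg s) ∈ symmDiff R (keySet s f) ↔
          f.coeff (p + hashDeg s) ≠ 0 := by
        rw [← keyWire_mem_keySet (s := s), Finset.mem_symmDiff]; tauto
      simp only [e1, e2, Nat.add_zero]
      set c := f.coeff (p + hashDeg s) with hc
      set f' := f + C c * X ^ p * (X ^ k * (if w ∈ R then 1 else 0)) with hf'
      have e3 : symmDiff (symmDiff R (keySet s f)) (if w ∈ R ∧ c ≠ 0 then {keyWire s (p + k)}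
          else ∅) = symmDiff R (keySet s f') := by
        rw [symmDiff_assoc]
        by_cases h1 : w ∈ R
        · by_cases h2 : c = 0
          · simp [hf', h2, ← Finset.bot_eq_empty]
          · have h3 : c = 1 := by revert h2; generalize c = c; revert c; decide
            rw [hf', if_pos ⟨h1, h2⟩, if_pos h1, h3, ← keySet_add_X_pow]
            congr 3
            rw [pow_add]; simp
        · simp [hf', h1, ← Finset.bot_eq_empty]
      rw [e3]
      have e4 : f'.coeff (p + hashDeg s) = c := by
        rw [hf', coeff_add, mul_assoc, coeff_C_mul, ← mul_assoc, ← pow_add]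
        split_ifs
        · rw [mul_one, coeff_X_pow, if_neg (by omega), mul_zero, add_zero]
        · simp [hc]
      have := ih (k + 1) f' (fun w hw' => hw w (by simp [hw'])) (by omega)
      rw [e4] at this
      have e5 : f + C c * X ^ p * (X ^ k * wirePoly R (w :: ws)) =
          f' + C c * X ^ p * (X ^ (k + 1) * wirePoly R ws) := by
        rw [hf', wirePoly]; ring
      have e6 : (fun i w => Gate.toffoli w (keyWire s (p + hashDeg s))
          (keyWire s (p + (k + (i + 1))))) = fun i w => Gate.toffoli w (keyWire s (p + hashDeg s))
          (keyWire s (p + (k + 1 + i))) := by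
        funext i w; rw [Nat.add_right_comm, Nat.add_assoc k i 1]
      rw [e5, e6]
      exact this
  have := main ins 0 f hi (by omega)
  simpa [reduceStep, redStep] using this

open Polynomial in
theorem maps_reduceGates {s : ℕ} {R : Finset ℕ} (ins : List ℕ) (hi : ∀ w ∈ ins, w < s)
    (hN : ins.length ≤ hashDeg s) (n : ℕ) (hR : ∀ p < n, keyWire s (p + hashDeg s) ∉ R)
    (f : (ZMod 2)[X]) :
    Maps O ((List.range n).reverse.flatMap (reduceStep s ins)) (symmDiff R (keySet s f))
      (symmDiff R (keySet s (reduce (hashDeg s) (wirePoly R ins) n f))) := by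
  induction n generalizing f with
  | zero => exact Maps.nil _
  | succ n ih =>
    rw [List.range_succ, List.reverse_append, List.reverse_singleton, List.singleton_append,
      List.flatMap_cons]
    exact (maps_reduceStep (hR n (by omega)) ins hi hN f).append
      (ih (fun p hp => hR p (by omega)) _)

open Polynomial in
theorem maps_unreduceGates {s : ℕ} {R : Finset ℕ} (ins : List ℕ) (hi : ∀ w ∈ ins, w < s)
    (hN : ins.length ≤ hashDeg s) (n : ℕ) (hR : ∀ p < n, keyWire s (p + hashDeg s) ∉ R)
    (f : (ZMod 2)[X]) :
    Maps O ((List.range n).flatMap (reduceStep s ins)) (symmDiff R (keySet s f))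
      (symmDiff R (keySet s (unreduce (hashDeg s) (wirePoly R ins) n f))) := by
  induction n generalizing f with
  | zero => exact Maps.nil _
  | succ n ih =>
    rw [List.range_succ, List.flatMap_append, List.flatMap_singleton]
    exact (ih (fun p hp => hR p (by omega)) _).append
      (maps_reduceStep (hR n (by omega)) ins hi hN _)

end Maps

/-! ### Simulation of the oracle circuit -/

section Low

/-- The wires of a gate. -/
def Gate.wires : Gate → List ℕ
  | .hadamard i => [i]
  | .phaseT i => [i]
  | .pauliX i => [i]
  | .cnot i j => [i, j]
  | .toffoli i j k => [i, j, k]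
  | .query ins outs => ins ++ outs

/-- All wires of the gate have numbers less than `n`. -/
def Gate.Below (n : ℕ) (g : Gate) : Prop := ∀ i ∈ g.wires, i < n

/-- The states in which all wires from `n` on are `0`. -/
def low (n : ℕ) : Submodule ℂ State := Finsupp.supported ℂ ℂ {S | ∀ i ∈ S, i < n}

theorem single_mem_low {n : ℕ} {S : Finset ℕ} (h : ∀ i ∈ S, i < n) (c : ℂ) :
    Finsupp.single S c ∈ low n := Finsupp.single_mem_supported ℂ c h

theorem eq_of_mem_low {n : ℕ} {T T' : State →ₗ[ℂ] State}
    (h : ∀ S : Finset ℕ, (∀ i ∈ S, i < n) → T (Finsupp.single S 1) = T' (Finsupp.single S 1))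
    {ψ : State} (hψ : ψ ∈ low n) : T ψ = T' ψ := by
  rw [← Finsupp.sum_single ψ, map_finsuppSum, map_finsuppSum]
  refine Finsupp.sum_congr fun S hS => ?_
  have := h S (hψ hS)
  rw [← mul_one (ψ S), ← smul_eq_mul, ← Finsupp.smul_single, map_smul, map_smul, this]

theorem mem_of_mem_symmDiff {n : ℕ} {S T : Finset ℕ} (hS : ∀ i ∈ S, i < n) (hT : ∀ i ∈ T, i < n) :
    ∀ i ∈ symmDiff S T, i < n := fun i hi =>
  (Finset.mem_symmDiff.1 hi).elim (fun h => hS i h.1) fun h => hT i h.1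

variable {d m : ℕ} (O : BitString d → BitString m)

theorem apply_mem_low {n : ℕ} {g : Gate} (hg : g.Below n) (hw : g.WellFormed d m) {ψ : State}
    (hψ : ψ ∈ low n) : g.apply O ψ ∈ low n := by
  rw [Gate.apply, Finsupp.linearCombination_apply]
  refine Submodule.sum_mem _ fun S hS => Submodule.smul_mem _ _ ?_
  have hS : ∀ i ∈ S, i < n := hψ hS
  have hs : ∀ i < n, ∀ j ∈ symmDiff S {i}, j < n := fun i hi =>
    mem_of_mem_symmDiff hS (by simpa using hi)
  cases g with
  | hadamard i =>
    have hi : i < n := hg i (by simp [Gate.wires])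
    refine Submodule.smul_mem _ _ (Submodule.add_mem _ (single_mem_low ?_ _)
      (single_mem_low ?_ _))
    · intro k hk; exact hS k (Finset.mem_of_mem_erase hk)
    · intro k hk
      rcases Finset.mem_insert.1 hk with rfl | hk
      · exact hi
      · exact hS k hk
  | phaseT i => exact single_mem_low hS _
  | pauliX i => exact single_mem_low (hs i (hg i (by simp [Gate.wires]))) _
  | cnot i j =>
    refine single_mem_low ?_ _
    split_ifs
    · exact hs j (hg j (by simp [Gate.wires]))
    · exact hS
  | toffoli i j k =>
    refine single_mem_low ?_ _
    split_ifs
    · exact hs k (hg k (by simp [Gate.wires]))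
    · exact hS
  | query ins outs =>
    exact single_mem_low (mem_of_mem_symmDiff hS fun i hi =>
      hg i (by simp [Gate.wires, mem_of_mem_onesOf hw.2.1 hi])) _

theorem run_mem_low {n : ℕ} {gs : List Gate} (hg : ∀ g ∈ gs, g.Below n)
    (hw : ∀ g ∈ gs, g.WellFormed d m) {ψ : State} (hψ : ψ ∈ low n) : run O gs ψ ∈ low n := by
  induction gs generalizing ψ with
  | nil => exact hψ
  | cons g gs ih =>
    exact ih (fun g h => hg g (by simp [h])) (fun g h => hw g (by simp [h]))
      (apply_mem_low O (hg g (by simp)) (hw g (by simp)) hψ)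

/-- Negates the wires in `a`. -/
def shift (a : Finset ℕ) : State →ₗ[ℂ] State :=
  Finsupp.lmapDomain ℂ ℂ fun S => symmDiff S a

theorem shift_single (a S : Finset ℕ) (c : ℂ) :
    shift a (Finsupp.single S c) = Finsupp.single (symmDiff S a) c := by
  simp [shift]

theorem support_shift (a : Finset ℕ) (ψ : State) :
    (shift a ψ).support = ψ.support.image fun S => symmDiff S a :=
  Finsupp.mapDomain_support_of_injective (symmDiff_left_injective a) ψ

theorem shift_apply (a : Finset ℕ) (ψ : State) (S : Finset ℕ) :
    shift a ψ (symmDiff S a) = ψ S :=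
  Finsupp.mapDomain_apply (symmDiff_left_injective a) ψ S

theorem normSq_shift (a : Finset ℕ) (ψ : State) : normSq (shift a ψ) = normSq ψ := by
  rw [normSq_eq_sum subset_rfl, support_shift,
    Finset.sum_image fun _ _ _ _ h => symmDiff_left_injective a h, normSq_eq_sum subset_rfl]
  simp [shift_apply]

theorem project_shift {a : Finset ℕ} {ws : List ℕ} (h : ∀ i ∈ ws, i ∉ a) (v : List Bool)
    (ψ : State) : project ws v (shift a ψ) = shift a (project ws v ψ) := by
  have hr : ∀ S, readWires ws (symmDiff S a) = readWires ws S := by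
    intro S
    refine List.map_congr_left fun i hi => ?_
    rw [decide_eq_decide, Finset.mem_symmDiff]
    have := h i hi
    tauto
  ext T
  obtain ⟨S, rfl⟩ : ∃ S, symmDiff S a = T := ⟨symmDiff T a, by simp⟩
  rw [project, Finsupp.filter_apply, shift_apply, shift_apply, hr, project, Finsupp.filter_apply]

/-- Elementary gates act on their wires only. -/
theorem apply_shift {d' m' : ℕ} (O' : BitString d' → BitString m') {g : Gate}
    (hg : g.IsElementary) {a : Finset ℕ} (ha : ∀ i ∈ g.wires, i ∉ a) (ψ : State) :
    g.apply O' (shift a ψ) = shift a (g.apply O ψ) := by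
  suffices h : g.apply O' ∘ₗ shift a = shift a ∘ₗ g.apply O from LinearMap.congr_fun h ψ
  refine Finsupp.lhom_ext fun S c => ?_
  rw [LinearMap.comp_apply, LinearMap.comp_apply, shift_single, apply_single, apply_single,
    map_smul]
  congr 1
  have hm : ∀ i ∈ g.wires, i ∈ symmDiff S a ↔ i ∈ S := fun i hi => by
    have := ha i hi
    rw [Finset.mem_symmDiff]; tauto
  cases g with
  | hadamard i =>
    have hi := ha i (by simp [Gate.wires])
    simp only [Gate.onBasis, map_smul, map_add, shift_single, hm i (by simp [Gate.wires])]
    congr 3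
    · ext k
      simp only [Finset.mem_erase, Finset.mem_symmDiff]
      by_cases hk : k = i
      · subst hk; simp [hi]
      · simp [hk]
    · ext k
      simp only [Finset.mem_insert, Finset.mem_symmDiff]
      by_cases hk : k = i
      · subst hk; simp [hi]
      · simp [hk]
  | phaseT i => simp [Gate.onBasis, shift_single, hm i (by simp [Gate.wires])]
  | pauliX i => simp [Gate.onBasis, shift_single, symmDiff_right_comm]
  | cnot i j =>
    simp only [Gate.onBasis, shift_single, hm i (by simp [Gate.wires])]
    split_ifs
    · rw [symmDiff_right_comm]
    · rfl
  | toffoli i j k =>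
    simp only [Gate.onBasis, shift_single, hm i (by simp [Gate.wires]),
      hm j (by simp [Gate.wires])]
    split_ifs
    · rw [symmDiff_right_comm]
    · rfl
  | query ins outs => exact hg.elim

end Low

/-! ### The hash circuit in place of a query -/

section Sim

open Polynomial

variable {d m : ℕ}

theorem length_le_of_below {ws : List ℕ} (h : ws.Nodup) {s : ℕ} (hs : ∀ i ∈ ws, i < s) :
    ws.length ≤ s := by
  rw [← List.toFinset_card_of_nodup h, ← Finset.card_range s]
  exact Finset.card_le_card fun i hi => Finset.mem_range.2 (hs i (List.mem_toFinset.1 hi))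

theorem le_hashDeg {s d : ℕ} (h : d ≤ s) : d ≤ hashDeg s := by
  unfold hashDeg; nlinarith [Nat.le_mul_self s]

theorem hashPos_add_le {s m : ℕ} (h : m ≤ s) : hashPos s + m ≤ hashDeg s := by
  unfold hashDeg hashPos; nlinarith [Nat.le_mul_self s]

theorem maps_answerGates (O : BitString 0 → BitString 0) {s : ℕ} {outs : List ℕ}
    (hn : outs.Nodup) (ho : ∀ i ∈ outs, i < s) (hm : outs.length = m) {R : Finset ℕ}
    (hR : ∀ i : Fin m, keyWire s (hashPos s + i) ∉ R) (f : (ZMod 2)[X]) :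
    Maps O (answerGates s outs) (symmDiff R (keySet s f))
      (symmDiff (symmDiff R (onesOf outs fun i : Fin m => decide (f.coeff (hashPos s + i) ≠ 0)))
        (keySet s f)) := by
  set l : List (ℕ × ℕ) := outs.mapIdx fun i w => (keyWire s (hashPos s + i), w) with hl
  have e1 : answerGates s outs = l.map fun q => .cnot q.1 q.2 := by
    rw [hl, answerGates]; simp [List.mapIdx_eq_zipIdx_map]
  have e2 : l.map Prod.snd = outs := by
    rw [hl]; simp [List.mapIdx_eq_zipIdx_map, Function.comp_def, List.zipIdx_map_fst]
  rw [e1, symmDiff_right_comm]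
  have := maps_cnots (O := O) l (by rwa [e2]) (fun q hq q' hq' => ?_) (symmDiff R (keySet s f))
  · suffices h : (onesOf outs fun i : Fin m => decide (f.coeff (hashPos s + i) ≠ 0)) =
        ((l.filter fun q => q.1 ∈ symmDiff R (keySet s f)).map Prod.snd).toFinset by
      rw [h]; exact this
    ext x
    simp only [onesOf, Finset.mem_image, Finset.mem_filter, Finset.mem_univ, true_and,
      List.mem_toFinset, List.mem_map, List.mem_filter, decide_eq_true_eq, hl, List.mem_mapIdx]
    subst hm
    have h1 : ∀ i : Fin outs.length, keyWire s (hashPos s + i) ∈ symmDiff R (keySet s f) ↔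
        f.coeff (hashPos s + i) ≠ 0 := fun i => by
      rw [← keyWire_mem_keySet (s := s), Finset.mem_symmDiff]
      have := hR i
      tauto
    constructor
    · rintro ⟨i, hi, rfl⟩
      refine ⟨(keyWire s (hashPos s + i), outs[i]), ⟨⟨i, i.2, rfl⟩, (h1 i).2 hi⟩, ?_⟩
      simp
    · rintro ⟨_, ⟨⟨i, hi, rfl⟩, h2⟩, rfl⟩
      refine ⟨⟨i, hi⟩, (h1 ⟨i, hi⟩).1 h2, ?_⟩
      simp [hi]
  · obtain ⟨i, hi, rfl⟩ := List.mem_mapIdx.1 hq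
    obtain ⟨i', hi', rfl⟩ := List.mem_mapIdx.1 hq'
    have := ho _ (List.getElem_mem hi')
    simp only [keyWire]
    omega

/-- The hash circuit acts like a query to the hash function. -/
theorem run_hashGates (O : BitString 0 → BitString 0) {s : ℕ} {ins outs : List ℕ}
    (hw : (Gate.query ins outs).WellFormed d m) (hs : (Gate.query ins outs).Below s)
    {f : (ZMod 2)[X]} (hf : f.degree < (hashSteps s + hashDeg s : ℕ)) {b : Finset ℕ}
    (hb : ∀ p < hashSteps s + hashDeg s, keyWire s p ∉ b) (hb' : ∀ i ∈ b, s + s ≤ i)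
    {ψ : State} (hψ : ψ ∈ low (s + s)) :
    run O (reduceGates s ins ++ (answerGates s outs ++ unreduceGates s ins))
        (shift (symmDiff (keySet s f) b) ψ) =
      shift (symmDiff (keySet s f) b) ((Gate.query ins outs).apply
        (hashFun (hashDeg s) (hashPos s) f : BitString d → BitString m) ψ) := by
  rw [← runₗ_apply, ← LinearMap.comp_apply, ← LinearMap.comp_apply]
  refine eq_of_mem_low (fun S hS => ?_) hψ
  rw [LinearMap.comp_apply, LinearMap.comp_apply, runₗ_apply, shift_single, apply_single,
    one_smul, Gate.onBasis, shift_single]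
  obtain ⟨hd, hm, hn⟩ := hw
  have hn' := List.nodup_append.1 hn
  have hi : ∀ i ∈ ins, i < s := fun i hi => hs i (by simp [Gate.wires, hi])
  have ho : ∀ i ∈ outs, i < s := fun i hi => hs i (by simp [Gate.wires, hi])
  have hds : ins.length ≤ s := length_le_of_below hn'.1 hi
  have hms : m ≤ s := hm ▸ length_le_of_below hn'.2.1 ho
  set T : Finset ℕ := onesOf outs
    ((hashFun (hashDeg s) (hashPos s) f : BitString d → BitString m) (queryInput d ins S)) with hT
  have hTo : ∀ i ∈ T, i ∈ outs := fun i => mem_of_mem_onesOf hm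
  have hR : ∀ p < hashSteps s + hashDeg s, keyWire s p ∉ symmDiff S b := fun p hp => by
    have h1 : keyWire s p ∉ S := fun h => by have := hS _ h; simp only [keyWire] at this; omega
    have := hb p hp
    rw [Finset.mem_symmDiff]; tauto
  have hin : ∀ w ∈ ins, w ∈ symmDiff S b ↔ w ∈ S := fun w hw => by
    have : w ∉ b := fun h => by have := hb' w h; have := hi w hw; omega
    rw [Finset.mem_symmDiff]; tauto
  -- The answer is written on wires other than the input wires, so the uncomputation divides by the
  -- same modulus.
  have hin' : ∀ w ∈ ins, w ∈ symmDiff (symmDiff S b) T ↔ w ∈ S := fun w hw => by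
    have : w ∉ T := fun h => hn'.2.2 w hw w (hTo w h) rfl
    rw [← hin w hw, Finset.mem_symmDiff (t := T)]; tauto
  have hY : wirePoly (symmDiff S b) ins = inPoly (queryInput d ins S) := by
    rw [wirePoly_congr hin, wirePoly_eq hd]
  have hY' : wirePoly (symmDiff (symmDiff S b) T) ins = inPoly (queryInput d ins S) := by
    rw [wirePoly_congr hin', wirePoly_eq hd]
  set Y := inPoly (queryInput d ins S) with hYdef
  have hYdeg : Y.degree < (hashDeg s : WithBot ℕ) :=
    (degree_inPoly_lt _).trans_le (by exact_mod_cast le_hashDeg (hd ▸ hds))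
  have s1 := maps_reduceGates (O := O) ins hi (le_hashDeg hds) (hashSteps s)
    (R := symmDiff S b) (fun p hp => hR _ (by omega)) f
  rw [hY] at s1
  have hpos := hashPos_add_le hms
  have s2 := maps_answerGates O hn'.2.1 ho hm (R := symmDiff S b)
    (fun i => hR _ (by have := i.2; omega)) (reduce (hashDeg s) Y (hashSteps s) f)
  have hans : (onesOf outs fun i : Fin m => decide
      ((reduce (hashDeg s) Y (hashSteps s) f).coeff (hashPos s + i) ≠ 0)) = T := by
    rw [hT]
    congr 1
    funext i
    -- The positions that are read lie below `hashDeg s`, where the register holds the remainder and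
    -- not the quotient.
    rw [coeff_reduce hYdeg hf (by have := i.2; omega)]
    rfl
  rw [hans] at s2
  have hTk : ∀ p, keyWire s p ∉ T := fun p h => by
    have := ho _ (hTo _ h); simp only [keyWire] at this; omega
  have s3 := maps_unreduceGates (O := O) ins hi (le_hashDeg hds) (hashSteps s)
    (R := symmDiff (symmDiff S b) T) (fun p hp => by
      have h1 := hR (p + hashDeg s) (by omega)
      have h2 := hTk (p + hashDeg s)
      rw [Finset.mem_symmDiff (t := T)]; tauto) (reduce (hashDeg s) Y (hashSteps s) f)
  rw [hY', unreduce_reduce hYdeg] at s3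
  have := s1.append (s2.append s3)
  have e1 : symmDiff (symmDiff S b) (keySet s f) = symmDiff S (symmDiff (keySet s f) b) := by
    rw [symmDiff_assoc, symmDiff_comm b]
  have e2 : symmDiff (symmDiff (symmDiff S b) T) (keySet s f) =
      symmDiff (symmDiff S T) (symmDiff (keySet s f) b) := by
    rw [symmDiff_right_comm S b T, symmDiff_assoc _ b, symmDiff_comm b]
  rw [e1, e2] at this
  exact this

end Sim

/-! ### Coins that decide which query is copied -/

section Flag

/-- The blocks of different positions do not overlap. Strictness matters: a block of ancillas uses
the indices from `0` to `coinNum s` inclusive. -/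
theorem coinNum_lt_hashDeg {s : ℕ} (hs : 0 < s) : coinNum s < hashDeg s := by
  have h : coinNum s ≤ s + s := Nat.size_le.2 Nat.lt_two_pow_self
  unfold hashDeg
  nlinarith [Nat.le_mul_self s]

theorem coinWire_lt {s j l : ℕ} (hj : j < s) (hl : l < coinNum s) :
    coinWire s j l < ancWire s 0 0 := by
  have h1 := coinNum_lt_hashDeg (s := s) (by omega)
  have h2 : (j + 1) * hashDeg s ≤ s * hashDeg s := Nat.mul_le_mul_right _ hj
  rw [Nat.succ_mul] at h2
  simp only [coinWire, ancWire, randLen]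
  omega

theorem ancWire_injective (s j : ℕ) : Function.Injective (ancWire s j) := fun a b h => by
  simp only [ancWire] at h; omega

theorem ancWire_zero_le (s j l : ℕ) : ancWire s 0 0 ≤ ancWire s j l := by
  simp only [ancWire, Nat.zero_mul]; omega

open Classical in
/-- The ancilla wires, up to the `k`-th one, that the coins in `b` set. -/
def flagSet (s j : ℕ) (b : Finset ℕ) (k : ℕ) : Finset ℕ :=
  ((Finset.range (k + 1)).filter fun l => ∀ l' < l, coinWire s j l' ∈ b).image (ancWire s j)

theorem ancWire_mem_flagSet {s j l k : ℕ} {b : Finset ℕ} :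
    ancWire s j l ∈ flagSet s j b k ↔ l ≤ k ∧ ∀ l' < l, coinWire s j l' ∈ b := by
  rw [flagSet, (ancWire_injective s j).mem_finset_image, Finset.mem_filter, Finset.mem_range,
    Nat.lt_succ_iff]

theorem exists_of_mem_flagSet {s j k i : ℕ} {b : Finset ℕ} (h : i ∈ flagSet s j b k) :
    ∃ l ≤ k, i = ancWire s j l := by
  simp only [flagSet, Finset.mem_image, Finset.mem_filter, Finset.mem_range] at h
  obtain ⟨l, ⟨hl, _⟩, rfl⟩ := h
  exact ⟨l, by omega, rfl⟩

theorem flagSet_congr {s j k : ℕ} {b b' : Finset ℕ}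
    (h : ∀ l < k, coinWire s j l ∈ b ↔ coinWire s j l ∈ b') : flagSet s j b k = flagSet s j b' k := by
  unfold flagSet
  congr 1
  refine Finset.filter_congr fun l hl => ?_
  rw [Finset.mem_range] at hl
  exact forall_congr' fun l' => imp_congr_right fun hl' => h l' (by omega)

/-- The ancilla with index `l` becomes the conjunction of the first `l` coins: the one with index
`0` is set unconditionally, and each Toffoli gate takes in one more coin. -/
theorem maps_flagGates (O : BitString 0 → BitString 0) {s j : ℕ} (hj : j < s) {U : Finset ℕ}
    (hU : ∀ l, ancWire s j l ∉ U) :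
    Maps O (flagGates s j) U (symmDiff U (flagSet s j U (coinNum s))) := by
  suffices H : ∀ k ≤ coinNum s, Maps O (.pauliX (ancWire s j 0) :: (List.range k).map fun l =>
      .toffoli (ancWire s j l) (coinWire s j l) (ancWire s j (l + 1))) U
      (symmDiff U (flagSet s j U k)) from H _ le_rfl
  intro k hk
  induction k with
  | zero =>
    have : flagSet s j U 0 = {ancWire s j 0} := by simp [flagSet, Finset.filter_singleton]
    rw [this]
    exact maps_pauliX _ _
  | succ k ih =>
    rw [List.range_succ, List.map_append, ← List.cons_append]
    refine (ih (by omega)).append ?_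
    have h1 := maps_toffoli (O := O) (ancWire s j k) (coinWire s j k) (ancWire s j (k + 1))
      (symmDiff U (flagSet s j U k))
    have e1 : ancWire s j k ∈ symmDiff U (flagSet s j U k) ↔ ∀ l' < k, coinWire s j l' ∈ U := by
      rw [Finset.mem_symmDiff, ancWire_mem_flagSet]
      simp [hU]
    have e2 : coinWire s j k ∈ symmDiff U (flagSet s j U k) ↔ coinWire s j k ∈ U := by
      have : coinWire s j k ∉ flagSet s j U k := fun h => by
        obtain ⟨l, _, h⟩ := exists_of_mem_flagSet h
        have := coinWire_lt hj (l := k) (by omega)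
        have := ancWire_zero_le s j l
        omega
      rw [Finset.mem_symmDiff]; tauto
    have e3 : ∀ i, i ∈ flagSet s j U (k + 1) ↔ i ∈ symmDiff (flagSet s j U k)
        (if ancWire s j k ∈ symmDiff U (flagSet s j U k) ∧
          coinWire s j k ∈ symmDiff U (flagSet s j U k) then {ancWire s j (k + 1)} else ∅) := by
      intro i
      have e4 : (ancWire s j k ∈ symmDiff U (flagSet s j U k) ∧
          coinWire s j k ∈ symmDiff U (flagSet s j U k)) ↔
          ∀ l' < k + 1, coinWire s j l' ∈ U := by
        rw [e1, e2]
        constructor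
        · rintro ⟨h1, h2⟩ l hl
          rcases Nat.lt_succ_iff_lt_or_eq.1 hl with hl | rfl
          · exact h1 l hl
          · exact h2
        · exact fun h => ⟨fun l hl => h l (by omega), h k (by omega)⟩
      by_cases hi : ∃ l, ancWire s j l = i
      · obtain ⟨l, rfl⟩ := hi
        rw [Finset.mem_symmDiff, ancWire_mem_flagSet, ancWire_mem_flagSet]
        by_cases hl : l = k + 1
        · subst hl
          simp only [e4]
          split_ifs with h
          · simpa using h
          · simpa using h
        · have : ancWire s j l ≠ ancWire s j (k + 1) := fun h => hl (ancWire_injective s j h)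
          split_ifs
          · simp only [Finset.mem_singleton, this]
            grind
          · simp only [Finset.notMem_empty]
            grind
      · have h1 : ∀ k, i ∉ flagSet s j U k := fun k h => by
          obtain ⟨l, _, h⟩ := exists_of_mem_flagSet h
          exact hi ⟨l, h.symm⟩
        have h2 : i ≠ ancWire s j (k + 1) := fun h => hi ⟨_, h.symm⟩
        rw [Finset.mem_symmDiff]
        split_ifs <;> simp [h1, h2]
    rw [symmDiff_assoc, ← Finset.ext e3] at h1
    exact h1

/-- Copies the query input. -/
def copyCnots (s : ℕ) (ins : List ℕ) : List Gate := ins.mapIdx fun i w => .cnot w (outWire s i)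

/-- With one control on a wire that carries a classical value, a Toffoli gate is a CNOT or the
identity according to that value. -/
theorem apply_toffoli_shift {d m : ℕ} (O' : BitString 0 → BitString 0)
    (O : BitString d → BitString m) {n i j k : ℕ} (hi : n ≤ i) (hj : j < n)
    {a : Finset ℕ} (ha : ∀ i ∈ a, n ≤ i) {ψ : State} (hψ : ψ ∈ low n) :
    (Gate.toffoli i j k).apply O' (shift a ψ) =
      shift a (if i ∈ a then (Gate.cnot j k).apply O ψ else ψ) := by
  have e : ∀ S : Finset ℕ, (∀ i ∈ S, i < n) → (i ∈ symmDiff S a ↔ i ∈ a) ∧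
      (j ∈ symmDiff S a ↔ j ∈ S) := fun S hS => by
    have h1 : i ∉ S := fun h => by have := hS i h; omega
    have h2 : j ∉ a := fun h => by have := ha j h; omega
    rw [Finset.mem_symmDiff, Finset.mem_symmDiff]; tauto
  by_cases h : i ∈ a
  · rw [if_pos h, ← LinearMap.comp_apply, ← LinearMap.comp_apply]
    refine eq_of_mem_low (fun S hS => ?_) hψ
    simp only [LinearMap.comp_apply, shift_single, apply_single, one_smul, Gate.onBasis,
      (e S hS).1, (e S hS).2, h, true_and]
    split_ifs
    · rw [symmDiff_right_comm]
    · rfl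
  · rw [if_neg h, ← LinearMap.comp_apply]
    refine eq_of_mem_low (fun S hS => ?_) hψ
    simp only [LinearMap.comp_apply, shift_single, apply_single, one_smul, Gate.onBasis,
      (e S hS).1, h, false_and, if_false]

theorem cnot_below {n i j : ℕ} (hi : i < n) (hj : j < n) : (Gate.cnot i j).Below n := by
  intro k hk
  simp only [Gate.wires, List.mem_cons, List.not_mem_nil, or_false] at hk
  rcases hk with rfl | rfl <;> assumption

theorem run_copyGates {d m : ℕ} (O' : BitString 0 → BitString 0) (O : BitString d → BitString m)
    {s j : ℕ} {ins : List ℕ} (hi : ∀ i ∈ ins, i < s) (hl : ins.length ≤ s) {a : Finset ℕ}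
    (ha : ∀ i ∈ a, s + s ≤ i) {ψ : State} (hψ : ψ ∈ low (s + s)) :
    run O' (copyGates s j ins) (shift a ψ) =
      shift a (run O (if ancWire s j (coinNum s) ∈ a then copyCnots s ins else []) ψ) := by
  suffices H : ∀ (ws : List ℕ) (k : ℕ), (∀ i ∈ ws, i < s) → k + ws.length ≤ s →
      ∀ ψ ∈ low (s + s),
      run O' (ws.mapIdx fun i w => .toffoli (ancWire s j (coinNum s)) w (outWire s (k + i)))
        (shift a ψ) = shift a (run O (if ancWire s j (coinNum s) ∈ a then
          (ws.mapIdx fun i w => .cnot w (outWire s (k + i))) else []) ψ) by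
    have := H ins 0 hi (by omega) ψ hψ
    simpa [copyGates, copyCnots] using this
  intro ws
  induction ws with
  | nil => intro k _ _ ψ _; simp [run_nil]
  | cons w ws ih =>
    intro k hw hk ψ hψ
    rw [List.length_cons] at hk
    have hws : w < s := hw w (by simp)
    have ho : outWire s (k + 0) < s + s := by simp only [outWire]; omega
    rw [List.mapIdx_cons, List.mapIdx_cons, run_cons,
      apply_toffoli_shift O' O (n := s + s) (by simp only [ancWire]; omega)
      (by omega) ha hψ]
    have e1 : (fun i w => Gate.toffoli (ancWire s j (coinNum s)) w (outWire s (k + (i + 1)))) =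
        fun i w => Gate.toffoli (ancWire s j (coinNum s)) w (outWire s (k + 1 + i)) := by
      funext i w; rw [Nat.add_right_comm, Nat.add_assoc k i 1]
    have e2 : (fun i w => Gate.cnot w (outWire s (k + (i + 1)))) =
        fun i w => Gate.cnot w (outWire s (k + 1 + i)) := by
      funext i w; rw [Nat.add_right_comm, Nat.add_assoc k i 1]
    rw [e1, e2]
    have hlow : (Gate.cnot w (outWire s (k + 0))).apply O ψ ∈ low (s + s) :=
      apply_mem_low O (cnot_below (by omega) ho) (by
        show w ≠ outWire s (k + 0)
        simp only [outWire]; omega) hψ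
    by_cases h : ancWire s j (coinNum s) ∈ a
    · have := ih (k + 1) (fun i hi => hw i (by simp [hi])) (by omega) _ hlow
      simp only [h, if_true] at this ⊢
      rw [this, run_cons]
    · have := ih (k + 1) (fun i hi => hw i (by simp [hi])) (by omega) ψ hψ
      simp only [h, if_false] at this ⊢
      rw [this]

end Flag

/-! ### The simulating circuit for fixed key and coins -/

section Mark

open Polynomial

variable {d m : ℕ}

theorem length_encode_pos (g : Gate) : 0 < g.encode.length := by
  cases g <;> simp [Gate.encode]

theorem lt_length_flatMap_encodeWire {ws : List ℕ} {i : ℕ} (h : i ∈ ws) :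
    i < (ws.flatMap encodeWire).length := by
  induction ws with
  | nil => simp at h
  | cons w ws ih =>
    rw [List.flatMap_cons, List.length_append, encodeWire, List.length_append,
      List.length_replicate, List.length_singleton]
    rcases List.mem_cons.1 h with rfl | h
    · omega
    · have := ih h; omega

/-- Wire numbers are written in unary, so a description is longer than every wire number in it. For
this reason the single parameter `s` bounds the wires, the arities and the number of gates. -/
theorem below_length_encode (g : Gate) : g.Below g.encode.length := by
  intro i hi
  cases g with
  | query ins outs =>
    simp only [Gate.wires, List.mem_append] at hi
    simp only [Gate.encode, encodeWires, List.length_cons, List.length_append]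
    rcases hi with hi | hi
    · have := lt_length_flatMap_encodeWire hi; omega
    · have := lt_length_flatMap_encodeWire hi; omega
  | _ =>
    simp only [Gate.wires, List.mem_cons, List.not_mem_nil, or_false] at hi
    simp only [Gate.encode, encodeWire, List.length_cons, List.length_append,
      List.length_replicate, List.length_nil]
    omega

theorem length_encode_le {gs : List Gate} {g : Gate} (h : g ∈ gs) :
    g.encode.length ≤ (gs.flatMap Gate.encode).length := by
  obtain ⟨l, l', rfl⟩ := List.append_of_mem h
  rw [List.flatMap_append, List.flatMap_cons, List.length_append, List.length_append]
  omega

theorem Circuit.length_flatMap_encode_le (C : Circuit) :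
    (C.gates.flatMap Gate.encode).length ≤ C.encode.length := by
  simp [Circuit.encode]

theorem Circuit.below (C : Circuit) : ∀ g ∈ C.gates, g.Below C.encode.length := fun g hg i hi =>
  ((below_length_encode g i hi).trans_le (length_encode_le hg)).trans_le
    C.length_flatMap_encode_le

open Classical in
/-- Copies the inputs of the queries at the positions in `P`. -/
def markGate (s : ℕ) (P : ℕ → Prop) (j : ℕ) : Gate → List Gate
  | .query ins outs => (if P j then copyCnots s ins else []) ++ [.query ins outs]
  | g => [g]

def markGates (s : ℕ) (P : ℕ → Prop) : ℕ → List Gate → List Gate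
  | _, [] => []
  | j, g :: gs => markGate s P j g ++ markGates s P (j + g.encode.length) gs

/-- All coins for the query at position `j` are in `b`. -/
def Fires (s : ℕ) (b : Finset ℕ) (j : ℕ) : Prop := ∀ l < coinNum s, coinWire s j l ∈ b

theorem copyCnots_below {s : ℕ} {ins : List ℕ} (hi : ∀ i ∈ ins, i < s) (hl : ins.length ≤ s) :
    ∀ g ∈ copyCnots s ins, g.Below (s + s) ∧ g.WellFormed d m := by
  intro g hg
  obtain ⟨i, h, rfl⟩ := List.mem_mapIdx.1 hg
  have h1 := hi _ (List.getElem_mem h)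
  refine ⟨cnot_below (by omega) (by simp only [outWire]; omega), ?_⟩
  show _ ≠ _
  simp only [outWire]; omega

/-- `b` consists of the coins that are set and of the ancillas left dirty by earlier queries; below
the ancillas it agrees with the initial coins `b₀`. The new ancillas are not cleaned either and join
`b`, while the low wires undergo the marked query. -/
theorem run_queryGates (O : BitString 0 → BitString 0) {s j : ℕ} (hj : j < s) {ins outs : List ℕ}
    (hw : (Gate.query ins outs).WellFormed d m) (hs : (Gate.query ins outs).Below s)
    {f : (ZMod 2)[X]} (hf : f.degree < (hashSteps s + hashDeg s : ℕ)) {b b₀ : Finset ℕ}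
    (hb : ∀ p < hashSteps s + hashDeg s, keyWire s p ∉ b) (hb' : ∀ i ∈ b, s + s ≤ i)
    (hb₀ : ∀ i < ancWire s 0 0, i ∈ b ↔ i ∈ b₀) (hfresh : ∀ i ∈ b, i < ancWire s j 0)
    {ψ : State} (hψ : ψ ∈ low (s + s)) :
    run O (queryGates s j ins outs) (shift (symmDiff (keySet s f) b) ψ) =
      shift (symmDiff (keySet s f) (symmDiff b (flagSet s j b (coinNum s))))
        (run (hashFun (hashDeg s) (hashPos s) f : BitString d → BitString m)
          (markGate s (Fires s b₀) j (.query ins outs)) ψ) := by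
  have hn' := List.nodup_append.1 hw.2.2
  have hi : ∀ i ∈ ins, i < s := fun i hi => hs i (by simp [Gate.wires, hi])
  have hds : ins.length ≤ s := length_le_of_below hn'.1 hi
  have hkf : ∀ i, s + (s + (hashSteps s + hashDeg s)) ≤ i → i ∉ keySet s f := fun i hi' h => by
    obtain ⟨p, hp, rfl⟩ := Finset.mem_image.1 h
    have h1 := coeff_eq_zero_of_degree_lt (n := p) (hf.trans_le (by
      simp only [keyWire] at hi'
      exact_mod_cast (by omega : hashSteps s + hashDeg s ≤ p)))
    exact (mem_support_iff.1 hp) h1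
  have hanc : ∀ j l, s + (s + (hashSteps s + hashDeg s)) ≤ ancWire s j l := fun j l => by
    simp only [ancWire, randLen]; omega
  have hflag_high : ∀ i ∈ flagSet s j b (coinNum s), s + (s + (hashSteps s + hashDeg s)) ≤ i := by
    intro i h
    obtain ⟨l, _, rfl⟩ := exists_of_mem_flagSet h
    exact hanc j l
  set F := flagSet s j b (coinNum s) with hF
  have h1 : run O (flagGates s j) (shift (symmDiff (keySet s f) b) ψ) =
      shift (symmDiff (keySet s f) (symmDiff b F)) ψ := by
    rw [← runₗ_apply, ← LinearMap.comp_apply]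
    refine eq_of_mem_low (fun S hS => ?_) hψ
    have hcoin : ∀ i, s + (s + (hashSteps s + hashDeg s)) ≤ i →
        (i ∈ symmDiff S (symmDiff (keySet s f) b) ↔ i ∈ b) := fun i hi' => by
      have e1 : i ∉ S := fun h => by have := hS i h; omega
      have e2 := hkf i hi'
      rw [Finset.mem_symmDiff, Finset.mem_symmDiff]; tauto
    have := maps_flagGates O hj (U := symmDiff S (symmDiff (keySet s f) b)) (fun l h => by
      rw [hcoin _ (hanc j l)] at h
      have := hfresh _ h
      simp only [ancWire] at this
      omega)
    rw [flagSet_congr (b' := b) (fun l _ => hcoin _ (by simp only [coinWire]; omega)), ← hF,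
      symmDiff_assoc, symmDiff_assoc] at this
    rw [LinearMap.comp_apply, runₗ_apply, shift_single, shift_single]
    exact this
  have ha : ∀ i ∈ symmDiff (keySet s f) (symmDiff b F), s + s ≤ i := by
    intro i h
    by_contra hlt
    have e1 : i ∉ keySet s f := notMem_keySet (by omega)
    have e2 : i ∉ b := fun h => hlt (hb' i h)
    have e3 : i ∉ F := fun h => by have := hflag_high i h; omega
    rw [Finset.mem_symmDiff, Finset.mem_symmDiff] at h; tauto
  have hflag : ancWire s j (coinNum s) ∈ symmDiff (keySet s f) (symmDiff b F) ↔
      Fires s b₀ j := by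
    have e1 := hkf _ (hanc j (coinNum s))
    have e2 : ancWire s j (coinNum s) ∉ b := fun h => by
      have := hfresh _ h
      simp only [ancWire] at this
      omega
    have e3 : ancWire s j (coinNum s) ∈ F ↔ Fires s b₀ j := by
      rw [hF, ancWire_mem_flagSet]
      simp only [le_refl, true_and, Fires]
      exact forall_congr' fun l => imp_congr_right fun hl => hb₀ _ (coinWire_lt hj hl)
    rw [Finset.mem_symmDiff, Finset.mem_symmDiff, ← e3]; tauto
  rw [queryGates, run_append, h1, run_append, run_copyGates O
    (hashFun (hashDeg s) (hashPos s) f : BitString d → BitString m) hi hds ha hψ]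
  have hlow : run (hashFun (hashDeg s) (hashPos s) f : BitString d → BitString m)
      (if ancWire s j (coinNum s) ∈ symmDiff (keySet s f) (symmDiff b F) then copyCnots s ins
        else []) ψ ∈ low (s + s) := by
    split_ifs
    · exact run_mem_low _ (fun g hg => (copyCnots_below (d := d) (m := m) hi hds g hg).1)
        (fun g hg => (copyCnots_below hi hds g hg).2) hψ
    · exact hψ
  rw [run_hashGates O hw hs hf (fun p hp h => ?_) (fun i h => ?_) hlow]
  · rw [markGate, run_append, run_cons, run_nil]
    by_cases h : Fires s b₀ j
    · rw [if_pos h, if_pos (hflag.2 h)]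
    · rw [if_neg h, if_neg (hflag.not.2 h)]
  · have e1 := hb p hp
    have e2 : keyWire s p ∉ F := fun h => by
      have := hflag_high _ h
      simp only [keyWire] at this
      omega
    rw [Finset.mem_symmDiff] at h; tauto
  · rcases Finset.mem_symmDiff.1 h with h | h
    · exact hb' i h.1
    · have := hflag_high _ h.1; omega

/-- The garbage `F` does not depend on `ψ`: for fixed key and coins it is a classical value on fresh
wires, so leaving it there does not disturb interference on the low wires. -/
theorem run_simGates (O : BitString 0 → BitString 0) {s : ℕ} {f : (ZMod 2)[X]}
    (hf : f.degree < (hashSteps s + hashDeg s : ℕ)) (b₀ : Finset ℕ) (gs : List Gate)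
    (hw : ∀ g ∈ gs, g.WellFormed d m) (hs : ∀ g ∈ gs, g.Below s) (j : ℕ)
    (hj : j + (gs.flatMap Gate.encode).length ≤ s) (b : Finset ℕ)
    (hb : ∀ p < hashSteps s + hashDeg s, keyWire s p ∉ b) (hb' : ∀ i ∈ b, s + s ≤ i)
    (hb₀ : ∀ i < ancWire s 0 0, i ∈ b ↔ i ∈ b₀) (hfresh : ∀ i ∈ b, i < ancWire s j 0) :
    ∃ F : Finset ℕ, (∀ i ∈ F, ancWire s 0 0 ≤ i) ∧ ∀ ψ ∈ low (s + s),
      run O (simGates s j gs) (shift (symmDiff (keySet s f) b) ψ) =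
        shift (symmDiff (keySet s f) (symmDiff b F))
          (run (hashFun (hashDeg s) (hashPos s) f : BitString d → BitString m)
            (markGates s (Fires s b₀) j gs) ψ) := by
  induction gs generalizing j b with
  | nil => exact ⟨∅, by simp, fun ψ _ => by simp [simGates, markGates, run_nil, ← Finset.bot_eq_empty]⟩
  | cons g gs ih =>
    rw [List.flatMap_cons, List.length_append] at hj
    have hpos := length_encode_pos g
    have hg := hw g (by simp)
    have hgs := hs g (by simp)
    have hmono : ancWire s j 0 ≤ ancWire s (j + g.encode.length) 0 := by
      have : j * hashDeg s ≤ (j + g.encode.length) * hashDeg s := Nat.mul_le_mul_right _ (by omega)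
      simp only [ancWire]; omega
    have key : ∃ F : Finset ℕ, (∀ i ∈ F, ancWire s 0 0 ≤ i ∧ i < ancWire s (j + g.encode.length) 0) ∧
        ∀ ψ ∈ low (s + s), run O (simGate s j g) (shift (symmDiff (keySet s f) b) ψ) =
        shift (symmDiff (keySet s f) (symmDiff b F))
          (run (hashFun (hashDeg s) (hashPos s) f : BitString d → BitString m)
            (markGate s (Fires s b₀) j g) ψ) ∧
          run (hashFun (hashDeg s) (hashPos s) f : BitString d → BitString m)
            (markGate s (Fires s b₀) j g) ψ ∈ low (s + s) := by
      have el : g.IsElementary → simGate s j g = [g] → markGate s (Fires s b₀) j g = [g] →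
          ∃ F : Finset ℕ, (∀ i ∈ F, ancWire s 0 0 ≤ i ∧ i < ancWire s (j + g.encode.length) 0) ∧
        ∀ ψ ∈ low (s + s), run O (simGate s j g) (shift (symmDiff (keySet s f) b) ψ) =
        shift (symmDiff (keySet s f) (symmDiff b F))
          (run (hashFun (hashDeg s) (hashPos s) f : BitString d → BitString m)
            (markGate s (Fires s b₀) j g) ψ) ∧
          run (hashFun (hashDeg s) (hashPos s) f : BitString d → BitString m)
            (markGate s (Fires s b₀) j g) ψ ∈ low (s + s) := by
        intro he h1 h2
        refine ⟨∅, by simp, fun ψ hψ => ?_⟩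
        rw [h1, h2, run_cons, run_nil, run_cons, run_nil, ← Finset.bot_eq_empty, symmDiff_bot]
        refine ⟨apply_shift _ _ he (fun i hi h => ?_) ψ, apply_mem_low _ (fun i hi =>
          (hgs i hi).trans_le (by omega)) hg hψ⟩
        have := hgs i hi
        have e1 : i ∉ keySet s f := notMem_keySet (by omega)
        have e2 : i ∉ b := fun h => by have := hb' i h; omega
        rw [Finset.mem_symmDiff] at h; tauto
      cases g with
      | query ins outs =>
        refine ⟨flagSet s j b (coinNum s), fun i hi => ?_, fun ψ hψ => ⟨?_, ?_⟩⟩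
        · obtain ⟨l, hl, rfl⟩ := exists_of_mem_flagSet hi
          refine ⟨ancWire_zero_le s j l, ?_⟩
          have h1 := coinNum_lt_hashDeg (s := s) (by omega)
          have h2 : (j + 1) * hashDeg s ≤ (j + (Gate.query ins outs).encode.length) * hashDeg s :=
            Nat.mul_le_mul_right _ (by omega)
          rw [Nat.succ_mul] at h2
          simp only [ancWire]; omega
        · exact run_queryGates O (by omega) hg hgs hf hb hb' hb₀ hfresh hψ
        · have hn' := List.nodup_append.1 hg.2.2
          have hi : ∀ i ∈ ins, i < s := fun i hi => hgs i (by simp [Gate.wires, hi])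
          have hds : ins.length ≤ s := length_le_of_below hn'.1 hi
          have hall : ∀ g' ∈ markGate s (Fires s b₀) j (.query ins outs),
              g'.Below (s + s) ∧ g'.WellFormed d m := by
            intro g' hg'
            rw [markGate, List.mem_append] at hg'
            rcases hg' with hg' | hg'
            · split_ifs at hg'
              · exact copyCnots_below hi hds g' hg'
              · simp at hg'
            · rw [List.mem_singleton] at hg'
              subst hg'
              exact ⟨fun i hi => (hgs i hi).trans_le (by omega), hg⟩
          exact run_mem_low _ (fun g' h => (hall g' h).1) (fun g' h => (hall g' h).2) hψ
      | _ => exact el trivial rfl rfl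
    obtain ⟨F, hF, h1⟩ := key
    obtain ⟨F', hF', h2⟩ := ih (fun g h => hw g (by simp [h])) (fun g h => hs g (by simp [h]))
      (j + g.encode.length) (by omega) (symmDiff b F) (fun p hp h => by
        have e1 := hb p hp
        have e2 : keyWire s p ∉ F := fun h => by
          have := (hF _ h).1
          simp only [keyWire, ancWire, randLen] at this
          omega
        rw [Finset.mem_symmDiff] at h; tauto) (fun i h => by
        rcases Finset.mem_symmDiff.1 h with h | h
        · exact hb' i h.1
        · have := (hF i h.1).1
          simp only [ancWire] at this
          omega) (fun i hi => by
        have : i ∉ F := fun h => by have := (hF i h).1; omega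
        rw [← hb₀ i hi, Finset.mem_symmDiff]; tauto) (fun i h => by
        rcases Finset.mem_symmDiff.1 h with h | h
        · exact (hfresh i h.1).trans_le hmono
        · exact (hF i h.1).2)
    refine ⟨symmDiff F F', fun i h => ?_, fun ψ hψ => ?_⟩
    · rcases Finset.mem_symmDiff.1 h with h | h
      · exact (hF i h.1).1
      · exact hF' i h.1
    · rw [simGates, run_append, (h1 ψ hψ).1, h2 _ (h1 ψ hψ).2, markGates, run_append,
        symmDiff_assoc]

end Mark

/-! ### From a superposition of keys and coins to an average -/

section Preamble

open Polynomial

variable {d m : ℕ}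

theorem run_hadamards (O : BitString d → BitString m) (s n : ℕ) :
    run O ((List.range n).map fun p => .hadamard (keyWire s p)) ketZero =
      ((1 / Real.sqrt 2 : ℝ) : ℂ) ^ n •
        ∑ T ∈ ((Finset.range n).image (keyWire s)).powerset, Finsupp.single T 1 := by
  induction n with
  | zero => simp [run_nil, ketZero]
  | succ n ih =>
    have hn : keyWire s n ∉ (Finset.range n).image (keyWire s) := by
      rw [(keyWire_injective s).mem_finset_image]; simp
    rw [List.range_succ, List.map_append, run_append, ih, List.map_singleton, run_cons, run_nil,
      Finset.range_add_one, Finset.image_insert, Finset.sum_powerset_insert hn, map_smul, map_sum,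
      ← Finset.sum_add_distrib, pow_succ, mul_smul]
    congr 1
    rw [Finset.smul_sum]
    refine Finset.sum_congr rfl fun T hT => ?_
    have hT' : keyWire s n ∉ T := fun h => hn (Finset.mem_powerset.1 hT h)
    rw [apply_single, one_smul, Gate.onBasis, Finset.erase_eq_of_notMem hT', if_neg hT']

/-- The wires of the coins. -/
def coinSet (s : ℕ) : Finset ℕ :=
  (Finset.Ico (hashSteps s + hashDeg s) (randLen s)).image (keyWire s)

/-- The wires of the key and of the coins. -/
def randSet (s : ℕ) : Finset ℕ := (Finset.range (randLen s)).image (keyWire s)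

theorem coeff_keyPoly {L : ℕ} (v : Fin L → ZMod 2) (p : ℕ) :
    (keyPoly v).coeff p = if h : p < L then v ⟨p, h⟩ else 0 := by
  split_ifs with h
  · exact congrFun ((degreeLTEquiv (ZMod 2) L).apply_symm_apply v) ⟨p, h⟩
  · exact coeff_eq_zero_of_degree_lt ((mem_degreeLT.1 ((degreeLTEquiv (ZMod 2) L).symm v).2).trans_le
      (by exact_mod_cast (by omega : L ≤ p)))

theorem degree_keyPoly_lt {L : ℕ} (v : Fin L → ZMod 2) : (keyPoly v).degree < L :=
  mem_degreeLT.1 ((degreeLTEquiv (ZMod 2) L).symm v).2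

theorem keyWire_mem_coinSet {s p : ℕ} :
    keyWire s p ∈ coinSet s ↔ hashSteps s + hashDeg s ≤ p ∧ p < randLen s := by
  rw [coinSet, (keyWire_injective s).mem_finset_image, Finset.mem_Ico]

theorem keyWire_mem_randSet {s p : ℕ} : keyWire s p ∈ randSet s ↔ p < randLen s := by
  rw [randSet, (keyWire_injective s).mem_finset_image, Finset.mem_range]

theorem exists_keyWire_of_mem_randSet {s i : ℕ} (h : i ∈ randSet s) :
    ∃ p < randLen s, keyWire s p = i := by
  obtain ⟨p, hp, rfl⟩ := Finset.mem_image.1 h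
  exact ⟨p, Finset.mem_range.1 hp, rfl⟩

theorem coinSet_subset (s : ℕ) : coinSet s ⊆ randSet s :=
  Finset.image_subset_image fun _ h => Finset.mem_range.2 (Finset.mem_Ico.1 h).2

theorem keySet_keyPoly_subset (s : ℕ) (v : Fin (hashSteps s + hashDeg s) → ZMod 2) :
    keySet s (keyPoly v) ⊆ randSet s := by
  intro i hi
  obtain ⟨p, hp, rfl⟩ := Finset.mem_image.1 hi
  rw [mem_support_iff, coeff_keyPoly] at hp
  rw [keyWire_mem_randSet]
  split_ifs at hp with h
  · simp only [randLen]; omega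
  · exact absurd rfl hp

theorem keyWire_mem_symmDiff {s p : ℕ} {v : Fin (hashSteps s + hashDeg s) → ZMod 2}
    {c : Finset ℕ} (hc : c ⊆ coinSet s) : keyWire s p ∈ symmDiff (keySet s (keyPoly v)) c ↔
      (∃ h : p < hashSteps s + hashDeg s, v ⟨p, h⟩ ≠ 0) ∨ keyWire s p ∈ c := by
  have h1 : keyWire s p ∈ c → hashSteps s + hashDeg s ≤ p := fun h =>
    (keyWire_mem_coinSet.1 (hc h)).1
  rw [Finset.mem_symmDiff, keyWire_mem_keySet, coeff_keyPoly]
  by_cases h : p < hashSteps s + hashDeg s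
  · have h2 : keyWire s p ∉ c := fun h' => by have := h1 h'; omega
    simp [h, h2]
  · simp [h]

/-- The values of the key and of the coins are pairs. -/
theorem sum_powerset_randSet {M : Type*} [AddCommMonoid M] (s : ℕ) (F : Finset ℕ → M) :
    ∑ T ∈ (randSet s).powerset, F T =
      ∑ q ∈ (Finset.univ : Finset (Fin (hashSteps s + hashDeg s) → ZMod 2)) ×ˢ
        (coinSet s).powerset, F (symmDiff (keySet s (keyPoly q.1)) q.2) := by
  classical
  symm
  refine Finset.sum_nbij' (fun q => symmDiff (keySet s (keyPoly q.1)) q.2)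
    (fun T => (fun i => if keyWire s i ∈ T then 1 else 0, T ∩ coinSet s)) ?_ ?_ ?_ ?_ ?_
  · rintro ⟨v, c⟩ h
    have hc : c ⊆ coinSet s := Finset.mem_powerset.1 (Finset.mem_product.1 h).2
    rw [Finset.mem_powerset]
    intro i hi
    rcases Finset.mem_symmDiff.1 hi with h | h
    · exact keySet_keyPoly_subset s v h.1
    · exact coinSet_subset s (hc h.1)
  · intro T hT
    simp [Finset.inter_subset_right]
  · rintro ⟨v, c⟩ h
    have hc : c ⊆ coinSet s := Finset.mem_powerset.1 (Finset.mem_product.1 h).2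
    refine Prod.ext ?_ ?_
    · funext i
      have h2 : keyWire s i ∉ c := fun h' => by
        have := (keyWire_mem_coinSet.1 (hc h')).1
        have := i.2
        omega
      have h3 := keyWire_mem_symmDiff (s := s) (p := i) (v := v) hc
      simp only [h2, or_false, i.2, exists_true_left, Fin.eta] at h3
      simp only [h3]
      generalize v i = z
      revert z; decide
    · ext i
      rw [Finset.mem_inter]
      constructor
      · rintro ⟨h1, h2⟩
        obtain ⟨p, hp, rfl⟩ := exists_keyWire_of_mem_randSet (coinSet_subset s h2)
        rcases (keyWire_mem_symmDiff hc).1 h1 with ⟨h3, _⟩ | h3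
        · have := (keyWire_mem_coinSet.1 h2).1
          omega
        · exact h3
      · intro h1
        obtain ⟨p, hp, rfl⟩ := exists_keyWire_of_mem_randSet (coinSet_subset s (hc h1))
        exact ⟨(keyWire_mem_symmDiff hc).2 (.inr h1), hc h1⟩
  · intro T hT
    rw [Finset.mem_powerset] at hT
    ext i
    by_cases hi : i ∈ randSet s
    · obtain ⟨p, hp, rfl⟩ := exists_keyWire_of_mem_randSet hi
      rw [keyWire_mem_symmDiff Finset.inter_subset_right, Finset.mem_inter, keyWire_mem_coinSet]
      by_cases h : keyWire s p ∈ T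
      · simp only [h, true_and, if_true, ne_eq, one_ne_zero, not_false_eq_true, exists_prop,
          and_true, iff_true]
        omega
      · simp [h]
    · have h1 : i ∉ T := fun h => hi (hT h)
      have h2 : i ∉ keySet s (keyPoly fun i : Fin (hashSteps s + hashDeg s) =>
          if keyWire s i ∈ T then 1 else 0) := fun h => hi (keySet_keyPoly_subset s _ h)
      simp [Finset.mem_symmDiff, h1, h2]
  · intro q _; rfl

theorem notMem_symmDiff {i : ℕ} {A B : Finset ℕ} (hA : i ∉ A) (hB : i ∉ B) :
    i ∉ symmDiff A B := by
  simp [Finset.mem_symmDiff, hA, hB]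

theorem mem_symmDiff_iff_left {i : ℕ} {A B : Finset ℕ} (hB : i ∉ B) :
    i ∈ symmDiff A B ↔ i ∈ A := by
  simp [Finset.mem_symmDiff, hB]

theorem mem_symmDiff_iff_right {i : ℕ} {A B : Finset ℕ} (hA : i ∉ A) :
    i ∈ symmDiff A B ↔ i ∈ B := by
  simp [Finset.mem_symmDiff, hA]

theorem eq_of_symmDiff_keySet_eq {s : ℕ}
    {q q' : (Fin (hashSteps s + hashDeg s) → ZMod 2) × Finset ℕ} (hc : q.2 ⊆ coinSet s)
    (hc' : q'.2 ⊆ coinSet s) (heq : symmDiff (keySet s (keyPoly q.1)) q.2 =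
      symmDiff (keySet s (keyPoly q'.1)) q'.2) : q = q' := by
  have hcoin : ∀ c ⊆ coinSet s, ∀ p, keyWire s p ∈ c → hashSteps s + hashDeg s ≤ p :=
    fun c hc p hp => (keyWire_mem_coinSet.1 (hc hp)).1
  have hmem : ∀ p, ((∃ h : p < hashSteps s + hashDeg s, q.1 ⟨p, h⟩ ≠ 0) ∨ keyWire s p ∈ q.2) ↔
      ((∃ h : p < hashSteps s + hashDeg s, q'.1 ⟨p, h⟩ ≠ 0) ∨ keyWire s p ∈ q'.2) := fun p => by
    rw [← keyWire_mem_symmDiff hc, heq, keyWire_mem_symmDiff hc']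
  refine Prod.ext ?_ ?_
  · funext i
    have h := hmem i
    have h2 : ∀ c ⊆ coinSet s, keyWire s i ∉ c := fun c hc h' => by
      have := hcoin c hc _ h'
      have := i.2
      omega
    simp only [h2 _ hc, h2 _ hc', or_false, i.2, exists_true_left, Fin.eta] at h
    revert h
    generalize q.1 i = z
    generalize q'.1 i = z'
    revert z z'; decide
  · ext i
    constructor
    · intro hi
      obtain ⟨p, _, rfl⟩ := exists_keyWire_of_mem_randSet (coinSet_subset s (hc hi))
      rcases (hmem p).1 (.inr hi) with ⟨h2, _⟩ | h2
      · have := hcoin _ hc p hi; omega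
      · exact h2
    · intro hi
      obtain ⟨p, _, rfl⟩ := exists_keyWire_of_mem_randSet (coinSet_subset s (hc' hi))
      rcases (hmem p).2 (.inr hi) with ⟨h2, _⟩ | h2
      · have := hcoin _ hc' p hi; omega
      · exact h2

theorem project_smul (ws : List ℕ) (v : List Bool) (c : ℂ) (ψ : State) :
    project ws v (c • ψ) = c • project ws v ψ := Finsupp.filter_smul

theorem project_sum {ι : Type*} (ws : List ℕ) (v : List Bool) (K : Finset ι) (f : ι → State) :
    project ws v (∑ i ∈ K, f i) = ∑ i ∈ K, project ws v (f i) :=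
  map_sum (Finsupp.filterAddHom fun s => readWires ws s = v) f K

theorem shift_ketZero (a : Finset ℕ) : shift a ketZero = Finsupp.single a 1 := by
  rw [ketZero, shift_single, ← Finset.bot_eq_empty, bot_symmDiff]

theorem ketZero_mem_low (n : ℕ) : ketZero ∈ low n := single_mem_low (by simp) 1

theorem markGates_below {s : ℕ} {gs : List Gate} (P : ℕ → Prop) (j : ℕ)
    (hw : ∀ g ∈ gs, g.WellFormed d m) (hs : ∀ g ∈ gs, g.Below s) :
    ∀ g ∈ markGates s P j gs, g.Below (s + s) ∧ g.WellFormed d m := by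
  induction gs generalizing j with
  | nil => simp [markGates]
  | cons g gs ih =>
    intro g' hg'
    rw [markGates, List.mem_append] at hg'
    rcases hg' with hg' | hg'
    · have hg := hw g (by simp)
      have hgs := hs g (by simp)
      have hself : g.Below (s + s) ∧ g.WellFormed d m :=
        ⟨fun i hi => (hgs i hi).trans_le (by omega), hg⟩
      cases g with
      | query ins outs =>
        have hn' := List.nodup_append.1 hg.2.2
        have hi : ∀ i ∈ ins, i < s := fun i hi => hgs i (by simp [Gate.wires, hi])
        rw [markGate, List.mem_append] at hg'
        rcases hg' with hg' | hg'
        · split_ifs at hg'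
          · exact copyCnots_below hi (length_le_of_below hn'.1 hi) g' hg'
          · simp at hg'
        · rw [List.mem_singleton] at hg'
          exact hg' ▸ hself
      | _ =>
        rw [markGate, List.mem_singleton] at hg'
        · exact hg' ▸ hself
        · simp
    · exact ih _ (fun g h => hw g (by simp [h])) (fun g h => hs g (by simp [h])) g' hg'

/-- The Hadamard gates produce a uniform superposition of the keys and coins. In each branch the
circuit acts as the simulation with that key and those coins, and the wires in `randSet` show the
same value at the end. Distinct branches therefore have disjoint supports, and the output
probability is the average over the branches. -/
theorem outputProb_simCircuit (O : BitString 0 → BitString 0) {C : Circuit}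
    (hC : C.WellFormed d m) (w : List Bool)
    (ho : ∀ i ∈ (simCircuit C).out, i < C.encode.length + C.encode.length) :
    outputProb O (simCircuit C) w = (1 / 2) ^ randLen C.encode.length *
      ∑ v : Fin (hashSteps C.encode.length + hashDeg C.encode.length) → ZMod 2,
        ∑ c ∈ (coinSet C.encode.length).powerset, normSq (project (simCircuit C).out w
          (run (hashFun (hashDeg C.encode.length) (hashPos C.encode.length) (keyPoly v) :
            BitString d → BitString m)
            (markGates C.encode.length (Fires C.encode.length c) 0 C.gates) ketZero)) := by
  set s := C.encode.length with hs
  set K := (Finset.univ : Finset (Fin (hashSteps s + hashDeg s) → ZMod 2)) ×ˢ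
    (coinSet s).powerset with hK
  set φ : (Fin (hashSteps s + hashDeg s) → ZMod 2) × Finset ℕ → State := fun q =>
    run (hashFun (hashDeg s) (hashPos s) (keyPoly q.1) : BitString d → BitString m)
      (markGates s (Fires s q.2) 0 C.gates) ketZero with hφ
  have hφlow : ∀ q, φ q ∈ low (s + s) := fun q =>
    have h := markGates_below (Fires s q.2) 0 hC C.below
    run_mem_low _ (fun g hg => (h g hg).1) (fun g hg => (h g hg).2) (ketZero_mem_low _)
  have hcoin : ∀ q ∈ K, ∀ i ∈ q.2, ∃ p, hashSteps s + hashDeg s ≤ p ∧ p < randLen s ∧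
      keyWire s p = i := fun q hq i hi => by
    have h1 := Finset.mem_powerset.1 (Finset.mem_product.1 hq).2 hi
    obtain ⟨p, hp, rfl⟩ := exists_keyWire_of_mem_randSet (coinSet_subset s h1)
    exact ⟨p, (keyWire_mem_coinSet.1 h1).1, hp, rfl⟩
  have hsim : ∀ q ∈ K, ∃ F : Finset ℕ, (∀ i ∈ F, ancWire s 0 0 ≤ i) ∧
      run O (simGates s 0 C.gates) (Finsupp.single (symmDiff (keySet s (keyPoly q.1)) q.2) 1) =
        shift (symmDiff (keySet s (keyPoly q.1)) (symmDiff q.2 F)) (φ q) := by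
    intro q hq
    obtain ⟨F, hF, h⟩ := run_simGates O (degree_keyPoly_lt q.1) q.2 C.gates hC C.below 0
      (by rw [Nat.zero_add]; exact C.length_flatMap_encode_le) q.2
      (fun p hp h => by
        obtain ⟨p', h1, _, h2⟩ := hcoin q hq _ h
        have := keyWire_injective s h2
        omega)
      (fun i hi => by
        obtain ⟨p', _, _, rfl⟩ := hcoin q hq _ hi
        simp only [keyWire]; omega)
      (fun i _ => Iff.rfl)
      (fun i hi => by
        obtain ⟨p', _, _, rfl⟩ := hcoin q hq _ hi
        simp only [keyWire, ancWire]; omega)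
    refine ⟨F, hF, ?_⟩
    rw [← shift_ketZero]
    exact h _ (ketZero_mem_low _)
  choose! F hF hrun using hsim
  set a : (Fin (hashSteps s + hashDeg s) → ZMod 2) × Finset ℕ → Finset ℕ := fun q =>
    symmDiff (keySet s (keyPoly q.1)) (symmDiff q.2 (F q)) with ha
  have hfinal : run O (simCircuit C).gates ketZero = ((1 / Real.sqrt 2 : ℝ) : ℂ) ^ randLen s •
      ∑ q ∈ K, shift (a q) (φ q) := by
    rw [simCircuit, run_append, run_hadamards, ← hs, ← randSet, sum_powerset_randSet,
      ← runₗ_apply, map_smul, map_sum]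
    congr 1
    refine Finset.sum_congr rfl fun q hq => ?_
    rw [runₗ_apply, hrun q hq]
  have hahigh : ∀ q ∈ K, ∀ i < s + s, i ∉ a q := by
    intro q hq i hi h
    have e1 : i ∉ keySet s (keyPoly q.1) := notMem_keySet hi
    have e2 : i ∉ q.2 := fun h => by
      obtain ⟨p', _, _, rfl⟩ := hcoin q hq _ h
      simp only [keyWire] at hi; omega
    have e3 : i ∉ F q := fun h => by
      have := hF q hq i h
      simp only [ancWire] at this; omega
    exact notMem_symmDiff e1 (notMem_symmDiff e2 e3) h
  have hakey : ∀ q ∈ K, ∀ i ∈ randSet s, i ∈ a q ↔ i ∈ symmDiff (keySet s (keyPoly q.1)) q.2 := by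
    intro q hq i hi
    obtain ⟨p, hp, rfl⟩ := exists_keyWire_of_mem_randSet hi
    have e3 : keyWire s p ∉ F q := fun h => by
      have := hF q hq _ h
      simp only [ancWire, keyWire] at this; omega
    rw [ha]
    simp only
    rw [← symmDiff_assoc, mem_symmDiff_iff_left e3]
  rw [outputProb, hfinal, project_smul, normSq_smul, project_sum, normSq_sum_of_disjoint]
  · have e1 : ‖((1 / Real.sqrt 2 : ℝ) : ℂ) ^ randLen s‖ ^ 2 = (1 / 2) ^ randLen s := by
      rw [norm_pow, Complex.norm_real, Real.norm_eq_abs, pow_right_comm, sq_abs, div_pow,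
        Real.sq_sqrt (by norm_num), one_pow]
    rw [e1, hK, Finset.sum_product]
    refine congrArg (fun x : ℝ => (1 / 2) ^ randLen s * x) ?_
    refine Finset.sum_congr rfl fun v _ => Finset.sum_congr rfl fun c hc => ?_
    rw [project_shift, normSq_shift]
    intro i hi
    exact hahigh (v, c) (Finset.mem_product.2 ⟨Finset.mem_univ _, hc⟩) i (ho i hi)
  · intro q hq q' hq' hne
    rw [project_shift fun i hi => hahigh q hq i (ho i hi),
      project_shift fun i hi => hahigh q' hq' i (ho i hi), Finset.disjoint_left]
    intro T hT hT'
    rw [support_shift, Finset.mem_image] at hT hT'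
    obtain ⟨S, hS, rfl⟩ := hT
    obtain ⟨S', hS', hSS'⟩ := hT'
    have hSlow : ∀ i ∈ S, i < s + s := hφlow q (support_project_subset _ _ _ hS)
    have hSlow' : ∀ i ∈ S', i < s + s := hφlow q' (support_project_subset _ _ _ hS')
    -- A basis state common to two branches would show both values on the wires in `randSet`, where
    -- neither the low wires nor the garbage interfere.
    have heq : symmDiff (keySet s (keyPoly q.1)) q.2 =
        symmDiff (keySet s (keyPoly q'.1)) q'.2 := by
      have hsub : ∀ q ∈ K, symmDiff (keySet s (keyPoly q.1)) q.2 ⊆ randSet s := by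
        intro q hq i hi
        rcases Finset.mem_symmDiff.1 hi with h | h
        · exact keySet_keyPoly_subset s _ h.1
        · exact coinSet_subset s (Finset.mem_powerset.1 (Finset.mem_product.1 hq).2 h.1)
      have hiff : ∀ i ∈ randSet s, i ∈ symmDiff (keySet s (keyPoly q.1)) q.2 ↔
          i ∈ symmDiff (keySet s (keyPoly q'.1)) q'.2 := by
        intro i hi
        rw [← hakey q hq i hi, ← hakey q' hq' i hi]
        obtain ⟨p, hp, rfl⟩ := exists_keyWire_of_mem_randSet hi
        have h1 : keyWire s p ∉ S := fun h => by
          have := hSlow _ h; simp only [keyWire] at this; omega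
        have h2 : keyWire s p ∉ S' := fun h => by
          have := hSlow' _ h; simp only [keyWire] at this; omega
        have h3 := Finset.ext_iff.1 hSS' (keyWire s p)
        rw [mem_symmDiff_iff_right h1, mem_symmDiff_iff_right h2] at h3
        exact h3.symm
      ext i
      exact ⟨fun h => (hiff i (hsub q hq h)).1 h, fun h => (hiff i (hsub q' hq' h)).2 h⟩
    exact hne (eq_of_symmDiff_keySet_eq (Finset.mem_powerset.1 (Finset.mem_product.1 hq).2)
      (Finset.mem_powerset.1 (Finset.mem_product.1 hq').2) heq)

end Preamble

/-! ### Measuring the input of one query -/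

section Measure

variable {d m : ℕ}

/-- Measurement with a given outcome, as a linear map. -/
def projectₗ (ws : List ℕ) (v : List Bool) : State →ₗ[ℂ] State where
  toFun := project ws v
  map_add' _ _ := Finsupp.filter_add
  map_smul' c ψ := project_smul ws v c ψ

theorem projectₗ_apply (ws : List ℕ) (v : List Bool) (ψ : State) :
    projectₗ ws v ψ = project ws v ψ := rfl

theorem project_single (ws : List ℕ) (v : List Bool) (S : Finset ℕ) (c : ℂ) :
    project ws v (Finsupp.single S c) = if readWires ws S = v then Finsupp.single S c else 0 := by
  rw [project]
  split_ifs with h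
  · exact Finsupp.filter_single_of_pos _ h
  · exact Finsupp.filter_single_of_neg _ h

theorem readWires_congr {ws : List ℕ} {S T : Finset ℕ} (h : ∀ i ∈ ws, i ∈ S ↔ i ∈ T) :
    readWires ws S = readWires ws T :=
  List.map_congr_left fun i hi => by rw [decide_eq_decide]; exact h i hi

/-- A gate commutes with a measurement of other wires. -/
theorem project_apply {g : Gate} (O : BitString d → BitString m) (hg : g.WellFormed d m)
    {ws : List ℕ} (h : ∀ i ∈ ws, i ∉ g.wires) (v : List Bool) (ψ : State) :
    project ws v (g.apply O ψ) = g.apply O (project ws v ψ) := by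
  suffices H : projectₗ ws v ∘ₗ g.apply O = g.apply O ∘ₗ projectₗ ws v from
    LinearMap.congr_fun H ψ
  refine Finsupp.lhom_ext fun S c => ?_
  rw [LinearMap.comp_apply, LinearMap.comp_apply, apply_single, projectₗ_apply, projectₗ_apply,
    project_smul, project_single]
  have key : ∀ T : Finset ℕ, (∀ i, i ∉ g.wires → (i ∈ T ↔ i ∈ S)) → ∀ c : ℂ,
      project ws v (Finsupp.single T c) =
        if readWires ws S = v then Finsupp.single T c else 0 := fun T hT c => by
    rw [project_single, readWires_congr fun i hi => hT i (h i hi)]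
  have hsd : ∀ k ∈ g.wires, ∀ i, i ∉ g.wires → (i ∈ symmDiff S {k} ↔ i ∈ S) := fun k hk i hi =>
    mem_symmDiff_iff_left fun h => hi (Finset.mem_singleton.1 h ▸ hk)
  have main : project ws v (g.onBasis O S) = if readWires ws S = v then g.onBasis O S else 0 := by
    cases g with
    | hadamard i =>
      have h0 : ∀ k, k ∉ (Gate.hadamard i).wires → k ≠ i := fun k hk e => hk (by simp [Gate.wires, e])
      simp only [Gate.onBasis]
      rw [project_smul, ← projectₗ_apply, map_add, projectₗ_apply, projectₗ_apply,
        key _ fun k hk => by simp [h0 k hk], key _ fun k hk => by simp [h0 k hk]]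
      split_ifs <;> simp
    | phaseT i => exact key _ (fun _ _ => Iff.rfl) _
    | pauliX i => exact key _ (hsd i (by simp [Gate.wires])) _
    | cnot i j =>
      refine key _ ?_ _
      split_ifs
      · exact hsd j (by simp [Gate.wires])
      · exact fun _ _ => Iff.rfl
    | toffoli i j k =>
      refine key _ ?_ _
      split_ifs
      · exact hsd k (by simp [Gate.wires])
      · exact fun _ _ => Iff.rfl
    | query ins outs =>
      exact key _ (fun i hi => mem_symmDiff_iff_left fun h' =>
        hi (by simp [Gate.wires, mem_of_mem_onesOf hg.2.1 h'])) _
  rw [main]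
  split_ifs
  · rw [apply_single]
  · simp

theorem project_run {gs : List Gate} (O : BitString d → BitString m)
    (hg : ∀ g ∈ gs, g.WellFormed d m) {ws : List ℕ} (h : ∀ g ∈ gs, ∀ i ∈ ws, i ∉ g.wires)
    (v : List Bool) (ψ : State) : project ws v (run O gs ψ) = run O gs (project ws v ψ) := by
  induction gs generalizing ψ with
  | nil => rfl
  | cons g gs ih =>
    rw [run_cons, run_cons, ih (fun g h => hg g (by simp [h])) (fun g h' => h g (by simp [h'])),
      project_apply O (hg g (by simp)) (h g (by simp))]

/-- Measuring the copies of some wires amounts to measuring these wires. -/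
theorem project_run_copyCnots (O : BitString d → BitString m) {s k : ℕ} {ins : List ℕ}
    (hi : ∀ i ∈ ins, i < s) (w : List Bool) {ψ : State} (hψ : ψ ∈ low s) :
    project ((List.range (ins.length - k)).map fun i => outWire s (k + i)) w
        (run O (copyCnots s ins) ψ) =
      run O (copyCnots s ins) (project (ins.drop k) w ψ) := by
  rw [← runₗ_apply, ← runₗ_apply, ← projectₗ_apply, ← projectₗ_apply, ← LinearMap.comp_apply,
    ← LinearMap.comp_apply]
  refine eq_of_mem_low (fun S hS => ?_) hψ
  set l : List (ℕ × ℕ) := ins.mapIdx fun i w => (w, outWire s i) with hl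
  have e1 : copyCnots s ins = l.map fun q => .cnot q.1 q.2 := by
    rw [hl, copyCnots]; simp [List.mapIdx_eq_zipIdx_map]
  have hmem : ∀ q, q ∈ l ↔ ∃ (i : ℕ) (h : i < ins.length), (ins[i], outWire s i) = q := fun q => by
    rw [hl, List.mem_mapIdx]
  have hmaps := maps_cnots (O := O) l (by
      have : l.map Prod.snd = (List.range ins.length).map (outWire s) := by
        refine List.ext_getElem (by simp [hl]) fun i h1 h2 => by simp [hl]
      rw [this]
      exact List.nodup_range.map fun a b h => by simpa [outWire] using h)
    (fun q hq q' hq' => by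
      obtain ⟨i, h, rfl⟩ := (hmem q).1 hq
      obtain ⟨i', h', rfl⟩ := (hmem q').1 hq'
      have := hi _ (List.getElem_mem h)
      simp only [outWire]; omega) S
  rw [← e1] at hmaps
  set T := ((l.filter fun q => q.1 ∈ S).map Prod.snd).toFinset with hT
  have hread : readWires ((List.range (ins.length - k)).map fun i => outWire s (k + i))
      (symmDiff S T) = readWires (ins.drop k) S := by
    refine List.ext_getElem (by simp [readWires]) fun i h1 h2 => ?_
    simp only [readWires, List.length_map, List.length_range] at h1
    simp only [readWires, List.getElem_map, List.getElem_range, List.getElem_drop,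
      decide_eq_decide]
    have h3 : outWire s (k + i) ∉ S := fun h => by
      have := hS _ h; simp only [outWire] at this; omega
    rw [mem_symmDiff_iff_right h3, hT]
    simp only [List.mem_toFinset, List.mem_map, List.mem_filter, decide_eq_true_eq, hmem]
    constructor
    · rintro ⟨_, ⟨⟨i', h', rfl⟩, h4⟩, h5⟩
      have : i' = k + i := by simp only [outWire] at h5; omega
      subst this
      exact h4
    · intro h
      exact ⟨_, ⟨⟨k + i, by omega, rfl⟩, h⟩, rfl⟩
  rw [LinearMap.comp_apply, LinearMap.comp_apply, runₗ_apply, hmaps, projectₗ_apply,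
    projectₗ_apply, project_single, project_single, hread]
  split_ifs
  · rw [runₗ_apply, hmaps]
  · simp

/-- The position at which the description of the `i`-th gate starts. -/
def gatePos (gs : List Gate) (i : ℕ) : ℕ := ((gs.take i).flatMap Gate.encode).length

theorem gatePos_lt {gs : List Gate} {i i' : ℕ} (h : i < i') (hi : i < gs.length) :
    gatePos gs i < gatePos gs i' := by
  have h1 : (gs.take i' ).take i = gs.take i := by rw [List.take_take, min_eq_left h.le]
  have h2 : gs.take i' = gs.take i ++ (gs.take i').drop i := by
    rw [← h1, List.take_append_drop]
  rw [gatePos, gatePos, h2, List.flatMap_append, List.length_append]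
  have h3 : gs[i] ∈ (gs.take i').drop i := by
    rw [List.mem_iff_getElem]
    exact ⟨0, by simp; omega, by simp⟩
  have := length_encode_le h3
  have := length_encode_pos gs[i]
  omega

theorem gatePos_injOn (gs : List Gate) : Set.InjOn (gatePos gs) {i | i < gs.length} := by
  intro i hi i' hi' h
  rcases lt_trichotomy i i' with h' | h' | h'
  · have := gatePos_lt h' hi; omega
  · exact h'
  · have := gatePos_lt h' hi'; omega

theorem Circuit.gatePos_lt_length (C : Circuit) {i : ℕ} (hi : i < C.gates.length) :
    gatePos C.gates i < C.encode.length := by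
  have h1 := gatePos_lt hi hi
  have h2 := C.length_flatMap_encode_le
  rw [gatePos, gatePos, List.take_length] at h1
  rw [gatePos]
  omega

theorem markGates_append (s : ℕ) (P : ℕ → Prop) (j : ℕ) (gs gs' : List Gate) :
    markGates s P j (gs ++ gs') =
      markGates s P j gs ++ markGates s P (j + (gs.flatMap Gate.encode).length) gs' := by
  induction gs generalizing j with
  | nil => simp [markGates]
  | cons g gs ih => simp [markGates, ih, Nat.add_assoc]

theorem markGates_eq_self (s : ℕ) (P : ℕ → Prop) (j : ℕ) (gs : List Gate)
    (h : ∀ i < gs.length, ¬ P (j + gatePos gs i)) : markGates s P j gs = gs := by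
  induction gs generalizing j with
  | nil => rfl
  | cons g gs ih =>
    have h0 : ¬ P j := by simpa [gatePos] using h 0 (by simp)
    have h1 : markGate s P j g = [g] := by
      cases g with
      | query ins outs => simp [markGate, h0]
      | _ => rfl
    rw [markGates, h1, ih, List.singleton_append]
    intro i hi
    have := h (i + 1) (by simpa using hi)
    simpa [gatePos, Nat.add_assoc] using this

/-- The state before the `i`-th gate, after the part from `k` on of its query input has been
measured with outcome `w`. -/
def hitState (k : ℕ) (w : List Bool) (O : BitString d → BitString m) (gs : List Gate) (i : ℕ) :
    State :=
  match gs[i]? with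
  | some (.query ins _) => project (ins.drop k) w (run O (gs.take i) ketZero)
  | _ => 0

/-- All queries have the same arity, so the first one reveals it; this lets the transformation find
the length of the witness without knowing the parameters of the adversary. -/
theorem length_firstIns {gs : List Gate} (hg : ∀ g ∈ gs, g.WellFormed d m) {ins outs : List ℕ}
    (h : .query ins outs ∈ gs) : (firstIns gs).length = d := by
  induction gs with
  | nil => simp at h
  | cons g gs ih =>
    rcases List.mem_cons.1 h with rfl | h
    · exact (hg (.query ins outs) (by simp)).1
    · have := ih (fun g h => hg g (by simp [h])) h
      cases g with
      | query ins outs => exact (hg (.query ins outs) (by simp)).1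
      | _ => exact this

/-- If only the coins of the `i`-th gate fire, then the measurement hits with the probability with
which the `i`-th gate queries the oracle at the right place. -/
theorem normSq_hitState_le {s k : ℕ} {gs : List Gate} (O : BitString d → BitString m)
    (hw : ∀ g ∈ gs, g.WellFormed d m) (hs : ∀ g ∈ gs, g.Below s) (w : List Bool) {P : ℕ → Prop}
    {i : ℕ} (hP : P (gatePos gs i)) (hP' : ∀ i' < gs.length, i' ≠ i → ¬ P (gatePos gs i')) :
    normSq (hitState k w O gs i) ≤ normSq (project ((List.range ((firstIns gs).length - k)).map
      fun i => outWire s (k + i)) w (run O (markGates s P 0 gs) ketZero)) := by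
  by_cases hq : ∃ ins outs, gs[i]? = some (.query ins outs)
  swap
  · have : hitState k w O gs i = 0 := by
      rw [hitState]
      split
      · next ins outs h => exact absurd ⟨ins, outs, h⟩ hq
      · rfl
    rw [this, normSq_zero]
    exact normSq_nonneg _
  obtain ⟨ins, outs, hget⟩ := hq
  obtain ⟨hilt, hgi⟩ := List.getElem?_eq_some_iff.1 hget
  have hmem : Gate.query ins outs ∈ gs := hgi ▸ List.getElem_mem hilt
  have hsplit : gs = gs.take i ++ .query ins outs :: gs.drop (i + 1) := by
    rw [← hgi, List.cons_getElem_drop_succ, List.take_append_drop]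
  have hdrop : ∀ g ∈ gs.drop (i + 1), g ∈ gs := fun g => List.mem_of_mem_drop
  have htake : ∀ g ∈ gs.take i, g ∈ gs := fun g => List.mem_of_mem_take
  have hmark : markGates s P 0 gs =
      gs.take i ++ (copyCnots s ins ++ .query ins outs :: gs.drop (i + 1)) := by
    conv_lhs => rw [hsplit]
    rw [markGates_append, markGates_eq_self, markGates, Nat.zero_add, ← gatePos,
      markGates_eq_self, markGate, if_pos hP]
    · simp
    · intro i' hi'
      rw [List.length_drop] at hi'
      have h := hP' (i + 1 + i') (by omega) (by omega)
      convert h using 2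
      conv_rhs => rw [gatePos, List.take_add, List.flatMap_append, List.length_append]
      congr 1
      rw [List.take_add_one, hget, gatePos]
      simp
    · intro i' hi'
      rw [List.length_take] at hi'
      have h := hP' i' (by omega) (by omega)
      rwa [Nat.zero_add, gatePos, List.take_take, min_eq_left (by omega), ← gatePos]
  have hwq := hw _ hmem
  have hi : ∀ j ∈ ins, j < s := fun j hj => hs _ hmem j (by simp [Gate.wires, hj])
  have hlen : ins.length ≤ s := length_le_of_below (List.nodup_append.1 hwq.2.2).1 hi
  have hhit : hitState k w O gs i = project (ins.drop k) w (run O (gs.take i) ketZero) := by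
    rw [hitState, hget]
  -- No gate after the copies touches the measured wires, so the projection moves back to the copies
  -- and becomes a projection on the query input. All gates after it preserve the norm.
  rw [(length_firstIns hw hmem).trans hwq.1.symm, hmark, run_append, run_append, project_run,
    project_run_copyCnots O hi w (run_mem_low O (fun g hg => hs g (htake g hg))
      (fun g hg => hw g (htake g hg)) (ketZero_mem_low s)), normSq_run, normSq_run, hhit]
  · exact fun g hg => (copyCnots_below hi hlen g hg).2
  · intro g hg
    rcases List.mem_cons.1 hg with rfl | hg
    · exact hwq
    · exact hw g (hdrop g hg)
  · intro g hg
    rcases List.mem_cons.1 hg with rfl | hg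
    · exact hwq
    · exact hw g (hdrop g hg)
  · intro g hg j hj hj'
    have hgb : g.Below s := by
      rcases List.mem_cons.1 hg with rfl | hg
      · exact hs _ hmem
      · exact hs g (hdrop g hg)
    have := hgb j hj'
    obtain ⟨i', _, rfl⟩ := List.mem_map.1 hj
    simp only [outWire] at this
    omega

end Measure

/-! ### The probability that exactly one query is copied -/

section Count

variable {d m : ℕ}

/-- The coins for the query at position `j`. -/
def coinsAt (s j : ℕ) : Finset ℕ := (Finset.range (coinNum s)).image (coinWire s j)

theorem coinWire_injective (s j : ℕ) : Function.Injective (coinWire s j) := fun a b h => by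
  simp only [coinWire] at h; omega

theorem card_coinsAt (s j : ℕ) : (coinsAt s j).card = coinNum s := by
  rw [coinsAt, Finset.card_image_of_injective _ (coinWire_injective s j), Finset.card_range]

theorem fires_iff {s j : ℕ} {c : Finset ℕ} : Fires s c j ↔ coinsAt s j ⊆ c := by
  simp [Fires, coinsAt, Finset.image_subset_iff]

theorem coinsAt_subset {s j : ℕ} (hj : j < s) : coinsAt s j ⊆ coinSet s := by
  intro i hi
  obtain ⟨l, hl, rfl⟩ := Finset.mem_image.1 hi
  have h1 := coinWire_lt hj (Finset.mem_range.1 hl)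
  have h2 : coinWire s j l = keyWire s (hashSteps s + (hashDeg s + (j * hashDeg s + l))) := rfl
  rw [h2, keyWire_mem_coinSet]
  simp only [coinWire, ancWire] at h1
  omega

theorem disjoint_coinsAt {s j j' : ℕ} (hs : 0 < s) (h : j ≠ j') :
    Disjoint (coinsAt s j) (coinsAt s j') := by
  rw [Finset.disjoint_left]
  intro i hi hi'
  obtain ⟨l, hl, rfl⟩ := Finset.mem_image.1 hi
  obtain ⟨l', hl', h'⟩ := Finset.mem_image.1 hi'
  have h1 := coinNum_lt_hashDeg hs
  rw [Finset.mem_range] at hl hl'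
  simp only [coinWire] at h'
  have h2 : j * hashDeg s + l = j' * hashDeg s + l' := by omega
  rcases Nat.lt_or_gt_of_ne h with h3 | h3
  · have : (j + 1) * hashDeg s ≤ j' * hashDeg s := Nat.mul_le_mul_right _ h3
    rw [Nat.succ_mul] at this
    omega
  · have : (j' + 1) * hashDeg s ≤ j * hashDeg s := Nat.mul_le_mul_right _ h3
    rw [Nat.succ_mul] at this
    omega

open Classical in
theorem card_filter_superset {A M : Finset ℕ} (h : A ⊆ M) :
    (((M.powerset.filter fun c => A ⊆ c).card : ℕ) : ℝ) = 2 ^ M.card * (1 / 2) ^ A.card := by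
  have : (M.powerset.filter fun c => A ⊆ c) = Finset.Icc A M := by
    ext c; simp [and_comm]
  rw [this, Finset.card_Icc_finset h, Nat.cast_pow, Nat.cast_ofNat]
  have h2 := Finset.card_le_card h
  rw [pow_sub₀ _ (by norm_num) h2, one_div, inv_pow]

/-- Together with `pow_coinNum_le` this places the probability that all coins of one position are
set between `1 / (4 * s)` and `1 / (2 * s)`: large enough to be useful, and small enough for a union
bound over the other positions. -/
theorem two_mul_lt_pow_coinNum (s : ℕ) : 2 * s < 2 ^ coinNum s := by
  rw [two_mul]; exact Nat.lt_size_self _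

theorem pow_coinNum_le {s : ℕ} (hs : 0 < s) : 2 ^ coinNum s ≤ 4 * s := by
  have h0 : 0 < coinNum s := Nat.size_pos.2 (by omega)
  have h1 : 2 ^ (coinNum s - 1) ≤ s + s := Nat.lt_size.1 (by unfold coinNum at h0 ⊢; omega)
  have : 2 ^ coinNum s = 2 ^ (coinNum s - 1) * 2 := by
    rw [← pow_succ]; congr 1; omega
  omega

open Classical in
/-- With good probability only the coins at position `j` fire. -/
theorem le_card_fires {s : ℕ} (hs : 0 < s) (J : Finset ℕ) (hJ : J.card ≤ s) (hJs : ∀ j ∈ J, j < s)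
    {j : ℕ} (hj : j ∈ J) :
    2 ^ (coinSet s).card * (1 / (8 * s : ℝ)) ≤ (((coinSet s).powerset.filter fun c =>
      Fires s c j ∧ ∀ j' ∈ J, j' ≠ j → ¬ Fires s c j').card : ℝ) := by
  set A := (coinSet s).powerset.filter fun c => coinsAt s j ⊆ c with hA
  set B : ℕ → Finset (Finset ℕ) := fun j' =>
    (coinSet s).powerset.filter fun c => coinsAt s j ∪ coinsAt s j' ⊆ c with hB
  set G := (coinSet s).powerset.filter fun c =>
      Fires s c j ∧ ∀ j' ∈ J, j' ≠ j → ¬ Fires s c j' with hG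
  -- The coins of different positions are disjoint, hence independent. If `p` is the probability
  -- that one position fires, the good event has probability at least `p - s * p ^ 2 ≥ p / 2 ≥ 1 /
  -- (8 * s)`.
  have hsub : A ⊆ G ∪ (J.erase j).biUnion B := by
    intro c hc
    rw [hA, Finset.mem_filter] at hc
    rw [Finset.mem_union]
    by_cases h : ∀ j' ∈ J, j' ≠ j → ¬ Fires s c j'
    · exact .inl (Finset.mem_filter.2 ⟨hc.1, fires_iff.2 hc.2, h⟩)
    · push Not at h
      obtain ⟨j', h1, h2, h3⟩ := h
      refine .inr (Finset.mem_biUnion.2 ⟨j', Finset.mem_erase.2 ⟨h2, h1⟩,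
        Finset.mem_filter.2 ⟨hc.1, Finset.union_subset hc.2 (fires_iff.1 h3)⟩⟩)
  have hcard : (A.card : ℝ) ≤ G.card + ∑ j' ∈ J.erase j, ((B j').card : ℝ) := by
    have h1 := (Finset.card_le_card hsub).trans (Finset.card_union_le _ _)
    have h2 : ((J.erase j).biUnion B).card ≤ ∑ j' ∈ J.erase j, (B j').card :=
      Finset.card_biUnion_le
    exact_mod_cast h1.trans (Nat.add_le_add_left h2 _)
  set p : ℝ := (1 / 2) ^ coinNum s with hp
  set M : ℝ := 2 ^ (coinSet s).card with hM
  have hA' : (A.card : ℝ) = M * p := by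
    rw [hA, card_filter_superset (coinsAt_subset (hJs j hj)), card_coinsAt]
  have hB' : ∀ j' ∈ J.erase j, ((B j').card : ℝ) = M * (p * p) := by
    intro j' hj'
    obtain ⟨h1, h2⟩ := Finset.mem_erase.1 hj'
    rw [hB]
    simp only
    rw [card_filter_superset (Finset.union_subset (coinsAt_subset (hJs j hj))
      (coinsAt_subset (hJs j' h2))), Finset.card_union_of_disjoint
      (disjoint_coinsAt hs (Ne.symm h1)), card_coinsAt, card_coinsAt, pow_add]
  rw [Finset.sum_congr rfl hB', hA', Finset.sum_const, nsmul_eq_mul] at hcard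
  have hs' : (0 : ℝ) < s := by exact_mod_cast hs
  have hp0 : 0 < p := by positivity
  have hM0 : 0 < M := by positivity
  have h2 : (2 * s : ℝ) ≤ 2 ^ coinNum s := by exact_mod_cast (two_mul_lt_pow_coinNum s).le
  have h4 : (2 : ℝ) ^ coinNum s ≤ 4 * s := by exact_mod_cast pow_coinNum_le hs
  have hpp : p * 2 ^ coinNum s = 1 := by
    rw [hp, ← mul_pow]; norm_num
  have hsp : s * p ≤ 1 / 2 := by nlinarith
  have hpl : 1 / (4 * s : ℝ) ≤ p := by
    rw [div_le_iff₀ (by positivity)]; nlinarith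
  have hJ' : ((J.erase j).card : ℝ) ≤ s := by
    exact_mod_cast (Finset.card_le_card (Finset.erase_subset _ _)).trans hJ
  have h5 : ((J.erase j).card : ℝ) * (M * (p * p)) ≤ M * p * (1 / 2) := by
    calc ((J.erase j).card : ℝ) * (M * (p * p)) ≤ s * (M * (p * p)) := by gcongr
      _ = M * p * (s * p) := by ring
      _ ≤ M * p * (1 / 2) := by gcongr
  have h6 : M * (1 / (8 * s : ℝ)) ≤ M * p * (1 / 2) := by
    have : 1 / (8 * s : ℝ) = 1 / (4 * s) * (1 / 2) := by field_simp; norm_num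
    rw [this, ← mul_assoc]
    gcongr
  linarith

end Count

/-! ### The success probability of the reduction -/

section Extract

variable {d m : ℕ}

theorem firstIns_eq_nil_or (gs : List Gate) :
    firstIns gs = [] ∨ ∃ outs, .query (firstIns gs) outs ∈ gs := by
  induction gs with
  | nil => exact .inl rfl
  | cons g gs ih =>
    cases g with
    | query ins outs => exact .inr ⟨outs, by simp [firstIns]⟩
    | _ => exact ih.imp id fun ⟨outs, h⟩ => ⟨outs, by simp only [firstIns]; simp [h]⟩

theorem length_firstIns_le {s : ℕ} {gs : List Gate} (hw : ∀ g ∈ gs, g.WellFormed d m)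
    (hs : ∀ g ∈ gs, g.Below s) : (firstIns gs).length ≤ s := by
  rcases firstIns_eq_nil_or gs with h | ⟨outs, h⟩
  · simp [h]
  · exact length_le_of_below (List.nodup_append.1 (hw _ h).2.2).1 fun i hi =>
      hs _ h i (by simp [Gate.wires, hi])

theorem length_le_length_flatMap_encode (gs : List Gate) :
    gs.length ≤ (gs.flatMap Gate.encode).length := by
  induction gs with
  | nil => simp
  | cons g gs ih =>
    have := length_encode_pos g
    rw [List.length_cons, List.flatMap_cons, List.length_append]
    omega

theorem Circuit.length_gates_le (C : Circuit) : C.gates.length ≤ C.encode.length :=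
  (length_le_length_flatMap_encode _).trans C.length_flatMap_encode_le

theorem expect_hitState {C : Circuit} (hC : C.WellFormed d m) (k : ℕ) (w : List Bool) (i : ℕ) :
    𝔼 v : Fin (hashSteps C.encode.length + hashDeg C.encode.length) → ZMod 2,
      normSq (hitState k w (hashFun (hashDeg C.encode.length) (hashPos C.encode.length)
        (keyPoly v) : BitString d → BitString m) C.gates i) =
    𝔼 O : BitString d → BitString m, normSq (hitState k w O C.gates i) := by
  by_cases hq : ∃ ins outs, C.gates[i]? = some (.query ins outs)
  swap
  · have : ∀ O : BitString d → BitString m, hitState k w O C.gates i = 0 := by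
      intro O
      rw [hitState]
      split
      · next ins outs h => exact absurd ⟨ins, outs, h⟩ hq
      · rfl
    simp [this, normSq_zero]
  obtain ⟨ins, outs, hget⟩ := hq
  obtain ⟨hilt, hgi⟩ := List.getElem?_eq_some_iff.1 hget
  have hmem : Gate.query ins outs ∈ C.gates := hgi ▸ List.getElem_mem hilt
  have hhit : ∀ O : BitString d → BitString m, hitState k w O C.gates i =
      project (ins.drop k) w (run O (C.gates.take i) ketZero) := fun O => by
    rw [hitState, hget]
  simp only [hhit]
  obtain ⟨h1, h2, h3⟩ := hC _ hmem
  have hb := C.below _ hmem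
  have hn := List.nodup_append.1 h3
  set s := C.encode.length with hs
  have hd : d ≤ s := h1 ▸ length_le_of_below hn.1 fun j hj => hb j (by simp [Gate.wires, hj])
  have hm : m ≤ s := h2 ▸ length_le_of_below hn.2.1 fun j hj => hb j (by simp [Gate.wires, hj])
  -- Here the parameters come together. At most `s` gates call for independence `2 * s`. The product
  -- of the differences of inputs then has degree at most `2 * s * d ≤ 2 * s ^ 2 = hashPos s`, and
  -- `2 * s * hashDeg s = hashSteps s` coefficients suffice for the key.
  refine (isIndep_hashFun (n := s + s) (le_hashDeg hd) ?_ (hashPos_add_le hm)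
    ?_).expect_normSq_run ?_ _ _ _
  · unfold hashPos; nlinarith
  · have : (s + s) * hashDeg s = hashSteps s := by unfold hashSteps; ring
    omega
  · have := C.length_gates_le
    rw [List.length_take]
    omega

/-- The simulation outputs `w` at least with the probability, up to a polynomial factor, with which
a random query ends with `w`. -/
theorem sum_expect_hitState_le (O' : BitString 0 → BitString 0) {C : Circuit}
    (hC : C.WellFormed d m) (w : List Bool) :
    1 / (8 * C.encode.length : ℝ) * ∑ i ∈ Finset.range C.gates.length,
      𝔼 O : BitString d → BitString m, normSq (hitState C.out.length w O C.gates i) ≤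
    outputProb O' (simCircuit C) w := by
  classical
  have hs0 : 0 < C.encode.length := by simp [Circuit.encode]
  have ho : ∀ i ∈ (simCircuit C).out, i < C.encode.length + C.encode.length := by
    intro i hi
    have := length_firstIns_le hC C.below
    simp only [simCircuit, List.mem_map, List.mem_range] at hi
    obtain ⟨k, hk, rfl⟩ := hi
    simp only [outWire]
    omega
  rw [outputProb_simCircuit O' hC w ho]
  simp only [← expect_hitState hC]
  have hbelow := C.below
  have hlen := C.length_gates_le
  have hpos : ∀ i < C.gates.length, gatePos C.gates i < C.encode.length :=
    fun i hi => C.gatePos_lt_length hi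
  set s := C.encode.length with hs
  set L := hashSteps s + hashDeg s with hL
  set H : (Fin L → ZMod 2) → BitString d → BitString m := fun v =>
    hashFun (hashDeg s) (hashPos s) (keyPoly v) with hH
  set hit : (Fin L → ZMod 2) → ℕ → ℝ := fun v i =>
    normSq (hitState C.out.length w (H v) C.gates i) with hhit
  set X : (Fin L → ZMod 2) → Finset ℕ → ℝ := fun v c => normSq (project (simCircuit C).out w
    (run (H v) (markGates s (Fires s c) 0 C.gates) ketZero)) with hX
  show 1 / (8 * s : ℝ) * ∑ i ∈ Finset.range C.gates.length, 𝔼 v, hit v i ≤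
    (1 / 2) ^ randLen s * ∑ v, ∑ c ∈ (coinSet s).powerset, X v c
  set J := (Finset.range C.gates.length).image (gatePos C.gates) with hJ
  let only : ℕ → Finset ℕ → Prop := fun i c => Fires s c (gatePos C.gates i) ∧
    ∀ j' ∈ J, j' ≠ gatePos C.gates i → ¬ Fires s c j'
  have honly : ∀ i < C.gates.length, ∀ c, only i c → ∀ i' < C.gates.length, i' ≠ i →
      ¬ Fires s c (gatePos C.gates i') := fun i hi c h i' hi' hne =>
    h.2 _ (Finset.mem_image_of_mem _ (Finset.mem_range.2 hi'))
      fun e => hne (gatePos_injOn C.gates hi' hi e)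
  -- The events `only i` exclude one another because distinct gates have distinct positions, so at
  -- most one term survives.
  have h1 : ∀ v c, ∑ i ∈ Finset.range C.gates.length, (if only i c then hit v i else 0) ≤
      X v c := by
    intro v c
    by_cases hex : ∃ i ∈ Finset.range C.gates.length, only i c
    · obtain ⟨i, hi, hic⟩ := hex
      have hi' := Finset.mem_range.1 hi
      rw [Finset.sum_eq_single_of_mem i hi, if_pos hic]
      · exact normSq_hitState_le (H v) hC hbelow w hic.1 (honly i hi' c hic)
      · intro i' h' hne
        rw [if_neg fun h => honly i hi' c hic i' (Finset.mem_range.1 h') hne h.1]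
    · rw [Finset.sum_eq_zero fun i hi => if_neg fun h => hex ⟨i, hi, h⟩]
      exact normSq_nonneg _
  have h2 : ∀ v, ∑ i ∈ Finset.range C.gates.length,
      2 ^ (coinSet s).card * (1 / (8 * s : ℝ)) * hit v i ≤
        ∑ c ∈ (coinSet s).powerset, X v c := by
    intro v
    refine le_trans ?_ (Finset.sum_le_sum fun c _ => h1 v c)
    rw [Finset.sum_comm]
    refine Finset.sum_le_sum fun i hi => ?_
    rw [← Finset.sum_filter, Finset.sum_const, nsmul_eq_mul]
    refine mul_le_mul_of_nonneg_right ?_ (normSq_nonneg _)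
    refine le_card_fires hs0 J ?_ ?_ (Finset.mem_image_of_mem _ hi)
    · exact Finset.card_image_le.trans (by rw [Finset.card_range]; exact hlen)
    · intro j hj
      obtain ⟨i, hi, rfl⟩ := Finset.mem_image.1 hj
      exact hpos i (Finset.mem_range.1 hi)
  have hcard : (coinSet s).card = randLen s - L := by
    rw [coinSet, Finset.card_image_of_injective _ (keyWire_injective s), Nat.card_Ico]
  have hR : randLen s = L + (coinSet s).card := by
    rw [hcard]; unfold randLen; omega
  have h3 : ∀ i, 𝔼 v, hit v i = (1 / 2) ^ L * ∑ v, hit v i := by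
    intro i
    rw [Fintype.expect_eq_sum_div_card]
    simp only [Fintype.card_pi, ZMod.card, Finset.prod_const, Finset.card_univ, Fintype.card_fin]
    rw [div_eq_mul_inv, mul_comm, one_div, inv_pow]
    norm_num
  have h4 := Finset.sum_le_sum fun v (_ : v ∈ Finset.univ) => h2 v
  calc 1 / (8 * s : ℝ) * ∑ i ∈ Finset.range C.gates.length, 𝔼 v, hit v i
      = (1 / 2) ^ randLen s * ∑ v, ∑ i ∈ Finset.range C.gates.length,
        2 ^ (coinSet s).card * (1 / (8 * s : ℝ)) * hit v i := by
        simp only [h3]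
        rw [Finset.sum_comm]
        simp only [← Finset.mul_sum]
        rw [hR, pow_add]
        have : ((1 / 2 : ℝ)) ^ (coinSet s).card * 2 ^ (coinSet s).card = 1 := by
          rw [← mul_pow]; norm_num
        linear_combination (-(1 / 2 : ℝ) ^ L * (1 / (8 * s : ℝ)) *
          ∑ i ∈ Finset.range C.gates.length, ∑ v, hit v i) * this
    _ ≤ _ := by gcongr

theorem simCircuit_wellFormed {C : Circuit} (hC : C.WellFormed d m) :
    (simCircuit C).WellFormed 0 0 ∧ (simCircuit C).QueryFree := by
  have hbelow := C.below
  set s := C.encode.length with hs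
  have step : ∀ (ins : List ℕ) (p : ℕ), (∀ i ∈ ins, i < s) → ins.length ≤ s →
      ∀ g ∈ reduceStep s ins p, g.WellFormed 0 0 ∧ g.IsElementary := by
    intro ins p hi hl g hg
    obtain ⟨i, h, rfl⟩ := List.mem_mapIdx.1 hg
    have h1 := hi _ (List.getElem_mem h)
    have h2 := le_hashDeg hl
    refine ⟨?_, trivial⟩
    show [_, _, _].Nodup
    simp only [List.nodup_cons, List.mem_cons, List.not_mem_nil, or_false, not_or,
      not_false_eq_true, List.nodup_nil, and_true, keyWire]
    omega
  have query : ∀ (ins outs : List ℕ) (j : ℕ), j < s → (Gate.query ins outs).WellFormed d m →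
      (Gate.query ins outs).Below s →
      ∀ g ∈ queryGates s j ins outs, g.WellFormed 0 0 ∧ g.IsElementary := by
    intro ins outs j hj hw hb g hg
    have hn := List.nodup_append.1 hw.2.2
    have hi : ∀ i ∈ ins, i < s := fun i hi => hb i (by simp [Gate.wires, hi])
    have ho : ∀ i ∈ outs, i < s := fun i hi => hb i (by simp [Gate.wires, hi])
    have hl : ins.length ≤ s := length_le_of_below hn.1 hi
    simp only [queryGates, List.mem_append] at hg
    rcases hg with hg | hg | hg | hg | hg
    · rw [flagGates, List.mem_cons] at hg
      rcases hg with rfl | hg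
      · exact ⟨trivial, trivial⟩
      · obtain ⟨l, hl, rfl⟩ := List.mem_map.1 hg
        have h1 := coinWire_lt hj (List.mem_range.1 hl)
        have h2 := ancWire_zero_le s j l
        refine ⟨?_, trivial⟩
        show [_, _, _].Nodup
        have h3 : ancWire s j l < ancWire s j (l + 1) := by simp only [ancWire]; omega
        simp only [List.nodup_cons, List.mem_cons, List.not_mem_nil, or_false, not_or,
          not_false_eq_true, List.nodup_nil, and_true]
        omega
    · obtain ⟨i, h, rfl⟩ := List.mem_mapIdx.1 hg
      have h1 := hi _ (List.getElem_mem h)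
      refine ⟨?_, trivial⟩
      show [_, _, _].Nodup
      simp only [List.nodup_cons, List.mem_cons, List.not_mem_nil, or_false, not_or,
        not_false_eq_true, List.nodup_nil, and_true, outWire, ancWire]
      omega
    · obtain ⟨p, _, hg⟩ := List.mem_flatMap.1 hg
      exact step ins p hi hl g hg
    · obtain ⟨i, h, rfl⟩ := List.mem_mapIdx.1 hg
      have h1 := ho _ (List.getElem_mem h)
      refine ⟨?_, trivial⟩
      show _ ≠ _
      simp only [keyWire]
      omega
    · obtain ⟨p, _, hg⟩ := List.mem_flatMap.1 hg
      exact step ins p hi hl g hg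
  have sim : ∀ (gs : List Gate) (j : ℕ), (∀ g ∈ gs, g.WellFormed d m) → (∀ g ∈ gs, g.Below s) →
      j + (gs.flatMap Gate.encode).length ≤ s →
      ∀ g ∈ simGates s j gs, g.WellFormed 0 0 ∧ g.IsElementary := by
    intro gs
    induction gs with
    | nil => intro j _ _ _ g hg; simp [simGates] at hg
    | cons g gs ih =>
      intro j hw hb hj g' hg'
      rw [List.flatMap_cons, List.length_append] at hj
      have hpos := length_encode_pos g
      rw [simGates, List.mem_append] at hg'
      rcases hg' with hg' | hg'
      · have hwg := hw g (by simp)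
        have hbg := hb g (by simp)
        cases g with
        | query ins outs => exact query ins outs j (by omega) hwg hbg g' hg'
        | _ =>
          rw [simGate, List.mem_singleton] at hg'
          · exact hg' ▸ ⟨hwg, trivial⟩
          · simp
      · exact ih _ (fun g h => hw g (by simp [h])) (fun g h => hb g (by simp [h])) (by omega)
          g' hg'
  have all : ∀ g ∈ (simCircuit C).gates, g.WellFormed 0 0 ∧ g.IsElementary := by
    intro g hg
    simp only [simCircuit, List.mem_append] at hg
    rcases hg with hg | hg
    · obtain ⟨p, _, rfl⟩ := List.mem_map.1 hg
      exact ⟨trivial, trivial⟩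
    · exact sim C.gates 0 hC hbelow (by rw [Nat.zero_add]; exact C.length_flatMap_encode_le) g hg
  exact ⟨fun g hg => (all g hg).1, fun g hg => (all g hg).2⟩

end Extract

/-! ### The oracle without the points that end with the witness -/

section Hybrid

variable {k l m : ℕ}

/-- The oracle that answers `0` on the inputs that end with `w`. -/
def puncture (w : BitString l) (O : BitString (k + l) → BitString m) :
    BitString (k + l) → BitString m :=
  fun y => if (fun i => y (Fin.natAdd k i)) = w then fun _ => false else O y

theorem readWires_drop {ins : List ℕ} (h : ins.length = k + l) (S : Finset ℕ) :
    readWires (ins.drop k) S =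
      List.ofFn fun i : Fin l => queryInput (k + l) ins S (Fin.natAdd k i) := by
  refine List.ext_getElem (by simp [readWires, h]) fun i h1 h2 => ?_
  simp only [readWires, List.length_map, List.length_drop] at h1
  simp only [readWires, List.getElem_map, List.getElem_drop, List.getElem_ofFn, queryInput,
    Fin.val_natAdd]
  have : ins.getD (k + i) 0 = ins[k + i] := List.getD_eq_getElem _ _ (by omega)
  rw [decide_eq_decide, this]

/-- The two oracles act alike on basis states whose query input does not end with `w`, so their
difference factors through the projection on the other ones. -/
theorem apply_sub_apply_puncture {ins outs : List ℕ} (h : ins.length = k + l) (w : BitString l)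
    (O : BitString (k + l) → BitString m) (φ : State) :
    (Gate.query ins outs).apply O φ - (Gate.query ins outs).apply (puncture w O) φ =
      (Gate.query ins outs).apply O (project (ins.drop k) (List.ofFn w) φ) -
        (Gate.query ins outs).apply (puncture w O) (project (ins.drop k) (List.ofFn w) φ) := by
  suffices H : (Gate.query ins outs).apply O - (Gate.query ins outs).apply (puncture w O) =
      ((Gate.query ins outs).apply O - (Gate.query ins outs).apply (puncture w O)) ∘ₗ
        projectₗ (ins.drop k) (List.ofFn w) from LinearMap.congr_fun H φ
  refine Finsupp.lhom_ext fun S c => ?_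
  rw [LinearMap.comp_apply, projectₗ_apply, project_single]
  split_ifs with hS
  · rfl
  · rw [readWires_drop h, List.ofFn_inj] at hS
    rw [LinearMap.sub_apply, apply_single, apply_single, map_zero, Gate.onBasis, Gate.onBasis,
      puncture, if_neg hS, sub_self]

theorem apply_eq_apply {d m : ℕ} (O O' : BitString d → BitString m) {g : Gate}
    (hg : g.IsElementary) : g.apply O = g.apply O' := by
  cases g with
  | query ins outs => exact hg.elim
  | _ => rfl

theorem norm_apply {d m : ℕ} (O : BitString d → BitString m) {g : Gate} (hg : g.WellFormed d m)
    (ψ : State) : ‖toHilb (g.apply O ψ)‖ = ‖toHilb ψ‖ := norm_toHilb_eq (normSq_apply O hg ψ)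

/-- Puncturing the oracle changes the state by no more than the amplitudes of the queries at the
punctured points. -/
theorem norm_run_sub_le {gs : List Gate} (hg : ∀ g ∈ gs, g.WellFormed (k + l) m) (w : BitString l)
    (O : BitString (k + l) → BitString m) :
    ‖toHilb (run O gs ketZero) - toHilb (run (puncture w O) gs ketZero)‖ ≤
      2 * ∑ i ∈ Finset.range gs.length, ‖toHilb (hitState k (List.ofFn w) O gs i)‖ := by
  suffices H : ∀ n ≤ gs.length, ‖toHilb (run O (gs.take n) ketZero) -
      toHilb (run (puncture w O) (gs.take n) ketZero)‖ ≤
      2 * ∑ i ∈ Finset.range n, ‖toHilb (hitState k (List.ofFn w) O gs i)‖ by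
    have := H gs.length le_rfl
    rwa [List.take_length] at this
  intro n hn
  induction n with
  | zero => simp [run_nil]
  | succ n ih =>
    have hlt : n < gs.length := hn
    have hwf := hg _ (List.getElem_mem hlt)
    rw [List.take_succ_eq_append_getElem hlt, run_append, run_append, run_cons, run_nil, run_cons,
      run_nil, Finset.sum_range_succ, mul_add]
    set φ := run O (gs.take n) ketZero with hφ
    set φ' := run (puncture w O) (gs.take n) ketZero
    have h1 : ‖toHilb (gs[n].apply O φ) - toHilb (gs[n].apply (puncture w O) φ)‖ ≤
        2 * ‖toHilb (hitState k (List.ofFn w) O gs n)‖ := by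
      rw [hitState, List.getElem?_eq_getElem hlt, ← map_sub]
      generalize hgn : gs[n] = g at hwf
      cases g with
      | query ins outs =>
        rw [apply_sub_apply_puncture hwf.1, map_sub]
        refine (norm_sub_le _ _).trans ?_
        rw [norm_apply O hwf, norm_apply _ hwf, two_mul]
      | _ =>
        rw [apply_eq_apply O (puncture w O) (by trivial), sub_self, map_zero, norm_zero]
        simp
    have h2 : ‖toHilb (gs[n].apply (puncture w O) φ) - toHilb (gs[n].apply (puncture w O) φ')‖ =
        ‖toHilb φ - toHilb φ'‖ := by
      rw [← map_sub, ← map_sub, norm_apply _ hwf, map_sub]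
    -- The intermediate state applies the punctured gate to the run with the full oracle. Thus only
    -- query amplitudes of the unpunctured run enter, and the reduction can simulate that run
    -- without knowing `w`.
    calc _ ≤ _ := norm_sub_le_norm_sub_add_norm_sub _ (toHilb (gs[n].apply (puncture w O) φ)) _
      _ ≤ _ := by
        rw [h2]
        have := ih (by omega)
        linarith

/-- Contractions that follow a measurement. -/
theorem abs_sum_sub_le {ws : List ℕ} (hws : ws.length = k) (T : BitString k → State →ₗ[ℂ] State)
    (hT : ∀ x ψ, ‖toHilb (T x ψ)‖ ≤ ‖toHilb ψ‖) {φ φ' : State} (hφ : ‖toHilb φ‖ = 1)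
    (hφ' : ‖toHilb φ'‖ = 1) :
    |∑ x, normSq (T x (project ws (List.ofFn x) φ)) -
      ∑ x, normSq (T x (project ws (List.ofFn x) φ'))| ≤ 2 * ‖toHilb φ - toHilb φ'‖ := by
  set P : BitString k → State → ℝ := fun x ψ => ‖toHilb (project ws (List.ofFn x) ψ)‖ with hP
  have hsum : ∀ ψ, √(∑ x, P x ψ ^ 2) = ‖toHilb ψ‖ := fun ψ => by
    simp only [hP, norm_toHilb_sq]
    rw [sum_normSq_project hws, ← norm_toHilb_sq, Real.sqrt_sq (norm_nonneg _)]
  -- The difference of squared norms is at most the norm of the difference times the sum of the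
  -- norms. Cauchy–Schwarz over the outcomes then gives a bound that does not depend on their
  -- number.
  have hx : ∀ x, |normSq (T x (project ws (List.ofFn x) φ)) -
      normSq (T x (project ws (List.ofFn x) φ'))| ≤ P x (φ - φ') * P x φ + P x (φ - φ') * P x φ' := by
    intro x
    set a := toHilb (T x (project ws (List.ofFn x) φ)) with ha
    set b := toHilb (T x (project ws (List.ofFn x) φ')) with hb
    have h1 : ‖a - b‖ ≤ P x (φ - φ') := by
      rw [ha, hb, ← map_sub, ← map_sub]
      refine (hT x _).trans (le_of_eq ?_)
      rw [hP]
      simp only [← projectₗ_apply, map_sub]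
    have h2 : ‖a‖ ≤ P x φ := hT x _
    have h3 : ‖b‖ ≤ P x φ' := hT x _
    rw [← norm_toHilb_sq, ← norm_toHilb_sq, ← ha, ← hb, sq_sub_sq, abs_mul, mul_comm,
      abs_of_nonneg (by positivity : 0 ≤ ‖a‖ + ‖b‖), ← mul_add]
    have h4 := abs_norm_sub_norm_le a b
    have h5 : 0 ≤ P x (φ - φ') := norm_nonneg _
    exact mul_le_mul (h4.trans h1) (add_le_add h2 h3) (by positivity) h5
  rw [← Finset.sum_sub_distrib]
  refine (Finset.abs_sum_le_sum_abs _ _).trans ((Finset.sum_le_sum fun x _ => hx x).trans ?_)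
  rw [Finset.sum_add_distrib]
  have h1 := Real.sum_mul_le_sqrt_mul_sqrt Finset.univ (fun x => P x (φ - φ')) fun x => P x φ
  have h2 := Real.sum_mul_le_sqrt_mul_sqrt Finset.univ (fun x => P x (φ - φ')) fun x => P x φ'
  simp only [hsum, hφ, hφ', map_sub] at h1 h2
  linarith

/-- Exchanging the value of `O` at `y` with `z` is an involution on the pairs `(O, z)`. -/
theorem expect_update {α β : Type*} [Fintype α] [DecidableEq α] [Fintype β] [DecidableEq β]
    [Nonempty β] (y : α) (g : (α → β) → ℝ) :
    𝔼 O : α → β, 𝔼 z : β, g (update O y z) = 𝔼 O : α → β, g O := by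
  have h : ∑ O : α → β, ∑ z : β, g (update O y z) = ∑ O : α → β, ∑ _z : β, g O := by
    rw [← Fintype.sum_prod_type', ← Fintype.sum_prod_type']
    refine Fintype.sum_equiv ⟨fun q => (update q.1 y q.2, q.1 y), fun q => (update q.1 y q.2, q.1 y),
      fun q => ?_, fun q => ?_⟩ _ _ fun q => rfl
    · simp
    · simp
  simp only [Fintype.expect_eq_sum_div_card, ← Finset.sum_div]
  rw [h]
  simp only [Finset.sum_const, nsmul_eq_mul, ← Finset.mul_sum, Finset.card_univ]
  have : (Fintype.card β : ℝ) ≠ 0 := by exact_mod_cast Fintype.card_ne_zero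
  field_simp

/-- A first stage with the punctured oracle cannot notice reprogramming at `x‖w`, whatever `x` is.
-/
theorem puncture_update (x : BitString k) (w : BitString l) (O : BitString (k + l) → BitString m)
    (z : BitString m) : puncture w (update O (Fin.append x w) z) = puncture w O := by
  funext y
  rw [puncture, puncture]
  split_ifs with h
  · rfl
  · rw [update_of_ne]
    rintro rfl
    exact h (by funext i; simp)

end Hybrid

/-! ### The reduction -/

section Main

theorem norm_toHilb_ketZero : ‖toHilb ketZero‖ = 1 := by
  rw [ketZero, toHilb_single, one_smul, orthonormal_ket.1]

theorem norm_toHilb_run {d m : ℕ} (O : BitString d → BitString m) {gs : List Gate}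
    (hg : ∀ g ∈ gs, g.WellFormed d m) (ψ : State) : ‖toHilb (run O gs ψ)‖ = ‖toHilb ψ‖ :=
  norm_toHilb_eq (normSq_run O hg ψ)

variable {S : Sampler} {xLen zLen : ℕ → ℕ}

/-- The oracle of the second stage and the value `z` may depend on `x`, so that the same bound
serves both experiments. -/
theorem Adversary.abs_sum_prob_sub_le (A : Adversary S xLen zLen) (n : ℕ)
    (pk : BitString (S.pkLen n)) (w : BitString (S.wLen n))
    (O O' : BitString (xLen n + S.wLen n) → BitString (zLen n))
    (O₂ : BitString (xLen n) → BitString (xLen n + S.wLen n) → BitString (zLen n))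
    (z : BitString (xLen n) → BitString (zLen n)) :
    |∑ x, A.prob n pk w O (O₂ x) x (z x) - ∑ x, A.prob n pk w O' (O₂ x) x (z x)| ≤
      2 * ‖toHilb (run O (A.A₁ [unary n, List.ofFn pk]).gates ketZero) -
        toHilb (run O' (A.A₁ [unary n, List.ofFn pk]).gates ketZero)‖ := by
  have key := abs_sum_sub_le (A.out₁ n pk)
    (fun x => projectₗ
        (A.A₂ [unary n, List.ofFn pk, List.ofFn x, List.ofFn w, List.ofFn (z x)]).out [true] ∘ₗ
      runₗ (O₂ x) (A.A₂ [unary n, List.ofFn pk, List.ofFn x, List.ofFn w, List.ofFn (z x)]).gates)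
    (fun x ψ => by
      rw [LinearMap.comp_apply, projectₗ_apply, runₗ_apply]
      exact (norm_toHilb_le (normSq_project_le _ _ _)).trans_eq
        (norm_toHilb_run (O₂ x) (A.wellFormed₂ n pk x w (z x)) ψ))
    ((norm_toHilb_run O (A.wellFormed₁ n pk) ketZero).trans norm_toHilb_ketZero)
    ((norm_toHilb_run O' (A.wellFormed₁ n pk) ketZero).trans norm_toHilb_ketZero)
  simp only [LinearMap.comp_apply, projectₗ_apply, runₗ_apply] at key
  simpa only [Adversary.prob] using key

/-- The experiments with a fixed instance differ by no more than the amplitudes of those queries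
that end with the witness. -/
theorem Adversary.abs_expect_sub_le (A : Adversary S xLen zLen) (n : ℕ)
    (pk : BitString (S.pkLen n)) (w : BitString (S.wLen n)) :
    |(𝔼 O : BitString (xLen n + S.wLen n) → BitString (zLen n),
        ∑ x : BitString (xLen n), A.prob n pk w O O x (O (Fin.append x w))) -
      𝔼 O : BitString (xLen n + S.wLen n) → BitString (zLen n), 𝔼 z : BitString (zLen n),
        ∑ x : BitString (xLen n), A.prob n pk w O (update O (Fin.append x w) z) x z| ≤
    8 * 𝔼 O : BitString (xLen n + S.wLen n) → BitString (zLen n),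
      ∑ i ∈ Finset.range (A.A₁ [unary n, List.ofFn pk]).gates.length,
        ‖toHilb (hitState (xLen n) (List.ofFn w) O (A.A₁ [unary n, List.ofFn pk]).gates i)‖ := by
  set h : (BitString (xLen n + S.wLen n) → BitString (zLen n)) → ℝ := fun O =>
    ∑ i ∈ Finset.range (A.A₁ [unary n, List.ofFn pk]).gates.length,
      ‖toHilb (hitState (xLen n) (List.ofFn w) O (A.A₁ [unary n, List.ofFn pk]).gates i)‖ with hh
  have hclose : ∀ (O : BitString (xLen n + S.wLen n) → BitString (zLen n))
      (O₂ : BitString (xLen n) → BitString (xLen n + S.wLen n) → BitString (zLen n))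
      (z : BitString (xLen n) → BitString (zLen n)),
      |∑ x, A.prob n pk w O (O₂ x) x (z x) - ∑ x, A.prob n pk w (puncture w O) (O₂ x) x (z x)| ≤
        4 * h O := fun O O₂ z => by
    have h1 := A.abs_sum_prob_sub_le n pk w O (puncture w O) O₂ z
    have h2 := norm_run_sub_le (A.wellFormed₁ n pk) w O
    simp only [hh]
    linarith
  -- The hybrid in which only the first stage is punctured. It is within `𝔼 O, 4 * h O` of either
  -- experiment, which explains the constant `8`.
  set R := 𝔼 O : BitString (xLen n + S.wLen n) → BitString (zLen n),
    ∑ x : BitString (xLen n), A.prob n pk w (puncture w O) O x (O (Fin.append x w)) with hR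
  have hR' : R = 𝔼 O : BitString (xLen n + S.wLen n) → BitString (zLen n),
      𝔼 z : BitString (zLen n), ∑ x : BitString (xLen n),
        A.prob n pk w (puncture w O) (update O (Fin.append x w) z) x z := by
    -- The sum over `x` is moved outside, since the point that is resampled depends on `x`.
    rw [hR, Finset.expect_sum_comm]
    simp only [Finset.expect_sum_comm]
    refine Finset.sum_congr rfl fun x _ => ?_
    rw [← expect_update (Fin.append x w)]
    simp only [puncture_update, update_self]
  have e1 : |(𝔼 O : BitString (xLen n + S.wLen n) → BitString (zLen n),
      ∑ x : BitString (xLen n), A.prob n pk w O O x (O (Fin.append x w))) - R| ≤ 𝔼 O, 4 * h O := by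
    rw [hR, ← Finset.expect_sub_distrib]
    exact (Finset.abs_expect_le _ _).trans
      (Finset.expect_le_expect fun O _ => hclose O (fun _ => O) fun x => O (Fin.append x w))
  have e2 : |(𝔼 O : BitString (xLen n + S.wLen n) → BitString (zLen n),
      𝔼 z : BitString (zLen n), ∑ x : BitString (xLen n),
        A.prob n pk w O (update O (Fin.append x w) z) x z) - R| ≤ 𝔼 O, 4 * h O := by
    rw [hR', ← Finset.expect_sub_distrib]
    refine (Finset.abs_expect_le _ _).trans (Finset.expect_le_expect fun O _ => ?_)
    rw [← Finset.expect_sub_distrib]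
    refine (Finset.abs_expect_le _ _).trans ?_
    refine (Finset.expect_le_expect fun z _ => hclose O (fun x => update O (Fin.append x w) z)
      fun _ => z).trans ?_
    rw [Finset.expect_const Finset.univ_nonempty]
  rw [← Finset.mul_expect] at e1 e2
  rw [abs_sub_comm] at e2
  exact (abs_sub_le _ R _).trans ((add_le_add e1 e2).trans_eq (by ring))

/-- Cauchy–Schwarz twice, for the average and for the sum. It turns query amplitudes into the query
probabilities that the reduction can sample. -/
theorem sq_expect_sum_le {α : Type*} [Fintype α] [Nonempty α] (k : ℕ) (f : α → ℕ → ℝ) :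
    (𝔼 a, ∑ i ∈ Finset.range k, f a i) ^ 2 ≤ k * ∑ i ∈ Finset.range k, 𝔼 a, f a i ^ 2 := by
  have hc : (0 : ℝ) < Fintype.card α := by exact_mod_cast Fintype.card_pos
  have h1 := sq_sum_le_card_mul_sum_sq (s := (Finset.univ : Finset α))
    (f := fun a => ∑ i ∈ Finset.range k, f a i)
  have h2 : ∀ a, (∑ i ∈ Finset.range k, f a i) ^ 2 ≤ k * ∑ i ∈ Finset.range k, f a i ^ 2 :=
    fun a => by
      have := sq_sum_le_card_mul_sum_sq (s := Finset.range k) (f := f a)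
      rwa [Finset.card_range] at this
  rw [← Finset.expect_sum_comm, Fintype.expect_eq_sum_div_card, Fintype.expect_eq_sum_div_card,
    div_pow, ← mul_div_assoc, div_le_div_iff₀ (by positivity) hc]
  have h3 := Finset.sum_le_sum fun a (_ : a ∈ Finset.univ) => h2 a
  rw [← Finset.mul_sum] at h3
  rw [Finset.card_univ] at h1
  have h4 := h1.trans (mul_le_mul_of_nonneg_left h3 hc.le)
  nlinarith [mul_le_mul_of_nonneg_right h4 hc.le]

/-- The difference of the experiments with a fixed instance, in terms of the probability that the
reduction outputs the witness. -/
theorem Adversary.sq_expect_sub_le (A : Adversary S xLen zLen) (n : ℕ)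
    (pk : BitString (S.pkLen n)) (w : BitString (S.wLen n)) :
    ((𝔼 O : BitString (xLen n + S.wLen n) → BitString (zLen n),
        ∑ x : BitString (xLen n), A.prob n pk w O O x (O (Fin.append x w))) -
      𝔼 O : BitString (xLen n + S.wLen n) → BitString (zLen n), 𝔼 z : BitString (zLen n),
        ∑ x : BitString (xLen n), A.prob n pk w O (update O (Fin.append x w) z) x z) ^ 2 ≤
    512 * ((A.A₁ [unary n, List.ofFn pk]).encode.length : ℝ) ^ 2 *
      outputProb (fun y : BitString 0 => y) (simCircuit (A.A₁ [unary n, List.ofFn pk]))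
        (List.ofFn w) := by
  have h1 := A.abs_expect_sub_le n pk w
  have h2 := sum_expect_hitState_le (fun y : BitString 0 => y) (A.wellFormed₁ n pk) (List.ofFn w)
  rw [A.out₁ n pk] at h2
  set C := A.A₁ [unary n, List.ofFn pk]
  have hs : (0 : ℝ) < C.encode.length := by
    have : 0 < C.encode.length := by simp [Circuit.encode]
    exact_mod_cast this
  have h3 := sq_expect_sum_le C.gates.length
    fun (O : BitString (xLen n + S.wLen n) → BitString (zLen n)) i =>
      ‖toHilb (hitState (xLen n) (List.ofFn w) O C.gates i)‖
  simp only [norm_toHilb_sq] at h3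
  set E := ∑ i ∈ Finset.range C.gates.length, 𝔼 O : BitString (xLen n + S.wLen n) →
    BitString (zLen n), normSq (hitState (xLen n) (List.ofFn w) O C.gates i) with hE
  have hE0 : 0 ≤ E := Finset.sum_nonneg fun i _ =>
    Finset.expect_nonneg fun O _ => normSq_nonneg _
  have hlen : (C.gates.length : ℝ) ≤ C.encode.length := by exact_mod_cast C.length_gates_le
  have h4 : E ≤ 8 * C.encode.length *
      outputProb (fun y : BitString 0 => y) (simCircuit C) (List.ofFn w) := by
    rw [one_div, inv_mul_le_iff₀ (by positivity)] at h2
    exact h2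
  have h5 := pow_le_pow_left₀ (abs_nonneg _) h1 2
  rw [sq_abs, mul_pow] at h5
  -- The constant is `8 ^ 2 * 8 = 512`; one factor `s` bounds the number of gates, and the other is
  -- the loss `8 * s` in choosing a query.
  refine h5.trans ((mul_le_mul_of_nonneg_left h3 (by norm_num)).trans ?_)
  have h6 := mul_le_mul hlen h4 hE0 hs.le
  generalize outputProb (fun y : BitString 0 => y) (simCircuit C) (List.ofFn w) = p at h6
  generalize E = e at h6
  linarith

theorem outputProb_nonneg {d m : ℕ} (O : BitString d → BitString m) (C : Circuit)
    (v : List Bool) : 0 ≤ outputProb O C v := normSq_nonneg _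

theorem sum_toReal_dist (S : Sampler) (n : ℕ) : ∑ t, (S.dist n t).toReal = 1 := by
  rw [← ENNReal.toReal_sum fun t _ => (S.dist n).apply_ne_top t, ← tsum_fintype (L := .unconditional _),
    (S.dist n).tsum_coe, ENNReal.toReal_one]

/-- Jensen's inequality for the square. The pointwise bound is asked for only where `p t ≠ 0`,
because the sampler guarantees a valid witness only on its support. -/
theorem sq_sum_mul_sub_le {ι : Type*} [Fintype ι] {p f g r : ι → ℝ} (hp : ∀ t, 0 ≤ p t)
    (hp1 : ∑ t, p t = 1) (h : ∀ t, p t ≠ 0 → (f t - g t) ^ 2 ≤ r t) :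
    (∑ t, p t * f t - ∑ t, p t * g t) ^ 2 ≤ ∑ t, p t * r t := by
  have h1 : (∑ t, p t * (f t - g t)) ^ 2 ≤ (∑ t, p t) * ∑ t, p t * (f t - g t) ^ 2 :=
    Finset.sum_sq_le_sum_mul_sum_of_sq_le_mul _ (fun t _ => hp t)
      (fun t _ => mul_nonneg (hp t) (sq_nonneg _)) fun t _ => by rw [mul_pow]; exact le_of_eq (by ring)
  rw [hp1, one_mul] at h1
  rw [← Finset.sum_sub_distrib]
  simp only [← mul_sub]
  refine h1.trans (Finset.sum_le_sum fun t _ => ?_)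
  by_cases ht : p t = 0
  · simp [ht]
  · exact mul_le_mul_of_nonneg_left (h t ht) (hp t)

/-- The square of the advantage is at most a polynomial times the success probability of the
reduction. -/
theorem Adversary.sq_sub_le (A : Adversary S xLen zLen) (n : ℕ) (q : ℝ)
    (hq : ∀ pk : BitString (S.pkLen n), ((A.A₁ [unary n, List.ofFn pk]).encode.length : ℝ) ≤ q) :
    (A.probReal n - A.probProg n) ^ 2 ≤
      512 * q ^ 2 * S.winProb (fun l => simCircuit (A.A₁ l)) n := by
  rw [Sampler.winProb, Sampler.expect, Finset.mul_sum]
  simp only [mul_left_comm (512 * q ^ 2)]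
  rw [Adversary.probReal, Adversary.probProg, Sampler.expect, Sampler.expect]
  refine sq_sum_mul_sub_le (fun t => ENNReal.toReal_nonneg) (sum_toReal_dist S n) fun t ht => ?_
  have hv := S.valid n t ((PMF.mem_support_iff _ _).2 fun h => ht (by rw [h, ENNReal.toReal_zero]))
  refine (A.sq_expect_sub_le n t.1 t.2.1).trans ?_
  -- The reduction is credited only for the sampled witness itself, which is one of the winning
  -- outputs.
  have h3 := Finset.single_le_sum (s := Finset.univ.filter (fun v => t.2.2 t.1 v = true))
      (f := fun v => outputProb (fun y : BitString 0 => y)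
      (simCircuit (A.A₁ [unary n, List.ofFn t.1])) (List.ofFn v))
      (fun v _ => outputProb_nonneg _ _ _)
      (Finset.mem_filter.2 ⟨Finset.mem_univ t.2.1, hv⟩)
  refine mul_le_mul ?_ h3 (outputProb_nonneg _ _ _) (by positivity)
  exact mul_le_mul_of_nonneg_left (pow_le_pow_left₀ (Nat.cast_nonneg _) (hq t.1) 2) (by norm_num)

/-- The descriptions of the circuits have polynomial length. -/
theorem Adversary.exists_length_encode_le (A : Adversary S xLen zLen) :
    ∃ q : Polynomial ℕ, ∀ (n : ℕ) (pk : BitString (S.pkLen n)),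
      (A.A₁ [unary n, List.ofFn pk]).encode.length ≤ q.eval n := by
  obtain ⟨h⟩ := A.polyTime₁
  obtain ⟨q, hq⟩ := length_le_of_polyTime h
  obtain ⟨p, hp⟩ := S.pkLen_le
  -- The encoded input consists of `n` symbols for the security parameter, at most `p.eval n` for
  -- `pk`, and two separators.
  refine ⟨q.comp (Polynomial.X + p + 2), fun n pk => (hq _).trans ?_⟩
  rw [Polynomial.eval_comp]
  refine eval_mono q ?_
  have := hp n
  simp [encodeInput, unary]
  omega

/-- The square of `n ^ k * f n` is at most `n ^ (2 * k)` times a negligible function and so tends to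
zero; then take square roots. -/
theorem negligible_of_sq_le {f g : ℕ → ℝ} (hf : ∀ n, 0 ≤ f n) (q : Polynomial ℝ)
    (hg : Negligible g) (h : ∀ n, f n ^ 2 ≤ q.eval (n : ℝ) * g n) : Negligible f := by
  intro k
  have h1 := (hg.polynomial_mul q) (2 * k)
  have h2 : Filter.Tendsto (fun n : ℕ => ((n : ℝ) ^ k * f n) ^ 2) Filter.atTop (nhds 0) := by
    refine squeeze_zero (fun n => sq_nonneg _) (fun n => ?_) h1
    rw [mul_pow, ← pow_mul, mul_comm k 2]
    exact mul_le_mul_of_nonneg_left (h n) (by positivity)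
  have h3 := h2.sqrt
  rw [Real.sqrt_zero] at h3
  refine h3.congr fun n => Real.sqrt_sq (mul_nonneg (by positivity) (hf n))

end Main

end QRO

theorem lemma1 (S : QRO.Sampler) (hS : S.WSHard) (xLen zLen : ℕ → ℕ)
    (A : QRO.Adversary S xLen zLen) :
    QRO.Negligible (fun n => |A.probReal n - A.probProg n|) := by
  obtain ⟨q, hq⟩ := A.exists_length_encode_le
  have hB := hS (fun l => QRO.simCircuit (A.A₁ l)) A.polyTime₁.simCircuit
    fun n pk => QRO.simCircuit_wellFormed (A.wellFormed₁ n pk)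
  refine QRO.negligible_of_sq_le (fun n => abs_nonneg _)
    (512 * (q.map (Nat.castRingHom ℝ)) ^ 2) hB fun n => ?_
  have h := A.sq_sub_le n (q.eval n : ℕ) fun pk => Nat.cast_le.2 (hq n pk)
  rw [sq_abs, Polynomial.eval_mul, Polynomial.eval_pow, Polynomial.eval_natCast_map,
    Polynomial.eval_ofNat]
  exact h

end
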